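/- Let $k\ge 2$, let $d\in\{k,k+1\}$, and let $T$ be the infinite rooted tree, with vertex set $V$, whose root $0$ has $d$ direct successors and all of whose other vertices have $k$ direct successors, ordered from left to right ($d=k+1$: the Cayley tree of order $k$, rooted at a vertex; $d=k$: its half-tree version). $S(x)$ is the set of direct successors of $x$, $V_n$ and $W_n$ are the sets of vertices at distance $\le n$, respectively $=n$, from the root. The soft-core Widom–Rowlinson model has configurations $\omega\in\Omega=\{-1,0,1\}^V$ and formal Hamiltonian $H(\omega)=J\sum_{\{i,j\}}\mathbf 1(\omega_i\omega_j=-1)-\frac{\ln\lambda}{\beta}\sum_i\omega_i^2$ (first sum over edges), with $\beta>0$, $J\in\mathbb R$, $\lambda>0$; put $\theta=e^{-J\beta}$. Gibbs measures are the probability measures on $\Omega$ satisfying the DLR equations, and a Gibbs measure is extreme if it is not a nontrivial convex combination of Gibbs measures. For a function $h=(h_1,h_2):V\to\mathbb R^2$, the splitting Gibbs measure built from $h$, if it exists, is the probability measure $\mu$ on $\Omega$ with, for all $n\ge1$ and $\sigma\in\{-1,0,1\}^{V_n}$, $$\mu(\omega|_{V_n}=\sigma)=\frac1{Z_n}\exp\Big(-\beta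 H_n(\sigma)+\sum_{x\in W_n}\eta_x(\sigma_x)\Big),\quad \eta_x(1)=h_{1,x}-\ln\lambda,\ \eta_x(0)=0,\ \eta_x(-1)=h_{2,x}-\ln\lambda,$$ where $H_n$ is $H$ restricted to the edges inside $V_n$ and the vertices of $V_n$. Consider the compatibility equations $$h_{1,x}=\ln\lambda+\sum_{y\in S(x)}f(h_{1,y},h_{2,y}),\qquad h_{2,x}=\ln\lambda+\sum_{y\in S(x)}f(h_{2,y},h_{1,y})\qquad(x\in V),\tag{1}$$ with $f(a,b)=\ln\frac{1+e^a+\theta e^b}{1+e^a+e^b}$, and the equations for constant solutions $$x_1=\lambda\Big(\frac{1+x_1+\theta x_2}{1+x_1+x_2}\Big)^k,\qquad x_2=\lambda\Big(\frac{1+\theta x_1+x_2}{1+x_1+x_2}\Big)^k,\qquad x_1,x_2>0.\tag{2}$$ An infinite path $\pi$ from the root is a sequence of choices $\pi_0\in\{0,\dots,d-1\}$, $\pi_n\in\{0,\dots,k-1\}$ $(n\ge1)$; it represents the number $t(\pi)=\frac1d\sum_{n\ge0}\pi_nk^{-n}\in[0,1]$ ($d=k$: the base-$k$ expansion). The vertices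 off $\pi$ split into $\Gamma_1$ (right of $\pi$) and $\Gamma_2$ (left of $\pi$). Given a solution $(x_1,x_2)$ of (2) with $x_1\ne x_2$, let $h^\pi$ denote a solution of (1) equal to $(\ln x_1,\ln x_2)$ on $\Gamma_1$ and $(\ln x_2,\ln x_1)$ on $\Gamma_2$. **Theorem.** Suppose $\frac19<\theta<\frac{k-1}{k+1}$ and $\lambda>\lambda_{\rm cr}(k):=\frac{1}{k-1-\theta(k+1)}\big(\frac{k+1}{k}\big)^k$. Then (2) has a solution with $x_1<x_2$; every path represents a number in $[0,1]$, and every $t\in[0,1]$ is represented by some path. Moreover, for every solution $(x_1,x_2)$ of (2) with $x_1\neq x_2$: 1. The splitting Gibbs measures $\mu_1^*$ and $\mu_2^*$ built from the constant functions $(\ln x_1,\ln x_2)$ and $(\ln x_2,\ln x_1)$ exist and are unique. 2. For every path $\pi$ there is exactly one $h^\pi$, and it depends only on $t(\pi)$; write $h^{\pi(t)}$ for $h^\pi$ when $t(\pi)=t$. 3. For every $t\in[0,1]$ the splitting Gibbs measure $\mu(t)$ built from $h^{\pi(t)}$ exists, is unique, and is an extreme Gibbs measure; $\mu(0)=\mu_1^*$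 and $\mu(1)=\mu_2^*$. 4. The measures $\mu(t)$, $t\in[0,1]$, are pairwise distinct, and for $0<t<1$ the measure $\mu(t)$ is non-periodic: it is not invariant under any group of automorphisms of $T$ that has finitely many orbits on $V$. -/

import Mathlib

open scoped NNReal ENNReal

noncomputable section

namespace WidomRowlinson

/-! ### The rooted Cayley tree -/

/-- Number of direct successors of a vertex at distance `n` from the root: the root has `d` direct
successors and every other vertex has `k`. A Cayley tree of order `k` rooted at one of its vertices
is the case `d = k + 1`; the half tree is the case `d = k`. -/
def branching (k d n : ℕ) : ℕ := if n = 0 then d else k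

/-- A vertex is coded by the list of choices leading to it from the root, latest choice first. -/
def IsVertex (k d : ℕ) : List ℕ → Prop
  | [] => True
  | c :: l => c < branching k d l.length ∧ IsVertex k d l

@[ext]
structure Vertex (k d : ℕ) where
  code : List ℕ
  isVertex : IsVertex k d code

instance (k d : ℕ) : DecidableEq (Vertex k d) := fun _ _ =>
  decidable_of_iff _ Vertex.ext_iff.symm

variable {k d : ℕ}

namespace Vertex

def root : Vertex k d := ⟨[], trivial⟩

/-- Distance to the root. -/
def level (x : Vertex k d) : ℕ := x.code.length

/-- The direct successors of `x` are `x.child c`, ordered from left to right by `c`. -/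
def child (x : Vertex k d) (c : Fin (branching k d x.level)) : Vertex k d :=
  ⟨(c : ℕ) :: x.code, c.2, x.isVertex⟩

theorem isVertex_tail : ∀ {l : List ℕ}, IsVertex k d l → IsVertex k d l.tail
  | [], h => h
  | _ :: _, h => h.2

/-- The neighbour of `x` closer to the root; by convention the parent of the root is the root. -/
def parent (x : Vertex k d) : Vertex k d := ⟨x.code.tail, isVertex_tail x.isVertex⟩

end Vertex

/-- The Cayley tree as a graph. -/
def tree (k d : ℕ) : SimpleGraph (Vertex k d) :=
  SimpleGraph.fromRel fun x y => y.parent = x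

/-- All direct successors of the vertices in a finite set. -/
def children (Λ : Finset (Vertex k d)) : Finset (Vertex k d) :=
  Λ.biUnion fun x => Finset.univ.image x.child

/-- `V_n`: the vertices at distance at most `n` from the root. -/
def ball (k d : ℕ) : ℕ → Finset (Vertex k d)
  | 0 => {Vertex.root}
  | n + 1 => ball k d n ∪ children (ball k d n)

theorem mem_ball (n : ℕ) (x : Vertex k d) : x ∈ ball k d n ↔ x.level ≤ n := by
  induction n generalizing x with
  | zero =>
    obtain ⟨l, hl⟩ := x
    simp [ball, Vertex.root, Vertex.level, Vertex.ext_iff]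
  | succ n ih =>
    simp only [ball, children, Finset.mem_union, Finset.mem_biUnion, Finset.mem_image,
      Finset.mem_univ, true_and, ih]
    constructor
    · rintro (h | ⟨y, hy, c, rfl⟩)
      · omega
      · simp only [Vertex.level, Vertex.child, List.length_cons] at hy ⊢
        omega
    · intro h
      obtain ⟨l, hl⟩ := x
      cases l with
      | nil => left; simp [Vertex.level]
      | cons c l =>
        right
        refine ⟨⟨l, hl.2⟩, ?_, ⟨c, hl.1⟩, rfl⟩
        simp only [Vertex.level, List.length_cons] at h ⊢
        omega

/-- `W_n`: the vertices at distance exactly `n` from the root. -/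
def sphere (k d n : ℕ) : Finset (Vertex k d) := (ball k d n).filter fun x => x.level = n

/-! ### The soft-core Widom-Rowlinson model -/

/-- Configurations; the spin space `{-1, 0, 1}` is `SignType`. -/
abbrev Config (k d : ℕ) : Type := Vertex k d → SignType

instance : MeasurableSpace SignType := ⊤

/-- The configuration equal to `ξ` on `Λ` and to `ω` off `Λ`. -/
def glue (Λ : Finset (Vertex k d)) (ξ : Λ → SignType) (ω : Config k d) : Config k d :=
  fun x => if h : x ∈ Λ then ξ ⟨x, h⟩ else ω x

/-- Indicator that the spins at the ends of the edge `{y.parent, y}` have product `-1`.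
Every edge has exactly one such `y`; for the root the value is `0`, as a square is not `-1`. -/
def bond (ω : Config k d) (y : Vertex k d) : ℝ := if ω y.parent * ω y = -1 then 1 else 0

/-- The Hamiltonian `J ∑ 1(ω_i ω_j = -1) - (ln λ / β) ∑ ω_i²`, with the first sum over the edges
whose lower end is in `E` and the second one over the vertices in `Λ`. -/
def energy (J β lam : ℝ) (E Λ : Finset (Vertex k d)) (ω : Config k d) : ℝ :=
  J * ∑ y ∈ E, bond ω y - Real.log lam / β * ∑ x ∈ Λ, (ω x : ℝ) ^ 2

/-- The Hamiltonian of step `n`: all edges inside `V_n` and all vertices of `V_n`. -/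
def hamiltonian (J β lam : ℝ) (n : ℕ) (ω : Config k d) : ℝ :=
  energy J β lam (ball k d n) (ball k d n) ω

/-- Unnormalised weight of the finite-volume measure on `V_n` with external fields `η` on `W_n`. -/
def weight (J β lam : ℝ) (η : Vertex k d → SignType → ℝ) (n : ℕ) (ω : Config k d) : ℝ :=
  Real.exp (-β * hamiltonian J β lam n ω + ∑ x ∈ sphere k d n, η x (ω x))

/-- The finite-volume Gibbs measure on `V_n` (it depends on `σ` only through `V_n`). -/
def finiteGibbs (J β lam : ℝ) (η : Vertex k d → SignType → ℝ) (n : ℕ) (σ : Config k d) : ℝ :=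
  weight J β lam η n σ /
    ∑ ξ : ball k d n → SignType, weight J β lam η n (glue (ball k d n) ξ fun _ => 0)

/-- The external fields with `ln λ + h_{1,x} - h_{0,x} = (h x).1`,
`ln λ + h_{-1,x} - h_{0,x} = (h x).2`, normalised by `h_{0,x} = 0`. (The finite-volume measures do
not depend on this normalisation.) -/
def fields (lam : ℝ) (h : Vertex k d → ℝ × ℝ) (x : Vertex k d) : SignType → ℝ
  | .pos => (h x).1 - Real.log lam
  | .zero => 0
  | .neg => (h x).2 - Real.log lam

/-- `μ` is the splitting Gibbs measure built from `h`. -/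
def IsSplittingGibbs (J β lam : ℝ) (h : Vertex k d → ℝ × ℝ)
    (μ : MeasureTheory.Measure (Config k d)) : Prop :=
  MeasureTheory.IsProbabilityMeasure μ ∧
    ∀ n : ℕ, 1 ≤ n → ∀ σ : Config k d,
      μ.real {ω | ∀ x ∈ ball k d n, ω x = σ x} = finiteGibbs J β lam (fields lam h) n σ

/-- Boltzmann weight in the finite volume `Λ`: all edges meeting `Λ`, all vertices of `Λ`. -/
def boltzmann (J β lam : ℝ) (Λ : Finset (Vertex k d)) (ω : Config k d) : ℝ :=
  Real.exp (-β * energy J β lam (Λ ∪ children Λ) Λ ω)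

/-- The Gibbsian specification: probability of `A` given the configuration `ω` off `Λ`. -/
def gibbsKernel (J β lam : ℝ) (Λ : Finset (Vertex k d)) (ω : Config k d)
    (A : Set (Config k d)) : ℝ≥0∞ :=
  ∑ ξ : Λ → SignType,
    ENNReal.ofReal (boltzmann J β lam Λ (glue Λ ξ ω) /
      ∑ ξ' : Λ → SignType, boltzmann J β lam Λ (glue Λ ξ' ω)) *
    A.indicator 1 (glue Λ ξ ω)

/-- The set of Gibbs measures of the model (probability measures satisfying the
Dobrushin-Lanford-Ruelle equations). -/
def gibbsMeasures (k d : ℕ) (J β lam : ℝ) : Set (MeasureTheory.Measure (Config k d)) :=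
  {μ | MeasureTheory.IsProbabilityMeasure μ ∧
    ∀ (Λ : Finset (Vertex k d)) (A : Set (Config k d)), MeasurableSet A →
      μ A = ∫⁻ ω, gibbsKernel J β lam Λ ω A ∂μ}

/-- Extreme Gibbs measures: not a nontrivial convex combination of Gibbs measures. -/
def IsExtremeGibbs (J β lam : ℝ) (μ : MeasureTheory.Measure (Config k d)) : Prop :=
  μ ∈ Set.extremePoints ℝ≥0 (gibbsMeasures k d J β lam)

/-- `μ` is periodic: it is invariant under some group of automorphisms of the tree with only
finitely many vertex orbits (such as a finite-index subgroup of a transitive group). -/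
def IsPeriodic (μ : MeasureTheory.Measure (Config k d)) : Prop :=
  ∃ H : Subgroup (tree k d ≃g tree k d),
    (∃ F : Finset (Vertex k d), ∀ x, ∃ y ∈ F, ∃ g ∈ H, g y = x) ∧
      ∀ g ∈ H, μ.map (fun (ω : Config k d) (x : Vertex k d) => ω (g x)) = μ

/-! ### Boundary laws and infinite paths -/

def lawMap (x y θ : ℝ) : ℝ :=
  Real.log ((1 + Real.exp x + θ * Real.exp y) / (1 + Real.exp x + Real.exp y))

/-- The compatibility equations at every vertex. -/
def IsBoundaryLaw (lam θ : ℝ) (h : Vertex k d → ℝ × ℝ) : Prop :=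
  ∀ x : Vertex k d,
    (h x).1 = Real.log lam + ∑ c, lawMap (h (x.child c)).1 (h (x.child c)).2 θ ∧
    (h x).2 = Real.log lam + ∑ c, lawMap (h (x.child c)).2 (h (x.child c)).1 θ

/-- `(x, y)` is a positive solution of the equations for translation-invariant boundary laws. -/
def IsConstantSolution (k : ℕ) (lam θ x y : ℝ) : Prop :=
  0 < x ∧ 0 < y ∧
    x = lam * ((1 + x + θ * y) / (1 + x + y)) ^ k ∧
    y = lam * ((1 + θ * x + y) / (1 + x + y)) ^ k

/-- An infinite path from the root, moving away from it; `step n` is the `n`-th choice. -/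
structure RootPath (k d : ℕ) where
  step : ℕ → ℕ
  step_lt : ∀ n, step n < branching k d n

namespace RootPath

/-- The list coding the `n`-th vertex of the path. -/
def word (π : RootPath k d) : ℕ → List ℕ
  | 0 => []
  | n + 1 => π.step n :: π.word n

/-- `x` lies to the right of the path: it is, or descends from, a right sibling of a path vertex
(being a descendant means that the code is extended at its front). -/
def IsRight (π : RootPath k d) (x : Vertex k d) : Prop :=
  ∃ n c, π.step n < c ∧ (c :: π.word n) <:+ x.code

/-- `x` lies to the left of the path. -/
def IsLeft (π : RootPath k d) (x : Vertex k d) : Prop :=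
  ∃ n c, c < π.step n ∧ (c :: π.word n) <:+ x.code

/-- The number `t ∈ [0,1]` represented by the path: first digit in base `d`, all later digits in
base `k`. For `d = k` this is the usual base-`k` expansion `∑ π_n / k^(n+1)`. -/
def number (π : RootPath k d) : ℝ := (∑' n, (π.step n : ℝ) / (k : ℝ) ^ n) / d

end RootPath

/-- `h` is a function `h^π`: it solves the compatibility equations, is `(ln x₁, ln x₂)` on the part
`Γ₁` of the tree to the right of `π`, and `(ln x₂, ln x₁)` on the part `Γ₂` to the left of `π`. -/
def IsPathLaw (lam θ x₁ x₂ : ℝ) (π : RootPath k d) (h : Vertex k d → ℝ × ℝ) : Prop :=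
  IsBoundaryLaw lam θ h ∧
    (∀ x, π.IsRight x → h x = (Real.log x₁, Real.log x₂)) ∧
    (∀ x, π.IsLeft x → h x = (Real.log x₂, Real.log x₁))

/-- The critical activity. -/
def lamCr (k : ℕ) (θ : ℝ) : ℝ :=
  1 / ((k : ℝ) - 1 - θ * ((k : ℝ) + 1)) * (((k : ℝ) + 1) / k) ^ k

end WidomRowlinson

end

open WidomRowlinson

namespace WidomRowlinson

noncomputable section

/-! ### Edge weights, boundary laws at a vertex and transition probabilities -/

/-! The splitting Gibbs measure of a solution `h` of (1) is a Markov chain indexed by the tree, with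
transition probabilities `trans θ (h x)` from the parent of `x` to `x`. Two properties of `msg θ`,
through which a child enters (1), carry the proof. It is Lipschitz for the sup norm with constant
2(1-√θ)/(1+√θ), which is below 1 exactly when θ > 1/9, and it is monotone for the order that raises
the first component and lowers the second.

Path laws. At a path vertex only the child on the path has an unprescribed value, so (1) along the
path is a contraction of bounded sequences, and (1) itself confines all solutions to a fixed box.
Hence h^π exists and is unique (`exists_isPathLaw`, `isPathLaw_unique`). Distinct paths have equal
numbers only if they split by consecutive choices, the left one then staying rightmost and the right
one leftmost. All later siblings of the left path lie on its left and carry one constant solution,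
so by uniqueness its tail carries it too, and the two paths have the same law.

Constant solutions. Let x₁ < x₂ solve (2), let ρ² be the ratio of the numerators in (2), v = ρ + 1/ρ
and U_j = `cheb v j`. Then x₁ = ρ^(-k)/D and x₂ = ρ^k/D with D = U_{k-2} - θ U_k, and λ = U_k^k /
(U_{k-1}^k D). Where D > 0 this λ is strictly increasing in v, so there is at most one such
solution; its value at v = 2 is λ_cr, so above λ_cr there is one.

Extremality. Given the spins off V_n, the inside of V_n is again a Markov chain, with the random
weights `ballField`. They are dominated by the weights for the boundary condition with all spins 1,
which decrease to a constant solution; by uniqueness it is the asymmetric one. So off the path the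
random weights have a one-sided deterministic bound that converges to `h`. Gibbs measures reproduce
means of conditional probabilities, and a one-sided bound attained in the limit mean forces
convergence in L¹. Contraction carries the convergence to the path. If aν ≤ μ with a > 0, then L¹
convergence under μ implies it under ν, so ν and μ agree on cylinders.

Distinctness and non-periodicity. The ratio of the probabilities of (0, 1) and (0, 0) at a vertex
and its child is the exponential of the first component of `h` at the child, so the measure
determines that component off the root. A group with finitely many orbits moves one edge both to the
right and to the left of the path, where the ratios are x₁ and x₂. -/

theorem sum_signType {M : Type*} [AddCommMonoid M] (f : SignType → M) :
    ∑ s, f s = f 0 + f (-1) + f 1 := by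
  rw [SignType.univ_eq, Finset.sum_insert (by decide), Finset.sum_insert (by decide),
    Finset.sum_singleton, add_assoc]

/-- Boltzmann weight of an edge whose ends carry the spins `s` and `s'`. -/
def edgeWeight (θ : ℝ) (s s' : SignType) : ℝ := if s * s' = -1 then θ else 1

/-- Boltzmann weight of a vertex with spin `s`. -/
def activity (lam : ℝ) (s : SignType) : ℝ := if s = 0 then 1 else lam

/-- The positive weights on the spin space coded by `h`, normalised to be `1` at `0`. -/
def law (h : ℝ × ℝ) : SignType → ℝ
  | .pos => Real.exp h.1
  | .zero => 1
  | .neg => Real.exp h.2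

/-- Sum over the spins of a vertex with weights `law h`, given the spin `s` of its parent. -/
def partition (θ : ℝ) (h : ℝ × ℝ) (s : SignType) : ℝ := ∑ s', edgeWeight θ s s' * law h s'

/-- Transition probability from a parent with spin `s` to a child with weights `law h`. -/
def trans (θ : ℝ) (h : ℝ × ℝ) (s s' : SignType) : ℝ :=
  edgeWeight θ s s' * law h s' / partition θ h s

/-- The contribution of a child with weights `law h` to the compatibility equation. -/
def msg (θ : ℝ) (h : ℝ × ℝ) : ℝ × ℝ := (lawMap h.1 h.2 θ, lawMap h.2 h.1 θ)

@[simp] theorem law_one (h : ℝ × ℝ) : law h 1 = Real.exp h.1 := rfl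
@[simp] theorem law_zero (h : ℝ × ℝ) : law h 0 = 1 := rfl
@[simp] theorem law_neg_one (h : ℝ × ℝ) : law h (-1) = Real.exp h.2 := rfl

theorem law_pos (h : ℝ × ℝ) (s : SignType) : 0 < law h s := by
  cases s <;> simp [law, Real.exp_pos]

theorem edgeWeight_pos {θ : ℝ} (hθ : 0 < θ) (s s' : SignType) : 0 < edgeWeight θ s s' := by
  unfold edgeWeight; split_ifs <;> simp [hθ]

@[simp] theorem edgeWeight_zero_left (θ : ℝ) (s : SignType) : edgeWeight θ 0 s = 1 := by
  cases s <;> rfl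

theorem activity_pos {lam : ℝ} (hl : 0 < lam) (s : SignType) : 0 < activity lam s := by
  unfold activity; split_ifs <;> simp [hl]

theorem partition_zero (θ : ℝ) (h : ℝ × ℝ) :
    partition θ h 0 = 1 + Real.exp h.1 + Real.exp h.2 := by
  simp [partition, sum_signType]; ring

theorem partition_one (θ : ℝ) (h : ℝ × ℝ) :
    partition θ h 1 = 1 + Real.exp h.1 + θ * Real.exp h.2 := by
  simp [partition, sum_signType, edgeWeight]
  ring

theorem partition_neg_one (θ : ℝ) (h : ℝ × ℝ) :
    partition θ h (-1) = 1 + Real.exp h.2 + θ * Real.exp h.1 := by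
  simp [partition, sum_signType, edgeWeight]

theorem partition_pos {θ : ℝ} (hθ : 0 < θ) (h : ℝ × ℝ) (s : SignType) : 0 < partition θ h s :=
  Finset.sum_pos (fun s' _ => mul_pos (edgeWeight_pos hθ s s') (law_pos h s')) ⟨0, by simp⟩

theorem trans_pos {θ : ℝ} (hθ : 0 < θ) (h : ℝ × ℝ) (s s' : SignType) : 0 < trans θ h s s' :=
  div_pos (mul_pos (edgeWeight_pos hθ s s') (law_pos h s')) (partition_pos hθ h s)

theorem sum_trans {θ : ℝ} (hθ : 0 < θ) (h : ℝ × ℝ) (s : SignType) : ∑ s', trans θ h s s' = 1 := by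
  unfold trans
  rw [← Finset.sum_div]
  exact div_self (partition_pos hθ h s).ne'

theorem trans_le_one {θ : ℝ} (hθ : 0 < θ) (h : ℝ × ℝ) (s s' : SignType) : trans θ h s s' ≤ 1 := by
  rw [← sum_trans hθ h s]
  exact Finset.single_le_sum (fun i _ => (trans_pos hθ h s i).le) (Finset.mem_univ s')

theorem exp_msg_fst {θ : ℝ} (hθ : 0 < θ) (h : ℝ × ℝ) :
    Real.exp (msg θ h).1 = partition θ h 1 / partition θ h 0 := by
  rw [partition_one, partition_zero, msg, lawMap, Real.exp_log (by positivity)]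

theorem exp_msg_snd {θ : ℝ} (hθ : 0 < θ) (h : ℝ × ℝ) :
    Real.exp (msg θ h).2 = partition θ h (-1) / partition θ h 0 := by
  rw [partition_neg_one, partition_zero, msg]
  simp only [lawMap]
  rw [Real.exp_log (by positivity)]
  ring

/-! ### Bounds, monotonicity and contraction of the messages. -/

theorem lawMap_nonpos {θ : ℝ} (hθ : 0 < θ) (hθ1 : θ ≤ 1) (a b : ℝ) : lawMap a b θ ≤ 0 := by
  unfold lawMap
  apply Real.log_nonpos (by positivity)
  rw [div_le_one (by positivity)]
  nlinarith [Real.exp_pos b]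

theorem log_le_lawMap {θ : ℝ} (hθ : 0 < θ) (hθ1 : θ ≤ 1) (a b : ℝ) :
    Real.log θ ≤ lawMap a b θ := by
  unfold lawMap
  apply Real.log_le_log hθ
  rw [le_div_iff₀ (by positivity)]
  nlinarith [Real.exp_pos a]

/-- For θ ≤ 1 the opposite spin is penalised, so raising the weight of a spin and lowering that of
its opposite helps it in the parent. Applied to both components, this makes `msg θ` monotone for the
order used to compare boundary conditions. -/
theorem lawMap_mono {θ : ℝ} (hθ : 0 < θ) (hθ1 : θ ≤ 1) {a a' b b' : ℝ} (ha : a ≤ a')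
    (hb : b' ≤ b) : lawMap a b θ ≤ lawMap a' b' θ := by
  unfold lawMap
  apply Real.log_le_log (by positivity)
  rw [div_le_div_iff₀ (by positivity) (by positivity)]
  have h1 := Real.exp_le_exp.2 ha
  have h2 := Real.exp_le_exp.2 hb
  have h3 := Real.exp_pos a
  have h4 := Real.exp_pos b'
  have h5 : 0 ≤ (1 - θ) * (Real.exp b * (1 + Real.exp a') - Real.exp b' * (1 + Real.exp a)) := by
    apply mul_nonneg (by linarith)
    have : Real.exp b' * (1 + Real.exp a) ≤ Real.exp b * (1 + Real.exp a') := by gcongr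
    linarith
  nlinarith

/-- The contraction constant of `msg`. -/
def contraction (θ : ℝ) : ℝ := 2 * ((1 - √θ) / (1 + √θ))

theorem contraction_nonneg {θ : ℝ} (hθ1 : θ ≤ 1) : 0 ≤ contraction θ := by
  have : √θ ≤ 1 := Real.sqrt_le_one.2 hθ1
  have := Real.sqrt_nonneg θ
  unfold contraction
  apply mul_nonneg zero_le_two (div_nonneg _ _) <;> linarith

theorem contraction_lt_one {θ : ℝ} (hθ : 1 / 9 < θ) : contraction θ < 1 := by
  have h : 1 / 3 < √θ := Real.lt_sqrt_of_sq_lt (by norm_num; linarith)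
  unfold contraction
  rw [← mul_div_assoc, div_lt_one (by linarith)]
  linarith

/-- Both partial derivatives of `lawMap` have this shape with u = 1 + e^a and B = e^b; c is e^a for
the first variable and u for the second. By AM-GM, with s = √θ, the denominator is at least (1 + s)²
u B, with equality at u = s B. -/
theorem slope_le_contraction {θ : ℝ} (hθ : 0 < θ) (hθ1 : θ ≤ 1) {u B c : ℝ} (hB : 0 < B)
    (hcu : c ≤ u) (hu : 0 < u) :
    (1 - θ) * c * B / ((u + θ * B) * (u + B)) ≤ contraction θ / 2 := by
  obtain ⟨s, hs, rfl⟩ : ∃ s : ℝ, 0 < s ∧ θ = s ^ 2 :=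
    ⟨√θ, Real.sqrt_pos.2 hθ, (Real.sq_sqrt hθ.le).symm⟩
  have hs1 : s ≤ 1 := by nlinarith
  rw [contraction, Real.sqrt_sq hs.le, mul_div_cancel_left₀ _ two_ne_zero,
    div_le_div_iff₀ (by positivity) (by positivity)]
  have h1 : (1 + s) ^ 2 * (u * B) ≤ (u + s ^ 2 * B) * (u + B) := by
    nlinarith [sq_nonneg (u - s * B)]
  have h2 : (1 + s) ^ 2 * (c * B) ≤ (u + s ^ 2 * B) * (u + B) := by
    refine le_trans ?_ h1
    gcongr
  have := mul_le_mul_of_nonneg_left h2 (sub_nonneg.2 hs1)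
  nlinarith

theorem abs_sub_le_of_deriv {f f' : ℝ → ℝ} {C : ℝ} (hf : ∀ x, HasDerivAt f (f' x) x)
    (hC : ∀ x, |f' x| ≤ C) (x y : ℝ) : |f x - f y| ≤ C * |x - y| := by
  simpa using Convex.norm_image_sub_le_of_norm_hasDerivWithin_le
    (fun x _ => (hf x).hasDerivWithinAt) (fun x _ => hC x) convex_univ
    (Set.mem_univ y) (Set.mem_univ x)

theorem abs_lawMap_sub_left {θ : ℝ} (hθ : 0 < θ) (hθ1 : θ ≤ 1) (a a' b : ℝ) :
    |lawMap a b θ - lawMap a' b θ| ≤ contraction θ / 2 * |a - a'| := by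
  refine abs_sub_le_of_deriv (f := fun a => lawMap a b θ)
    (f' := fun a => (1 - θ) * Real.exp a * Real.exp b /
      ((1 + Real.exp a + θ * Real.exp b) * (1 + Real.exp a + Real.exp b))) (fun x => ?_)
    (fun x => ?_) a a'
  · have h1 : HasDerivAt (fun a => 1 + Real.exp a + θ * Real.exp b) (Real.exp x) x :=
      ((Real.hasDerivAt_exp x).const_add 1).add_const _
    have h2 : HasDerivAt (fun a => 1 + Real.exp a + Real.exp b) (Real.exp x) x :=
      ((Real.hasDerivAt_exp x).const_add 1).add_const _
    have hp1 : 1 + Real.exp x + θ * Real.exp b ≠ 0 := by positivity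
    have hp2 : 1 + Real.exp x + Real.exp b ≠ 0 := by positivity
    refine HasDerivAt.congr_deriv ((h1.div h2 hp2).log (div_ne_zero hp1 hp2)) ?_
    simp only [Pi.div_apply]
    field_simp
    ring
  · have h : 0 ≤ (1 - θ) * Real.exp x * Real.exp b /
      ((1 + Real.exp x + θ * Real.exp b) * (1 + Real.exp x + Real.exp b)) := by
      have : 0 ≤ 1 - θ := by linarith
      positivity
    rw [abs_of_nonneg h]
    exact slope_le_contraction hθ hθ1 (Real.exp_pos b) (by linarith) (by positivity)

theorem abs_lawMap_sub_right {θ : ℝ} (hθ : 0 < θ) (hθ1 : θ ≤ 1) (a b b' : ℝ) :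
    |lawMap a b θ - lawMap a b' θ| ≤ contraction θ / 2 * |b - b'| := by
  refine abs_sub_le_of_deriv (f := fun b => lawMap a b θ)
    (f' := fun b => -((1 - θ) * (1 + Real.exp a) * Real.exp b /
      ((1 + Real.exp a + θ * Real.exp b) * (1 + Real.exp a + Real.exp b)))) (fun x => ?_)
    (fun x => ?_) b b'
  · have h1 : HasDerivAt (fun b => 1 + Real.exp a + θ * Real.exp b) (θ * Real.exp x) x :=
      ((Real.hasDerivAt_exp x).const_mul θ).const_add _
    have h2 : HasDerivAt (fun b => 1 + Real.exp a + Real.exp b) (Real.exp x) x :=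
      (Real.hasDerivAt_exp x).const_add _
    have hp1 : 1 + Real.exp a + θ * Real.exp x ≠ 0 := by positivity
    have hp2 : 1 + Real.exp a + Real.exp x ≠ 0 := by positivity
    refine HasDerivAt.congr_deriv ((h1.div h2 hp2).log (div_ne_zero hp1 hp2)) ?_
    simp only [Pi.div_apply]
    field_simp
    ring
  · have h : 0 ≤ (1 - θ) * (1 + Real.exp a) * Real.exp x /
      ((1 + Real.exp a + θ * Real.exp x) * (1 + Real.exp a + Real.exp x)) := by
      have : 0 ≤ 1 - θ := by linarith
      positivity
    rw [abs_neg, abs_of_nonneg h]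
    exact slope_le_contraction hθ hθ1 (Real.exp_pos x) le_rfl (by positivity)

/-- Changing one variable at a time costs half of the constant twice; this is the source of the
factor 2 in `contraction` and so of the threshold 1/9. -/
theorem abs_lawMap_sub_le {θ : ℝ} (hθ : 0 < θ) (hθ1 : θ ≤ 1) (a a' b b' : ℝ) :
    |lawMap a b θ - lawMap a' b' θ| ≤ contraction θ * max |a - a'| |b - b'| := by
  have h := abs_sub_le (lawMap a b θ) (lawMap a' b θ) (lawMap a' b' θ)
  have h1 := abs_lawMap_sub_left hθ hθ1 a a' b
  have h2 := abs_lawMap_sub_right hθ hθ1 a' b b'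
  have hq := contraction_nonneg hθ1
  have h3 := mul_le_mul_of_nonneg_left (le_max_left |a - a'| |b - b'|) (half_pos_of hq)
  have h4 := mul_le_mul_of_nonneg_left (le_max_right |a - a'| |b - b'|) (half_pos_of hq)
  linarith
where
  half_pos_of {q : ℝ} (hq : 0 ≤ q) : 0 ≤ q / 2 := by linarith

theorem dist_msg_le {θ : ℝ} (hθ : 0 < θ) (hθ1 : θ ≤ 1) (h h' : ℝ × ℝ) :
    dist (msg θ h) (msg θ h') ≤ contraction θ * dist h h' := by
  rw [Prod.dist_eq, Prod.dist_eq]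
  simp only [Real.dist_eq, msg]
  refine max_le (abs_lawMap_sub_le hθ hθ1 _ _ _ _) ?_
  rw [max_comm]
  exact abs_lawMap_sub_le hθ hθ1 _ _ _ _

theorem continuous_msg {θ : ℝ} (hθ : 0 < θ) (hθ1 : θ ≤ 1) : Continuous (msg θ) :=
  (LipschitzWith.of_dist_le_mul (K := ⟨contraction θ, contraction_nonneg hθ1⟩)
    (dist_msg_le hθ hθ1)).continuous

theorem msg_mem_Icc {θ : ℝ} (hθ : 0 < θ) (hθ1 : θ ≤ 1) (h : ℝ × ℝ) :
    msg θ h ∈ Set.Icc ((Real.log θ, Real.log θ) : ℝ × ℝ) 0 :=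
  ⟨⟨log_le_lawMap hθ hθ1 _ _, log_le_lawMap hθ hθ1 _ _⟩,
    ⟨lawMap_nonpos hθ hθ1 _ _, lawMap_nonpos hθ hθ1 _ _⟩⟩

@[simp] theorem msg_swap (θ : ℝ) (h : ℝ × ℝ) : msg θ h.swap = (msg θ h).swap := rfl

theorem law_le_exp_dist (h h' : ℝ × ℝ) (s : SignType) :
    law h s ≤ Real.exp (dist h h') * law h' s := by
  have h1 : h.1 - h'.1 ≤ dist h h' := by
    rw [Prod.dist_eq]; exact (le_abs_self _).trans (le_max_left _ _)
  have h2 : h.2 - h'.2 ≤ dist h h' := by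
    rw [Prod.dist_eq]; exact (le_abs_self _).trans (le_max_right _ _)
  cases s with
  | zero => simp [law]
  | neg => simp only [law, ← Real.exp_add]; exact Real.exp_le_exp.2 (by linarith)
  | pos => simp only [law, ← Real.exp_add]; exact Real.exp_le_exp.2 (by linarith)

/-- Numerator and normalisation each change by a factor at most exp(δ), where δ is the distance of
the weights. So the probability changes by a factor at most exp(2δ), and 1 - exp(-2δ) ≤ 2δ. -/
theorem trans_sub_le {θ : ℝ} (hθ : 0 < θ) (h h' : ℝ × ℝ) (s s' : SignType) :
    trans θ h s s' - trans θ h' s s' ≤ 2 * dist h h' := by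
  have hZ : partition θ h' s ≤ Real.exp (dist h h') * partition θ h s := by
    unfold partition
    rw [Finset.mul_sum]
    refine Finset.sum_le_sum fun i _ => ?_
    have := mul_le_mul_of_nonneg_left (law_le_exp_dist h' h i) (edgeWeight_pos hθ s i).le
    rw [dist_comm] at this
    linarith
  have hP : trans θ h s s' ≤ Real.exp (2 * dist h h') * trans θ h' s s' := by
    unfold trans
    rw [div_le_iff₀ (partition_pos hθ h s)]
    have h1 := mul_le_mul_of_nonneg_left (law_le_exp_dist h h' s') (edgeWeight_pos hθ s s').le
    refine h1.trans ?_
    have h2 : 0 ≤ Real.exp (dist h h') * (edgeWeight θ s s' * law h' s') / partition θ h' s :=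
      div_nonneg (mul_nonneg (Real.exp_pos _).le
        (mul_pos (edgeWeight_pos hθ s s') (law_pos h' s')).le) (partition_pos hθ h' s).le
    have h3 := mul_le_mul_of_nonneg_left hZ h2
    rw [div_mul_cancel₀ _ (partition_pos hθ h' s).ne'] at h3
    rw [two_mul, Real.exp_add]
    calc _ = Real.exp (dist h h') * (edgeWeight θ s s' * law h' s') := by ring
      _ ≤ _ := h3
      _ = _ := by ring
  have h1 := trans_le_one hθ h s s'
  have h0 := (trans_pos hθ h s s').le
  have h2 : Real.exp (-(2 * dist h h')) * trans θ h s s' ≤ trans θ h' s s' := by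
    rw [Real.exp_neg, inv_mul_le_iff₀ (Real.exp_pos _)]; exact hP
  have h3 := Real.add_one_le_exp (-(2 * dist h h'))
  have h4 := dist_nonneg (x := h) (y := h')
  nlinarith

theorem abs_trans_sub_le {θ : ℝ} (hθ : 0 < θ) (h h' : ℝ × ℝ) (s s' : SignType) :
    |trans θ h s s' - trans θ h' s s'| ≤ 2 * dist h h' := by
  refine abs_sub_le_iff.2 ⟨trans_sub_le hθ h h' s s', ?_⟩
  rw [dist_comm]
  exact trans_sub_le hθ h' h s s'

end

end WidomRowlinson

namespace WidomRowlinson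

noncomputable section

/-! ### Constant solutions -/

/-- Rescaled Chebyshev polynomials of the second kind: `cheb (ρ + ρ⁻¹) j` is the sum of
`ρ ^ (j - 2 * i)` over `0 ≤ i ≤ j`. -/
def cheb (v : ℝ) : ℕ → ℝ
  | 0 => 1
  | 1 => v
  | j + 2 => v * cheb v (j + 1) - cheb v j

@[simp] theorem cheb_zero (v : ℝ) : cheb v 0 = 1 := rfl

theorem cheb_add_two (v : ℝ) (j : ℕ) : cheb v (j + 2) = v * cheb v (j + 1) - cheb v j := rfl

theorem continuous_cheb (j : ℕ) : Continuous fun v => cheb v j := by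
  induction j using Nat.strong_induction_on with
  | _ j ih =>
    match j with
    | 0 => exact continuous_const
    | 1 => exact continuous_id
    | j + 2 =>
      exact (continuous_id.mul (ih (j + 1) (by omega))).sub (ih j (by omega))

theorem cheb_two (j : ℕ) : cheb 2 j = j + 1 ∧ cheb 2 (j + 1) = j + 2 := by
  induction j with
  | zero => exact ⟨by simp, by simp [cheb]⟩
  | succ j ih =>
    refine ⟨by rw [ih.2]; push_cast; ring, ?_⟩
    rw [cheb_add_two, ih.1, ih.2]; push_cast; ring

theorem cheb_pos_le {v : ℝ} (hv : 2 ≤ v) (j : ℕ) : 0 < cheb v j ∧ cheb v j ≤ cheb v (j + 1) := by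
  induction j with
  | zero => exact ⟨by simp, by simp [cheb]; linarith⟩
  | succ j ih =>
    have h : 0 < cheb v (j + 1) := ih.1.trans_le ih.2
    refine ⟨h, ?_⟩
    rw [cheb_add_two]
    nlinarith [ih.2]

/-- A Cassini-type identity. It turns the quotient of successive ratios into 1 - 1/U², whose
monotonicity in v is evident. -/
theorem cheb_sq_sub (v : ℝ) (j : ℕ) : cheb v (j + 1) ^ 2 - cheb v (j + 2) * cheb v j = 1 := by
  induction j with
  | zero => simp [cheb]; ring
  | succ j ih =>
    rw [← ih, cheb_add_two v (j + 1)]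
    have := cheb_add_two v j
    rw [this]; ring

/-- Quotients of consecutive values of `cheb`. -/
def chebRatio (v : ℝ) (j : ℕ) : ℝ := cheb v (j + 1) / cheb v j

theorem one_le_chebRatio {v : ℝ} (hv : 2 ≤ v) (j : ℕ) : 1 ≤ chebRatio v j := by
  rw [chebRatio, le_div_iff₀ (cheb_pos_le hv j).1, one_mul]
  exact (cheb_pos_le hv j).2

theorem chebRatio_succ {v : ℝ} (hv : 2 ≤ v) (j : ℕ) :
    chebRatio v (j + 1) = v - 1 / chebRatio v j := by
  have h1 := (cheb_pos_le hv j).1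
  have h2 := (cheb_pos_le hv (j + 1)).1
  rw [chebRatio, chebRatio, cheb_add_two]
  field_simp

theorem cheb_succ {v : ℝ} (hv : 2 ≤ v) (j : ℕ) : cheb v (j + 1) = chebRatio v j * cheb v j := by
  rw [chebRatio, div_mul_cancel₀ _ (cheb_pos_le hv j).1.ne']

theorem chebRatio_strictMono {v v' : ℝ} (hv : 2 ≤ v) (hvv : v < v') (j : ℕ) :
    chebRatio v j < chebRatio v' j := by
  induction j with
  | zero => simpa [chebRatio, cheb] using hvv
  | succ j ih =>
    rw [chebRatio_succ hv, chebRatio_succ (hv.trans hvv.le)]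
    have := one_div_le_one_div_of_le (by linarith [one_le_chebRatio hv j]) ih.le
    linarith

theorem cheb_mono {v v' : ℝ} (hv : 2 ≤ v) (hvv : v ≤ v') (j : ℕ) : cheb v j ≤ cheb v' j := by
  rcases hvv.eq_or_lt with rfl | hvv
  · rfl
  induction j with
  | zero => simp
  | succ j ih =>
    rw [cheb_succ hv, cheb_succ (hv.trans hvv.le)]
    have := one_le_chebRatio hv j
    exact mul_le_mul (chebRatio_strictMono hv hvv j).le ih (cheb_pos_le hv j).1.le
      (by linarith [chebRatio_strictMono hv hvv j])

theorem chebRatio_succ_eq_mul {v : ℝ} (hv : 2 ≤ v) (j : ℕ) :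
    chebRatio v (j + 1) = (1 - 1 / cheb v (j + 1) ^ 2) * chebRatio v j := by
  have h1 := (cheb_pos_le hv j).1
  have h2 := (cheb_pos_le hv (j + 1)).1
  have h3 := cheb_sq_sub v j
  rw [chebRatio, chebRatio]
  field_simp
  linarith

/-- In quotient form: for i ≤ j the ratio r_j / r_i is nondecreasing in v, being a product of
factors 1 - 1/U_l² with each U_l nondecreasing in v. -/
theorem chebRatio_mul_le {v v' : ℝ} (hv : 2 ≤ v) (hvv : v < v') {i j : ℕ} (hij : i ≤ j) :
    chebRatio v j * chebRatio v' i ≤ chebRatio v' j * chebRatio v i := by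
  induction j, hij using Nat.le_induction with
  | base => rw [mul_comm]
  | succ j _ ih =>
    have hv' := hv.trans hvv.le
    rw [chebRatio_succ_eq_mul hv, chebRatio_succ_eq_mul hv']
    have h1 := (cheb_pos_le hv (j + 1)).1
    have h2 : 1 ≤ cheb v (j + 1) := by
      simpa using (monotone_nat_of_le_succ fun n => (cheb_pos_le hv n).2) (Nat.zero_le (j + 1))
    have h3 : 1 / cheb v' (j + 1) ^ 2 ≤ 1 / cheb v (j + 1) ^ 2 := by
      have := cheb_mono hv hvv.le (j + 1)
      gcongr
    have h4 : 1 / cheb v (j + 1) ^ 2 ≤ 1 := by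
      rw [div_le_one (by positivity)]; nlinarith
    have h5 : 0 ≤ chebRatio v' j * chebRatio v i :=
      mul_nonneg (by linarith [one_le_chebRatio hv' j]) (by linarith [one_le_chebRatio hv i])
    rw [mul_assoc, mul_assoc]
    exact mul_le_mul (by linarith) ih (mul_nonneg (by linarith [one_le_chebRatio hv j])
      (by linarith [one_le_chebRatio hv' i])) (by linarith)

/-- Since U_i is the product of r_l over l < i, the quotient r_j^i / U_i is a product of quotients
r_j / r_l with l < j, each nondecreasing in v. -/
theorem chebRatio_pow_mul_le {v v' : ℝ} (hv : 2 ≤ v) (hvv : v < v') {i j : ℕ} (hij : i ≤ j) :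
    chebRatio v j ^ i * cheb v' i ≤ chebRatio v' j ^ i * cheb v i := by
  have hv' := hv.trans hvv.le
  induction i with
  | zero => simp
  | succ i ih =>
    have h1 := chebRatio_mul_le hv hvv (i := i) (j := j) (by omega)
    have h2 := ih (by omega)
    rw [cheb_succ hv, cheb_succ hv', pow_succ, pow_succ]
    have p1 := one_le_chebRatio hv j
    have p2 := one_le_chebRatio hv' j
    have p3 := one_le_chebRatio hv' i
    have p4 := (cheb_pos_le hv' i).1
    have p5 := one_le_chebRatio hv i
    have := mul_le_mul h2 h1 (by positivity) (mul_nonneg (by positivity) (cheb_pos_le hv i).1.le)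
    nlinarith

/-- Strict monotonicity, in the parameter, of the activity with a given asymmetric solution. -/
theorem activity_strictMono {θ lam v v' : ℝ} (hθ : 0 < θ) (hl : 0 < lam) (hv : 2 ≤ v)
    (hvv : v < v') (m : ℕ)
    (h : lam * cheb v (m + 1) ^ (m + 2) * (cheb v m - θ * cheb v (m + 2)) =
      cheb v (m + 2) ^ (m + 2))
    (h' : lam * cheb v' (m + 1) ^ (m + 2) * (cheb v' m - θ * cheb v' (m + 2)) =
      cheb v' (m + 2) ^ (m + 2)) : False := by
  -- Solved for the activity this reads λ = (P^m / U_m) · P² / N with P = r_{m+1} and N = 1 - θ r_m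
  -- r_{m+1}. The first factor is nondecreasing in v, P² strictly increases and N strictly
  -- decreases, so one λ cannot serve two values of v.
  have key : ∀ w : ℝ, 2 ≤ w → lam * cheb w (m + 1) ^ (m + 2) * (cheb w m - θ * cheb w (m + 2)) =
      cheb w (m + 2) ^ (m + 2) →
      lam * (cheb w m * (1 - θ * (chebRatio w m * chebRatio w (m + 1)))) =
        chebRatio w (m + 1) ^ m * chebRatio w (m + 1) ^ 2 := by
    intro w hw h
    have h0 := (cheb_pos_le hw m).1
    have h1 := (cheb_pos_le hw (m + 1)).1
    have e0 : chebRatio w m = cheb w (m + 1) / cheb w m := rfl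
    have e1 : chebRatio w (m + 1) = cheb w (m + 2) / cheb w (m + 1) := rfl
    rw [← pow_add, e0, e1, div_pow, eq_div_iff (by positivity), ← h]
    field_simp
  have e := key v hv h
  have e' := key v' (hv.trans hvv.le) h'
  have hv' := hv.trans hvv.le
  have a := one_le_chebRatio hv m
  have b := one_le_chebRatio hv (m + 1)
  have a' := chebRatio_strictMono hv hvv m
  have b' := chebRatio_strictMono hv hvv (m + 1)
  have c := (cheb_pos_le hv m).1
  have c' := (cheb_pos_le hv' m).1
  have hab : chebRatio v m * chebRatio v (m + 1) < chebRatio v' m * chebRatio v' (m + 1) := by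
    apply mul_lt_mul'' a' b' <;> linarith
  have hsq : chebRatio v (m + 1) ^ 2 < chebRatio v' (m + 1) ^ 2 := by gcongr
  have hp := chebRatio_pow_mul_le hv hvv (i := m) (j := m + 1) (by omega)
  set P := chebRatio v (m + 1)
  set P' := chebRatio v' (m + 1)
  set N := 1 - θ * (chebRatio v m * P) with hN
  set N' := 1 - θ * (chebRatio v' m * P') with hN'
  have hNN : N' < N := by
    have := mul_lt_mul_of_pos_left hab hθ
    linarith
  have hPm : 0 < P ^ m := by positivity
  have hP'm : 0 < P' ^ m := by
    have : 0 < P' := by linarith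
    positivity
  -- The right side of the equation is positive, so its left side is too.
  have hN'pos : 0 < N' := by
    by_contra hneg
    have h1 : lam * (cheb v' m * N') ≤ 0 :=
      mul_nonpos_of_nonneg_of_nonpos hl.le (mul_nonpos_of_nonneg_of_nonpos c'.le (not_lt.1 hneg))
    have h2 : 0 < P' ^ m * P' ^ 2 := mul_pos hP'm (by nlinarith)
    linarith
  have h1 : P ^ m * cheb v' m * (P ^ 2 * N') < P' ^ m * cheb v m * (P' ^ 2 * N) :=
    mul_lt_mul' hp (mul_lt_mul'' hsq hNN (by positivity) hN'pos.le) (by positivity) (by positivity)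
  have h2 : P ^ m * cheb v' m * (P ^ 2 * N') = P' ^ m * cheb v m * (P' ^ 2 * N) := by
    calc _ = (P ^ m * P ^ 2) * (cheb v' m * N') := by ring
      _ = (P' ^ m * P' ^ 2) * (cheb v m * N) := by rw [← e, ← e']; ring
      _ = _ := by ring
  exact h1.ne h2

/-! ### Parametrisation of the asymmetric constant solutions. -/

section Parametrisation

variable {ρ τ : ℝ} (hρτ : ρ * τ = 1)
include hρτ

theorem cheb_succ_eq (j : ℕ) : cheb (ρ + τ) (j + 1) = ρ * cheb (ρ + τ) j + τ ^ (j + 1) := by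
  induction j with
  | zero => simp [cheb]
  | succ j ih =>
    rw [cheb_add_two]
    have h : τ * cheb (ρ + τ) (j + 1) = cheb (ρ + τ) j + τ ^ (j + 2) := by
      rw [ih]; linear_combination cheb (ρ + τ) j * hρτ
    linear_combination h

theorem cheb_succ_eq' (j : ℕ) : cheb (ρ + τ) (j + 1) = τ * cheb (ρ + τ) j + ρ ^ (j + 1) := by
  have := cheb_succ_eq (ρ := τ) (τ := ρ) (by linarith) j
  rwa [add_comm τ ρ] at this

/-- With k = m + 2, x = τ^k / D and y = ρ^k / D, these are D times the denominator and the two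
numerators in (2). All three factor, and the quotients in (2) become τ U_{k-1} / U_k and ρ U_{k-1} /
U_k. -/
theorem cheb_numerators (θ : ℝ) (m : ℕ) :
    cheb (ρ + τ) m - θ * cheb (ρ + τ) (m + 2) + τ ^ (m + 2) + ρ ^ (m + 2) =
        (1 - θ) * cheb (ρ + τ) (m + 2) ∧
      cheb (ρ + τ) m - θ * cheb (ρ + τ) (m + 2) + τ ^ (m + 2) + θ * ρ ^ (m + 2) =
        (1 - θ) * (τ * cheb (ρ + τ) (m + 1)) ∧
      cheb (ρ + τ) m - θ * cheb (ρ + τ) (m + 2) + θ * τ ^ (m + 2) + ρ ^ (m + 2) =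
        (1 - θ) * (ρ * cheb (ρ + τ) (m + 1)) := by
  have h1 := cheb_succ_eq hρτ (m + 1)
  have h2 := cheb_succ_eq' hρτ (m + 1)
  have h3 := cheb_add_two (ρ + τ) m
  refine ⟨?_, ?_, ?_⟩
  · linear_combination (-1) * h1 - h2 + h3
  · linear_combination (-1) * h1 + h3 - θ * h2
  · linear_combination (-1) * h2 + h3 - θ * h1

end Parametrisation

theorem isConstantSolution_of_cheb {lam θ ρ τ : ℝ} (m : ℕ) (hθ1 : θ < 1) (hρ : 0 < ρ) (hτ : 0 < τ)
    (hv : 2 ≤ ρ + τ) (hρτ : ρ * τ = 1) (hD : 0 < cheb (ρ + τ) m - θ * cheb (ρ + τ) (m + 2))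
    (h : lam * cheb (ρ + τ) (m + 1) ^ (m + 2) * (cheb (ρ + τ) m - θ * cheb (ρ + τ) (m + 2)) =
      cheb (ρ + τ) (m + 2) ^ (m + 2)) :
    IsConstantSolution (m + 2) lam θ
      (τ ^ (m + 2) / (cheb (ρ + τ) m - θ * cheb (ρ + τ) (m + 2)))
      (ρ ^ (m + 2) / (cheb (ρ + τ) m - θ * cheb (ρ + τ) (m + 2))) := by
  obtain ⟨e1, e2, e3⟩ := cheb_numerators hρτ θ m
  have hs2 := (cheb_pos_le hv (m + 2)).1
  set D := cheb (ρ + τ) m - θ * cheb (ρ + τ) (m + 2) with hDdef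
  have ht : 0 < 1 - θ := by linarith
  have d1 : 1 + τ ^ (m + 2) / D + ρ ^ (m + 2) / D = (1 - θ) * cheb (ρ + τ) (m + 2) / D := by
    rw [← e1]; field_simp
  have d2 : 1 + τ ^ (m + 2) / D + θ * (ρ ^ (m + 2) / D) =
      (1 - θ) * (τ * cheb (ρ + τ) (m + 1)) / D := by
    rw [← e2]; field_simp
  have d3 : 1 + θ * (τ ^ (m + 2) / D) + ρ ^ (m + 2) / D =
      (1 - θ) * (ρ * cheb (ρ + τ) (m + 1)) / D := by
    rw [← e3]; field_simp
  have q : ∀ z : ℝ, (1 - θ) * (z * cheb (ρ + τ) (m + 1)) / D /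
      ((1 - θ) * cheb (ρ + τ) (m + 2) / D) = z * cheb (ρ + τ) (m + 1) / cheb (ρ + τ) (m + 2) := by
    intro z; field_simp
  refine ⟨by positivity, by positivity, ?_, ?_⟩
  · rw [d1, d2, q, div_pow, mul_pow, ← h]
    have := (cheb_pos_le hv (m + 1)).1
    have hl : lam ≠ 0 := by
      rintro rfl
      have : 0 < cheb (ρ + τ) (m + 2) ^ (m + 2) := by positivity
      simp [← h] at this
    field_simp
  · rw [d1, d3, q, div_pow, mul_pow, ← h]
    have := (cheb_pos_le hv (m + 1)).1
    have hl : lam ≠ 0 := by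
      rintro rfl
      have : 0 < cheb (ρ + τ) (m + 2) ^ (m + 2) := by positivity
      simp [← h] at this
    field_simp

/-- Dividing the two equations gives y / x = r^k, where r is the quotient of their numerators. With
ρ = √r, x and y are a common factor z times τ^k and ρ^k; the definition of r determines z, and the
first equation then gives the relation with λ. -/
theorem IsConstantSolution.exists_cheb {lam θ x y : ℝ} {m : ℕ} (hθ : 0 < θ) (hθ1 : θ < 1)
    (hxy : x < y) (hs : IsConstantSolution (m + 2) lam θ x y) :
    ∃ ρ τ : ℝ, 1 < ρ ∧ 0 < τ ∧ ρ * τ = 1 ∧ 2 ≤ ρ + τ ∧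
      lam * cheb (ρ + τ) (m + 1) ^ (m + 2) * (cheb (ρ + τ) m - θ * cheb (ρ + τ) (m + 2)) =
        cheb (ρ + τ) (m + 2) ^ (m + 2) ∧
      x = τ ^ (m + 2) / (cheb (ρ + τ) m - θ * cheb (ρ + τ) (m + 2)) ∧
      y = ρ ^ (m + 2) / (cheb (ρ + τ) m - θ * cheb (ρ + τ) (m + 2)) := by
  obtain ⟨hx, hy, ex, ey⟩ := hs
  set r := (1 + θ * x + y) / (1 + x + θ * y) with hr
  have hr1 : 1 < r := by
    rw [hr, one_lt_div (by positivity)]; nlinarith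
  have hρ : 1 < √r := by rw [Real.lt_sqrt] <;> linarith
  have hρ0 : 0 < √r := by linarith
  obtain ⟨ρ, hρr⟩ : ∃ ρ, ρ = √r := ⟨_, rfl⟩
  obtain ⟨τ, hτ⟩ : ∃ τ, τ = ρ⁻¹ := ⟨_, rfl⟩
  rw [← hρr] at hρ hρ0
  have hr2 : ρ ^ 2 = r := by rw [hρr]; exact Real.sq_sqrt (by linarith)
  have hτ0 : 0 < τ := by rw [hτ]; positivity
  have hρτ : ρ * τ = 1 := by rw [hτ]; exact mul_inv_cancel₀ hρ0.ne'
  have hv : 2 ≤ ρ + τ := by nlinarith [sq_nonneg (ρ - τ), sq_nonneg (ρ + τ)]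
  have hyx : y = r ^ (m + 2) * x := by
    have hB : (1 + θ * x + y) / (1 + x + y) = r * ((1 + x + θ * y) / (1 + x + y)) := by
      rw [hr]; field_simp
    calc y = lam * ((1 + θ * x + y) / (1 + x + y)) ^ (m + 2) := ey
      _ = r ^ (m + 2) * (lam * ((1 + x + θ * y) / (1 + x + y)) ^ (m + 2)) := by
        rw [hB, mul_pow, mul_left_comm]
      _ = r ^ (m + 2) * x := by rw [← ex]
  have hpow : ρ ^ (m + 2) * τ ^ (m + 2) = 1 := by rw [← mul_pow, hρτ, one_pow]
  -- z is the geometric mean of x and y.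
  obtain ⟨z, hz⟩ : ∃ z, z = x * ρ ^ (m + 2) := ⟨_, rfl⟩
  have hxz : x = z * τ ^ (m + 2) := by rw [hz]; linear_combination (-x) * hpow
  have hyz : y = z * ρ ^ (m + 2) := by rw [hyx, hz, ← hr2]; ring
  have hz0 : 0 < z := by rw [hz]; positivity
  obtain ⟨e1, e2, e3⟩ := cheb_numerators hρτ θ m
  have hrx : ρ * (1 + x + θ * y) = τ * (1 + θ * x + y) := by
    have : r * (1 + x + θ * y) = 1 + θ * x + y := by
      rw [hr, div_mul_cancel₀]; positivity
    rw [← this, ← hr2]; linear_combination (-ρ) * (1 + x + θ * y) * hρτ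
  set D := cheb (ρ + τ) m - θ * cheb (ρ + τ) (m + 2) with hD
  have hlt : τ < ρ := by nlinarith
  -- The definition of r, written in ρ, τ and z, factors as (ρ - τ)(z D - 1) = 0; asymmetry excludes
  -- the first factor.
  have hzD : z * D = 1 := by
    have h1 : (ρ - τ) * (z * D - 1) = 0 := by
      rw [hxz, hyz] at hrx
      linear_combination z * ρ * e2 - z * τ * e3 - hrx
    have := (mul_eq_zero.1 h1).resolve_left (by linarith)
    linarith
  have hD0 : 0 < D := by
    by_contra hneg
    nlinarith
  have hzD' : z = 1 / D := by rw [eq_div_iff hD0.ne', hzD]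
  refine ⟨ρ, τ, hρ, hτ0, hρτ, hv, ?_, ?_, ?_⟩
  · have hs2 := (cheb_pos_le hv (m + 2)).1
    have ht : 0 < 1 - θ := by linarith
    have q : (1 + x + θ * y) / (1 + x + y) =
        τ * cheb (ρ + τ) (m + 1) / cheb (ρ + τ) (m + 2) := by
      rw [div_eq_div_iff (by positivity) hs2.ne', hxz, hyz]
      have f1 : 1 + z * τ ^ (m + 2) + z * ρ ^ (m + 2) = z * ((1 - θ) * cheb (ρ + τ) (m + 2)) := by
        rw [← e1, ← hzD]; ring
      have f2 : 1 + z * τ ^ (m + 2) + θ * (z * ρ ^ (m + 2)) =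
          z * ((1 - θ) * (τ * cheb (ρ + τ) (m + 1))) := by
        rw [← e2, ← hzD]; ring
      rw [f1, f2]; ring
    rw [q, div_pow, mul_pow, hxz, hzD', ← mul_div_assoc, eq_div_iff (by positivity)] at ex
    have hτp : 0 < τ ^ (m + 2) := by positivity
    field_simp at ex
    linear_combination (-1) * ex
  · rw [hxz, hzD']; ring
  · rw [hyz, hzD']; ring

/-- Strict monotonicity of the activity fixes ρ + τ. Together with ρ τ = 1 and ρ > 1 > τ this fixes
ρ and τ, hence the solution. -/
theorem IsConstantSolution.unique {k : ℕ} {lam θ x y x' y' : ℝ} (hk : 2 ≤ k) (hθ : 0 < θ)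
    (hθ1 : θ < 1) (hl : 0 < lam) (hxy : x < y) (hs : IsConstantSolution k lam θ x y)
    (hxy' : x' < y') (hs' : IsConstantSolution k lam θ x' y') : x = x' ∧ y = y' := by
  obtain ⟨m, rfl⟩ := Nat.exists_eq_add_of_le' hk
  obtain ⟨ρ, τ, h1, h2, h3, h4, h5, h6, h7⟩ := hs.exists_cheb hθ hθ1 hxy
  obtain ⟨ρ', τ', h1', h2', h3', h4', h5', h6', h7'⟩ := hs'.exists_cheb hθ hθ1 hxy'
  have hv : ρ + τ = ρ' + τ' := by
    rcases lt_trichotomy (ρ + τ) (ρ' + τ') with h | h | h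
    · exact (activity_strictMono hθ hl h4 h m h5 h5').elim
    · exact h
    · exact (activity_strictMono hθ hl h4' h m h5' h5).elim
  have hlt : τ < 1 := by nlinarith
  have hlt' : τ' < 1 := by nlinarith
  have hρ : ρ = ρ' := by
    have : (ρ - ρ') * (ρ - τ') = 0 := by linear_combination h3' - h3 - ρ * (-hv)
    rcases mul_eq_zero.1 this with h | h <;> linarith
  have hτ : τ = τ' := by linarith
  subst hρ hτ
  exact ⟨h6.trans h6'.symm, h7.trans h7'.symm⟩

theorem lamCr_pos {k : ℕ} (hk : 2 ≤ k) {θ : ℝ} (hθ1 : θ < ((k : ℝ) - 1) / ((k : ℝ) + 1)) :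
    0 < lamCr k θ := by
  have hk0 : (0 : ℝ) < k := by positivity
  rw [lt_div_iff₀ (by positivity)] at hθ1
  have : 0 < (k : ℝ) - 1 - θ * ((k : ℝ) + 1) := by linarith
  unfold lamCr
  positivity

theorem exists_isConstantSolution {k : ℕ} (hk : 2 ≤ k) {θ lam : ℝ} (hθ : 0 < θ)
    (hθ1 : θ < ((k : ℝ) - 1) / ((k : ℝ) + 1)) (hlam : lamCr k θ < lam) :
    ∃ x₁ x₂ : ℝ, x₁ < x₂ ∧ IsConstantSolution k lam θ x₁ x₂ := by
  have hl : 0 < lam := (lamCr_pos hk hθ1).trans hlam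
  obtain ⟨m, rfl⟩ := Nat.exists_eq_add_of_le' hk
  have hθ1' : θ < 1 := hθ1.trans_le <| by
    rw [div_le_one (by positivity)]; linarith
  have hθ2 : 2 / θ ≥ 2 := by
    rw [ge_iff_le, le_div_iff₀ hθ]; linarith
  -- A zero of `g` with ρ > 1 is a parameter whose activity is the given one. The denominator is
  -- cleared so that `g` is continuous also where D changes sign.
  let g : ℝ → ℝ := fun ρ => lam * cheb (ρ + ρ⁻¹) (m + 1) ^ (m + 2) *
    (cheb (ρ + ρ⁻¹) m - θ * cheb (ρ + ρ⁻¹) (m + 2)) - cheb (ρ + ρ⁻¹) (m + 2) ^ (m + 2)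
  have hcont : ContinuousOn g (Set.Icc 1 (2 / θ)) := by
    have h0 : ContinuousOn (fun ρ : ℝ => ρ + ρ⁻¹) (Set.Icc 1 (2 / θ)) :=
      continuousOn_id.add (continuousOn_id.inv₀ fun x hx => by
        have := hx.1
        simp only [id]; linarith)
    have hc : ∀ j, ContinuousOn (fun ρ : ℝ => cheb (ρ + ρ⁻¹) j) (Set.Icc 1 (2 / θ)) := fun j =>
      (continuous_cheb j).comp_continuousOn h0
    exact ((continuousOn_const.mul ((hc _).pow _)).mul ((hc _).sub
      (continuousOn_const.mul (hc _)))).sub ((hc _).pow _)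
  have hv2 : ∀ ρ : ℝ, 0 < ρ → 2 ≤ ρ + ρ⁻¹ := by
    intro ρ hρ
    have : ρ * ρ⁻¹ = 1 := mul_inv_cancel₀ hρ.ne'
    have := inv_pos.2 hρ
    nlinarith [sq_nonneg (ρ - ρ⁻¹)]
  -- At ρ = 1 the Chebyshev values are j + 1, and positivity of `g` is exactly the condition that λ
  -- exceeds λ_cr.
  have g1 : 0 < g 1 := by
    simp only [g]
    norm_num
    rw [(cheb_two m).1, (cheb_two m).2, (cheb_two (m + 1)).2]
    push_cast at hθ1 hlam ⊢
    rw [lt_div_iff₀ (by positivity)] at hθ1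
    have hc : 0 < (m : ℝ) + 2 - 1 - θ * (m + 2 + 1) := by linarith
    rw [lamCr] at hlam
    push_cast at hlam
    rw [div_mul_eq_mul_div, one_mul, div_lt_iff₀ hc, div_pow, div_lt_iff₀ (by positivity)] at hlam
    have e : (m : ℝ) + 1 + 2 = m + 2 + 1 := by ring
    rw [e]
    nlinarith
  -- At ρ = 2/θ one has θ v ≥ 2, hence θ U_{m+2} ≥ 2 U_{m+1} - θ U_m ≥ U_m and D ≤ 0.
  have g2 : g (2 / θ) ≤ 0 := by
    have hpos : 0 < 2 / θ := by positivity
    have hv := hv2 _ hpos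
    have hle : 2 / θ ≤ 2 / θ + (2 / θ)⁻¹ := by
      have := inv_pos.2 hpos
      linarith
    simp only [g]
    set v := 2 / θ + (2 / θ)⁻¹
    have h1 := cheb_pos_le hv m
    have h2 := (cheb_pos_le hv (m + 1)).1
    have h3 := (cheb_pos_le hv (m + 2)).1
    have h4 : cheb v m - θ * cheb v (m + 2) ≤ 0 := by
      rw [cheb_add_two]
      have : 2 ≤ θ * v := by
        calc 2 = θ * (2 / θ) := by field_simp
          _ ≤ _ := by gcongr
      nlinarith
    have h5 : lam * cheb v (m + 1) ^ (m + 2) * (cheb v m - θ * cheb v (m + 2)) ≤ 0 :=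
      mul_nonpos_of_nonneg_of_nonpos (by positivity) h4
    have h6 : 0 < cheb v (m + 2) ^ (m + 2) := by positivity
    linarith
  obtain ⟨ρ, hρ, h0⟩ := intermediate_value_Icc' (by linarith : (1 : ℝ) ≤ 2 / θ) hcont
    (⟨g2, g1.le⟩ : (0 : ℝ) ∈ Set.Icc (g (2 / θ)) (g 1))
  have hρ1 : 1 < ρ := by
    refine lt_of_le_of_ne hρ.1 ?_
    rintro rfl
    linarith
  have hρ0 : 0 < ρ := by linarith
  have hτ : 0 < ρ⁻¹ := inv_pos.2 hρ0
  have hv := hv2 ρ hρ0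
  have h0' := sub_eq_zero.1 h0
  have hD : 0 < cheb (ρ + ρ⁻¹) m - θ * cheb (ρ + ρ⁻¹) (m + 2) := by
    have h2 := (cheb_pos_le hv (m + 1)).1
    have h3 := (cheb_pos_le hv (m + 2)).1
    have h6 : 0 < cheb (ρ + ρ⁻¹) (m + 2) ^ (m + 2) := by positivity
    rw [← h0'] at h6
    exact pos_of_mul_pos_right h6 (by positivity)
  refine ⟨_, _, ?_, isConstantSolution_of_cheb m hθ1' hρ0 hτ hv (mul_inv_cancel₀ hρ0.ne') hD h0'⟩
  gcongr
  exact (inv_lt_one_of_one_lt₀ hρ1).trans hρ1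

end

end WidomRowlinson

namespace WidomRowlinson

noncomputable section

variable {k d : ℕ}

/-! ### Paths and the numbers they represent -/

@[simp] theorem branching_zero (k d : ℕ) : branching k d 0 = d := rfl

@[simp] theorem branching_succ (k d n : ℕ) : branching k d (n + 1) = k := rfl

theorem branching_of_pos {n : ℕ} (hn : 0 < n) : branching k d n = k := if_neg hn.ne'

theorem branching_pos (hk : 2 ≤ k) (hd : k ≤ d) (n : ℕ) : 1 < branching k d n := by
  unfold branching; split_ifs <;> omega

namespace RootPath

/-- The part of the represented number that comes from the digits after position `m`. -/
def frac (π : RootPath k d) (m : ℕ) : ℝ :=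
  Real.ofDigits (b := k) fun i => ⟨π.step (m + 1 + i), by
    have := π.step_lt (m + 1 + i)
    rwa [branching_of_pos (by omega)] at this⟩

theorem frac_nonneg (π : RootPath k d) (m : ℕ) : 0 ≤ π.frac m := Real.ofDigits_nonneg _

theorem frac_le_one (π : RootPath k d) (m : ℕ) : π.frac m ≤ 1 := Real.ofDigits_le_one _

theorem mul_frac (hk : 2 ≤ k) (π : RootPath k d) (m : ℕ) :
    k * π.frac m = π.step (m + 1) + π.frac (m + 1) := by
  have hk0 : (k : ℝ) ≠ 0 := by positivity
  rw [frac, Real.ofDigits_eq_sum_add_ofDigits _ 1, Finset.sum_range_one, Real.ofDigitsTerm]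
  simp only [zero_add, pow_one, add_zero]
  have : Real.ofDigits (b := k) (fun i => ⟨π.step (m + 1 + (i + 1)), by
      have := π.step_lt (m + 1 + (i + 1))
      rwa [branching_of_pos (by omega)] at this⟩) = π.frac (m + 1) := by
    unfold frac
    congr 1
    ext i
    simp only
    congr 1
    omega
  rw [this]
  field_simp

theorem mul_number (hk : 2 ≤ k) (hd : k ≤ d) (π : RootPath k d) :
    d * π.number = π.step 0 + π.frac 0 := by
  have hd0 : (d : ℝ) ≠ 0 := by
    have : 0 < d := by omega
    positivity
  have hs : Summable fun n => (π.step (n + 1) : ℝ) / (k : ℝ) ^ (n + 1) := by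
    have := Real.summable_ofDigitsTerm (b := k) (digits := fun i => ⟨π.step (0 + 1 + i), by
      have := π.step_lt (0 + 1 + i)
      rwa [branching_of_pos (by omega)] at this⟩)
    refine this.congr fun n => ?_
    simp only [Real.ofDigitsTerm, div_eq_mul_inv, zero_add, add_comm]
  rw [number, mul_div_cancel₀ _ hd0,
    ((summable_nat_add_iff (f := fun n => (π.step n : ℝ) / (k : ℝ) ^ n) 1).1 hs).tsum_eq_zero_add]
  simp only [pow_zero, inv_one, mul_one, frac, Real.ofDigits, Real.ofDigitsTerm, div_eq_mul_inv, zero_add,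
    add_comm]

theorem step_succ_le (π : RootPath k d) (m : ℕ) : (π.step (m + 1) : ℝ) + 1 ≤ k := by
  have := π.step_lt (m + 1)
  rw [branching_succ] at this
  exact_mod_cast this

/-- The value 1 leaves no slack: in k · 1 = digit + remainder the digit is at most k - 1 and the
remainder at most 1, so both are maximal, and the argument repeats. -/
theorem step_succ_eq_of_frac_eq_one (hk : 2 ≤ k) (π : RootPath k d) {n : ℕ} (h : π.frac n = 1)
    {m : ℕ} (hm : n < m) : π.step m + 1 = k := by
  have key : ∀ j, π.frac (n + j) = 1 := by
    intro j
    induction j with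
    | zero => exact h
    | succ j ih =>
      have h1 := π.mul_frac hk (n + j)
      rw [ih] at h1
      have h2 := π.step_succ_le (n + j)
      have h3 := π.frac_le_one (n + j + 1)
      rw [← add_assoc]; linarith
  obtain ⟨j, rfl⟩ := Nat.exists_eq_add_of_lt hm
  have h1 := π.mul_frac hk (n + j)
  rw [key j, add_assoc, key (j + 1), ← add_assoc] at h1
  have : ((π.step (n + j + 1) + 1 : ℕ) : ℝ) = k := by push_cast; linarith
  exact_mod_cast this

theorem step_succ_eq_of_frac_eq_zero (hk : 2 ≤ k) (π : RootPath k d) {n : ℕ} (h : π.frac n = 0)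
    {m : ℕ} (hm : n < m) : π.step m = 0 := by
  have key : ∀ j, π.frac (n + j) = 0 := by
    intro j
    induction j with
    | zero => exact h
    | succ j ih =>
      have h1 := π.mul_frac hk (n + j)
      rw [ih] at h1
      have h2 : (0 : ℝ) ≤ π.step (n + j + 1) := by positivity
      have h3 := π.frac_nonneg (n + j + 1)
      rw [← add_assoc]; linarith
  obtain ⟨j, rfl⟩ := Nat.exists_eq_add_of_lt hm
  have h1 := π.mul_frac hk (n + j)
  rw [key j, add_assoc, key (j + 1), ← add_assoc] at h1
  have : (π.step (n + j + 1) : ℝ) = 0 := by linarith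
  exact_mod_cast this

theorem frac_eq_zero (π : RootPath k d) {n : ℕ} (h : ∀ m, n < m → π.step m = 0) :
    π.frac n = 0 := by
  unfold frac Real.ofDigits Real.ofDigitsTerm
  simp [fun i => h (n + 1 + i) (by omega)]

theorem frac_eq_one (hk : 2 ≤ k) (π : RootPath k d) {n : ℕ} (h : ∀ m, n < m → π.step m + 1 = k) :
    π.frac n = 1 := by
  rw [← Real.ofDigits_const_last_eq_one' (b := k) (by omega), frac]
  congr 1
  ext i
  have := h (n + 1 + i) (by omega)
  simp only
  omega

theorem number_mem_Icc (hk : 2 ≤ k) (hd : k ≤ d) (π : RootPath k d) :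
    π.number ∈ Set.Icc (0 : ℝ) 1 := by
  have hd0 : (0 : ℝ) < d := by
    have : 0 < d := by omega
    positivity
  have h1 := π.mul_number hk hd
  have h2 : (π.step 0 : ℝ) + 1 ≤ d := by exact_mod_cast π.step_lt 0
  have h3 : (0 : ℝ) ≤ π.step 0 := by positivity
  have h4 := π.frac_nonneg 0
  have h5 := π.frac_le_one 0
  constructor
  · by_contra hneg
    nlinarith
  · by_contra hneg
    nlinarith

theorem exists_number_eq (hk : 2 ≤ k) (hd : k ≤ d) {t : ℝ} (ht : t ∈ Set.Icc (0 : ℝ) 1) :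
    ∃ π : RootPath k d, π.number = t := by
  have hd0 : 0 < d := by omega
  have hd0' : (0 : ℝ) < d := by positivity
  -- The first digit is ⌊d t⌋, except at t = 1, where this would be the forbidden digit d.
  obtain ⟨c, hc, hc0, hc1⟩ : ∃ c : ℕ, c < d ∧ (0 : ℝ) ≤ d * t - c ∧ d * t - c ≤ 1 := by
    rcases ht.2.eq_or_lt with rfl | ht1
    · refine ⟨d - 1, by omega, ?_, ?_⟩ <;> rw [Nat.cast_sub (by omega)] <;> push_cast <;> linarith
    · have h0 : 0 ≤ d * t := mul_nonneg hd0'.le ht.1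
      refine ⟨⌊d * t⌋₊, ?_, ?_, ?_⟩
      · rw [Nat.floor_lt h0]; nlinarith
      · linarith [Nat.floor_le h0]
      · linarith [Nat.lt_floor_add_one (d * t)]
  obtain ⟨f, -, hf⟩ := Real.ofDigits_SurjOn (b := k) (by omega) ⟨hc0, hc1⟩
  let π : RootPath k d := ⟨fun n => if n = 0 then c else f (n - 1), fun n => by
    rcases n with _ | n
    · simpa using hc
    · simp⟩
  refine ⟨π, ?_⟩
  have h1 := π.mul_number hk hd
  have h2 : π.frac 0 = d * t - c := by
    rw [← hf, frac]
    congr 1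
    ext i
    simp [π]
  rw [h2] at h1
  have h3 : (d : ℝ) * π.number = d * t := by rw [h1]; simp [π]
  exact mul_left_cancel₀ hd0'.ne' h3

theorem number_eq_zero (hk : 2 ≤ k) (hd : k ≤ d) (π : RootPath k d) (h : ∀ n, π.step n = 0) :
    π.number = 0 := by
  have hd0 : (d : ℝ) ≠ 0 := by
    have : 0 < d := by omega
    positivity
  have h1 := π.mul_number hk hd
  rw [π.frac_eq_zero fun m _ => h m, h 0] at h1
  simpa [hd0] using h1

theorem number_eq_one (hk : 2 ≤ k) (hd : k ≤ d) (π : RootPath k d)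
    (h : ∀ n, π.step n + 1 = branching k d n) : π.number = 1 := by
  have hd0 : (d : ℝ) ≠ 0 := by
    have : 0 < d := by omega
    positivity
  have h1 := π.mul_number hk hd
  rw [π.frac_eq_one hk fun m hm => by rw [h m, branching_of_pos (by omega)]] at h1
  have h2 : (π.step 0 : ℝ) + 1 = d := by exact_mod_cast h 0
  rw [h2] at h1
  exact mul_left_cancel₀ hd0 (h1.trans (mul_one _).symm)

/-- Multiplying by the base shifts the digits, so a common initial segment cancels. -/
theorem number_eq_iff_of_agree (hk : 2 ≤ k) (hd : k ≤ d) {π π' : RootPath k d} (n : ℕ)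
    (h : ∀ j < n, π.step j = π'.step j) :
    π.number = π'.number ↔ (π.step n : ℝ) + π.frac n = π'.step n + π'.frac n := by
  have hd0 : (d : ℝ) ≠ 0 := by
    have : 0 < d := by omega
    positivity
  have hk0 : (k : ℝ) ≠ 0 := by positivity
  induction n with
  | zero => rw [← mul_number hk hd, ← mul_number hk hd, mul_right_inj' hd0]
  | succ n ih =>
    refine (ih fun j hj => h j (by omega)).trans ?_
    rw [h n (by omega), add_right_inj, ← mul_frac hk,
      ← mul_frac hk, mul_right_inj' hk0]

/-- `π'` is the path following `π` from left to right: the two paths separate at some vertex, by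
consecutive choices there, and then `π` stays rightmost and `π'` stays leftmost. -/
structure Adjacent (π π' : RootPath k d) (n : ℕ) : Prop where
  agree : ∀ j < n, π.step j = π'.step j
  next : π'.step n = π.step n + 1
  last : ∀ m, n < m → π.step m + 1 = k
  first : ∀ m, n < m → π'.step m = 0

/-- An integer gap of at least 1 at the first difference can be balanced by remainders in [0, 1]
only if the gap is 1 and the remainders are 1 and 0. -/
theorem number_eq_iff_adjacent (hk : 2 ≤ k) (hd : k ≤ d) {π π' : RootPath k d} {n : ℕ}
    (h : ∀ j < n, π.step j = π'.step j) (hn : π.step n < π'.step n) :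
    π.number = π'.number ↔ Adjacent π π' n := by
  rw [number_eq_iff_of_agree hk hd n h]
  constructor
  · intro he
    have h1 : (π.step n : ℝ) + 1 ≤ π'.step n := by exact_mod_cast hn
    have h2 := π.frac_le_one n
    have h3 := π'.frac_nonneg n
    have h4 : π.frac n = 1 := by linarith
    have h5 : π'.frac n = 0 := by linarith
    refine ⟨h, ?_, fun m hm => π.step_succ_eq_of_frac_eq_one hk h4 hm,
      fun m hm => π'.step_succ_eq_of_frac_eq_zero hk h5 hm⟩
    have : (π'.step n : ℝ) = π.step n + 1 := by linarith
    exact_mod_cast this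
  · intro ha
    rw [π.frac_eq_one hk ha.last, π'.frac_eq_zero ha.first, ha.next]
    push_cast; ring

theorem exists_first_difference {π π' : RootPath k d} (h : π ≠ π') :
    ∃ n, (∀ j < n, π.step j = π'.step j) ∧ π.step n ≠ π'.step n := by
  have : ∃ n, π.step n ≠ π'.step n := by
    by_contra! hall
    apply h
    cases π; cases π'
    congr
    exact funext hall
  classical
  exact ⟨Nat.find this, fun j hj => not_not.1 (Nat.find_min this hj), Nat.find_spec this⟩

/-! ### Vertices on, right of and left of a path -/

@[simp] theorem length_word (π : RootPath k d) (n : ℕ) : (π.word n).length = n := by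
  induction n with
  | zero => rfl
  | succ n ih => simp [word, ih]

theorem isVertex_word (π : RootPath k d) (n : ℕ) : IsVertex k d (π.word n) := by
  induction n with
  | zero => trivial
  | succ n ih => exact ⟨by rw [length_word]; exact π.step_lt n, ih⟩

/-- The vertex of the path at distance `n` from the root. -/
def vertex (π : RootPath k d) (n : ℕ) : Vertex k d := ⟨π.word n, π.isVertex_word n⟩

@[simp] theorem level_vertex (π : RootPath k d) (n : ℕ) : (π.vertex n).level = n := π.length_word n

theorem word_suffix (π : RootPath k d) {m n : ℕ} (h : m ≤ n) : π.word m <:+ π.word n := by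
  induction n, h using Nat.le_induction with
  | base => exact List.suffix_rfl
  | succ n _ ih => exact ih.trans (List.suffix_cons _ _)

theorem word_congr {π π' : RootPath k d} {n : ℕ} (h : ∀ j < n, π.step j = π'.step j) :
    π.word n = π'.word n := by
  induction n with
  | zero => rfl
  | succ n ih => rw [word, word, h n (by omega), ih fun j hj => h j (by omega)]

theorem eq_step_of_suffix_word (π : RootPath k d) {c n m : ℕ} (h : (c :: π.word n) <:+ π.word m) :
    c = π.step n := by
  have hlen := h.length_le
  simp only [List.length_cons, length_word] at hlen
  have h1 := List.suffix_of_suffix_length_le h (π.word_suffix hlen) (by simp)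
  have h2 := h1.eq_of_length (by simp)
  exact (List.cons.inj h2).1

/-- A vertex leaves the path once: if it left at two levels, the ancestor for the earlier departure
would be an initial vertex of the path, so its choice would be that of the path. -/
theorem branch_unique (π : RootPath k d) {l : List ℕ} {c n c' n' : ℕ}
    (h : (c :: π.word n) <:+ l) (hc : c ≠ π.step n) (h' : (c' :: π.word n') <:+ l)
    (hc' : c' ≠ π.step n') : n = n' ∧ c = c' := by
  rcases lt_trichotomy n n' with hlt | rfl | hlt
  · exfalso
    have := List.suffix_of_suffix_length_le h ((List.suffix_cons _ _).trans h') (by simpa using hlt)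
    exact hc (π.eq_step_of_suffix_word this)
  · have h2 := (List.suffix_of_suffix_length_le h h' (by simp)).eq_of_length (by simp)
    exact ⟨rfl, (List.cons.inj h2).1⟩
  · exfalso
    have := List.suffix_of_suffix_length_le h' ((List.suffix_cons _ _).trans h) (by simpa using hlt)
    exact hc' (π.eq_step_of_suffix_word this)

theorem isRight_or_isLeft_or_eq (π : RootPath k d) (x : Vertex k d) :
    π.IsRight x ∨ π.IsLeft x ∨ x = π.vertex x.level := by
  obtain ⟨l, hl⟩ := x
  induction l with
  | nil => exact Or.inr (Or.inr rfl)
  | cons c l ih =>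
    rcases ih hl.2 with ⟨n, e, he, hs⟩ | ⟨n, e, he, hs⟩ | h
    · exact Or.inl ⟨n, e, he, hs.trans (List.suffix_cons _ _)⟩
    · exact Or.inr (Or.inl ⟨n, e, he, hs.trans (List.suffix_cons _ _)⟩)
    · have h' : l = π.word l.length := congrArg Vertex.code h
      rcases lt_trichotomy c (π.step l.length) with hc | hc | hc
      · exact Or.inr (Or.inl ⟨l.length, c, hc, by rw [← h']⟩)
      · refine Or.inr (Or.inr (Vertex.ext ?_))
        change c :: l = π.word (l.length + 1)
        rw [word, ← h', ← hc]
      · exact Or.inl ⟨l.length, c, hc, by rw [← h']⟩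

theorem not_isRight_vertex (π : RootPath k d) (n : ℕ) : ¬ π.IsRight (π.vertex n) := by
  rintro ⟨m, c, hc, hs⟩
  exact hc.ne' (π.eq_step_of_suffix_word hs)

theorem not_isLeft_vertex (π : RootPath k d) (n : ℕ) : ¬ π.IsLeft (π.vertex n) := by
  rintro ⟨m, c, hc, hs⟩
  exact hc.ne (π.eq_step_of_suffix_word hs)

theorem not_isRight_of_isLeft (π : RootPath k d) {x : Vertex k d} (h : π.IsLeft x) :
    ¬ π.IsRight x := by
  rintro ⟨m, c, hc, hs⟩
  obtain ⟨n, e, he, hs'⟩ := h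
  obtain ⟨rfl, rfl⟩ := π.branch_unique hs hc.ne' hs' he.ne
  omega

theorem IsRight.child {π : RootPath k d} {x : Vertex k d} (h : π.IsRight x)
    (c : Fin (branching k d x.level)) : π.IsRight (x.child c) := by
  obtain ⟨m, e, he, hs⟩ := h
  exact ⟨m, e, he, hs.trans (List.suffix_cons _ _)⟩

theorem IsLeft.child {π : RootPath k d} {x : Vertex k d} (h : π.IsLeft x)
    (c : Fin (branching k d x.level)) : π.IsLeft (x.child c) := by
  obtain ⟨m, e, he, hs⟩ := h
  exact ⟨m, e, he, hs.trans (List.suffix_cons _ _)⟩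

theorem IsRight.level_pos {π : RootPath k d} {x : Vertex k d} (h : π.IsRight x) : 0 < x.level := by
  obtain ⟨m, e, he, hs⟩ := h
  have := hs.length_le
  rw [List.length_cons] at this
  exact Nat.lt_of_lt_of_le (Nat.succ_pos _) this

theorem IsLeft.level_pos {π : RootPath k d} {x : Vertex k d} (h : π.IsLeft x) : 0 < x.level := by
  obtain ⟨m, e, he, hs⟩ := h
  have := hs.length_le
  rw [List.length_cons] at this
  exact Nat.lt_of_lt_of_le (Nat.succ_pos _) this

theorem isRight_child_vertex (π : RootPath k d) {n : ℕ}
    (c : Fin (branching k d (π.vertex n).level)) (hc : π.step n < c) :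
    π.IsRight ((π.vertex n).child c) := ⟨n, c, hc, List.suffix_rfl⟩

theorem isLeft_child_vertex (π : RootPath k d) {n : ℕ}
    (c : Fin (branching k d (π.vertex n).level)) (hc : c < π.step n) :
    π.IsLeft ((π.vertex n).child c) := ⟨n, c, hc, List.suffix_rfl⟩

/-- The choice of the path at its `n`-th vertex. -/
def choice (π : RootPath k d) (n : ℕ) : Fin (branching k d (π.vertex n).level) :=
  ⟨π.step n, by rw [level_vertex]; exact π.step_lt n⟩

theorem child_choice (π : RootPath k d) (n : ℕ) :
    (π.vertex n).child (π.choice n) = π.vertex (n + 1) := rfl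

theorem lt_branching_of_suffix (π : RootPath k d) {x : Vertex k d} {c n : ℕ}
    (h : (c :: π.word n) <:+ x.code) : c < branching k d n := by
  obtain ⟨l, hl⟩ := x
  simp only at h
  induction l with
  | nil => simp at h
  | cons e l ih =>
    rcases List.suffix_cons_iff.1 h with h | h
    · obtain ⟨rfl, rfl⟩ := List.cons.inj h
      simpa using hl.1
    · exact ih hl.2 h

theorem Adjacent.isRight {π π' : RootPath k d} {n : ℕ} (h : Adjacent π π' n) {x : Vertex k d}
    (hx : π'.IsRight x) : π.IsRight x := by
  obtain ⟨m, c, hc, hs⟩ := hx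
  rcases lt_trichotomy m n with hm | rfl | hm
  · refine ⟨m, c, by rw [h.agree m hm]; exact hc, ?_⟩
    rwa [word_congr fun j hj => h.agree j (hj.trans hm)]
  · refine ⟨m, c, ?_, ?_⟩
    · rw [h.next] at hc; omega
    · rwa [word_congr h.agree]
  · refine ⟨n, π'.step n, by rw [h.next]; omega, ?_⟩
    rw [word_congr h.agree]
    exact (π'.word_suffix hm).trans ((List.suffix_cons _ _).trans hs)

/-- Moving to the next path brings only the tail of the old one to the left side. Below the first
vertex of that tail nothing lies to the right of π, which stays rightmost. -/
theorem Adjacent.isLeft {π π' : RootPath k d} {n : ℕ} (h : Adjacent π π' n) {x : Vertex k d}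
    (hx : π'.IsLeft x) : π.IsLeft x ∨ ∃ m, n < m ∧ x = π.vertex m := by
  obtain ⟨m, c, hc, hs⟩ := hx
  rcases lt_trichotomy m n with hm | rfl | hm
  · refine Or.inl ⟨m, c, by rw [h.agree m hm]; exact hc, ?_⟩
    rwa [word_congr fun j hj => h.agree j (hj.trans hm)]
  · rw [h.next] at hc
    rw [← word_congr h.agree] at hs
    rcases (Nat.lt_succ_iff.1 hc).lt_or_eq with hc | rfl
    · exact Or.inl ⟨m, c, hc, hs⟩
    rcases π.isRight_or_isLeft_or_eq x with hr | hl | he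
    · exfalso
      obtain ⟨j, e, he, hj⟩ := hr
      rcases lt_or_ge m j with hmj | hmj
      · have h1 := π.lt_branching_of_suffix hj
        rw [branching_of_pos (by omega), ← h.last j hmj] at h1
        omega
      · have := List.suffix_of_suffix_length_le hj hs (by simpa using hmj)
        exact he.ne' (π.eq_step_of_suffix_word (m := m + 1) this)
    · exact Or.inl hl
    · refine Or.inr ⟨x.level, ?_, he⟩
      have := hs.length_le
      simp only [List.length_cons, length_word] at this
      exact this
  · rw [h.first m hm] at hc; omega

/-- Paths with different numbers are separated by a vertex. -/
theorem exists_isRight_isLeft (hk : 2 ≤ k) (hd : k ≤ d) {π π' : RootPath k d} {n : ℕ}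
    (h : ∀ j < n, π.step j = π'.step j) (hn : π.step n < π'.step n) (hne : π.number ≠ π'.number) :
    ∃ x, π.IsRight x ∧ π'.IsLeft x := by
  rw [Ne, number_eq_iff_adjacent hk hd h hn] at hne
  -- For consecutive choices, π turns away from the rightmost continuation and leaves a vertex on
  -- its right, or π' turns away from the leftmost one and leaves a vertex on its left. Otherwise a
  -- whole branch lies between the paths.
  by_cases h1 : π'.step n = π.step n + 1
  · have : (∃ m, n < m ∧ π.step m + 1 ≠ k) ∨ ∃ m, n < m ∧ π'.step m ≠ 0 := by
      by_contra! hcon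
      exact hne ⟨h, h1, hcon.1, hcon.2⟩
    rcases this with ⟨m, hm, hmk⟩ | ⟨m, hm, hm0⟩
    · have hlt := π.step_lt m
      refine ⟨(π.vertex m).child ⟨π.step m + 1, ?_⟩, π.isRight_child_vertex _ ?_,
        ⟨n, π.step n, hn, ?_⟩⟩
      · rw [level_vertex]
        rw [branching_of_pos (by omega)] at hlt ⊢
        omega
      · simp
      · rw [← word_congr h]
        exact (π.word_suffix (m := n + 1) hm).trans (List.suffix_cons _ _)
    · have hlt := π'.step_lt m
      refine ⟨(π'.vertex m).child ⟨0, ?_⟩, ⟨n, π'.step n, hn, ?_⟩, π'.isLeft_child_vertex _ ?_⟩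
      · rw [level_vertex]; omega
      · rw [word_congr h]
        exact (π'.word_suffix (m := n + 1) hm).trans (List.suffix_cons _ _)
      · simp only; omega
  · have hlt := π'.step_lt n
    refine ⟨(π.vertex n).child ⟨π.step n + 1, ?_⟩, π.isRight_child_vertex _ ?_,
      ⟨n, π.step n + 1, by omega, ?_⟩⟩
    · rw [level_vertex]; omega
    · simp
    · rw [← word_congr h]; exact List.suffix_rfl

end RootPath

end

end WidomRowlinson

open scoped NNReal ENNReal BoundedContinuousFunction

namespace WidomRowlinson

noncomputable section

variable {k d : ℕ}

/-! ### The boundary law of a path -/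

/-- The right-hand side of the compatibility equations at `x`. -/
def update (lam θ : ℝ) (h : Vertex k d → ℝ × ℝ) (x : Vertex k d) : ℝ × ℝ :=
  (Real.log lam, Real.log lam) + ∑ c, msg θ (h (x.child c))

theorem isBoundaryLaw_iff {lam θ : ℝ} {h : Vertex k d → ℝ × ℝ} :
    IsBoundaryLaw lam θ h ↔ ∀ x, h x = update lam θ h x := by
  refine forall_congr' fun x => ?_
  rw [Prod.ext_iff, update, Prod.fst_add, Prod.snd_add, Prod.fst_sum, Prod.snd_sum]
  rfl

theorem isConstantSolution_log {lam θ x y : ℝ} (hl : 0 < lam) (hθ : 0 < θ)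
    (h : IsConstantSolution k lam θ x y) :
    (Real.log x, Real.log y) =
      (Real.log lam, Real.log lam) + (k : ℝ) • msg θ (Real.log x, Real.log y) := by
  obtain ⟨hx, hy, ex, ey⟩ := h
  refine Prod.ext ?_ ?_
  · change Real.log x = Real.log lam + k * Real.log _
    rw [Real.exp_log hx, Real.exp_log hy]
    nth_rewrite 1 [ex]
    rw [Real.log_mul hl.ne' (by positivity), Real.log_pow]
  · change Real.log y = Real.log lam + k * Real.log _
    rw [Real.exp_log hx, Real.exp_log hy]
    nth_rewrite 1 [ey]
    rw [Real.log_mul hl.ne' (by positivity), Real.log_pow]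
    ring_nf

theorem IsConstantSolution.swap {lam θ x y : ℝ} (h : IsConstantSolution k lam θ x y) :
    IsConstantSolution k lam θ y x := by
  obtain ⟨hx, hy, ex, ey⟩ := h
  refine ⟨hy, hx, ?_, ?_⟩
  · nth_rewrite 1 [ey]; ring_nf
  · nth_rewrite 1 [ex]; ring_nf

/-- A constant function solves the compatibility equations off the root. -/
theorem update_const {lam θ : ℝ} {X : ℝ × ℝ}
    (hX : X = (Real.log lam, Real.log lam) + (k : ℝ) • msg θ X) {h : Vertex k d → ℝ × ℝ}
    {x : Vertex k d} (hx : 0 < x.level) (hc : ∀ c, h (x.child c) = X) : update lam θ h x = X := by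
  rw [update, Finset.sum_congr rfl fun c _ => by rw [hc c], Finset.sum_const, Finset.card_univ,
    Fintype.card_fin, branching_of_pos hx]
  nth_rewrite 2 [hX]
  rw [Nat.cast_smul_eq_nsmul]

theorem dist_update_le {lam θ : ℝ} (hθ : 0 < θ) (hθ1 : θ ≤ 1) (h h' : Vertex k d → ℝ × ℝ)
    (x : Vertex k d) :
    dist (update lam θ h x) (update lam θ h' x) ≤
      ∑ c, contraction θ * dist (h (x.child c)) (h' (x.child c)) := by
  rw [update, update, dist_add_left]
  refine (dist_sum_sum_le _ _ _).trans (Finset.sum_le_sum fun c _ => dist_msg_le hθ hθ1 _ _)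

/-- A message has components between log θ and 0, and a vertex has at most d children. Hence
solutions of (1) are automatically bounded, and uniqueness needs no growth condition. -/
theorem update_mem_Icc {lam θ : ℝ} (hθ : 0 < θ) (hθ1 : θ ≤ 1) (hd : k ≤ d)
    (h : Vertex k d → ℝ × ℝ) (x : Vertex k d) :
    update lam θ h x ∈ Set.Icc ((Real.log lam + d * Real.log θ, Real.log lam + d * Real.log θ) :
      ℝ × ℝ) (Real.log lam, Real.log lam) := by
  have hb : (branching k d x.level : ℝ) ≤ d := by
    unfold branching; split_ifs <;> simp [hd]
  have hlog : Real.log θ ≤ 0 := Real.log_nonpos hθ.le hθ1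
  have h1 := Finset.sum_le_sum fun c (_ : c ∈ Finset.univ) =>
    (msg_mem_Icc hθ hθ1 (h (x.child c))).2
  have h2 := Finset.sum_le_sum fun c (_ : c ∈ Finset.univ) =>
    (msg_mem_Icc hθ hθ1 (h (x.child c))).1
  rw [Finset.sum_const, Finset.card_univ, Fintype.card_fin] at h2
  simp only [Finset.sum_const_zero] at h1
  have h3 : (d : ℝ) * Real.log θ ≤ branching k d x.level * Real.log θ :=
    mul_le_mul_of_nonpos_right hb hlog
  refine ⟨⟨?_, ?_⟩, ⟨?_, ?_⟩⟩
  · have := h2.1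
    simp only [update, Prod.fst_add, nsmul_eq_mul, Prod.smul_mk] at this ⊢
    linarith
  · have := h2.2
    simp only [update, Prod.snd_add, nsmul_eq_mul, Prod.smul_mk] at this ⊢
    linarith
  · have := h1.1
    simp only [update, Prod.fst_add, Prod.fst_zero] at this ⊢
    linarith
  · have := h1.2
    simp only [update, Prod.snd_add, Prod.snd_zero] at this ⊢
    linarith

/-! ### Contraction along a path. -/

theorem dist_le_of_mem_Icc {a b : ℝ} {z z' : ℝ × ℝ}
    (hz : z ∈ Set.Icc ((a, a) : ℝ × ℝ) (b, b)) (hz' : z' ∈ Set.Icc ((a, a) : ℝ × ℝ) (b, b)) :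
    dist z z' ≤ b - a := by
  rw [Prod.dist_eq, max_le_iff]
  exact ⟨Real.dist_le_of_mem_Icc ⟨hz.1.1, hz.2.1⟩ ⟨hz'.1.1, hz'.2.1⟩,
    Real.dist_le_of_mem_Icc ⟨hz.1.2, hz.2.2⟩ ⟨hz'.1.2, hz'.2.2⟩⟩

/-- A bounded nonnegative sequence contracted at each step vanishes. -/
theorem eq_zero_of_contraction {q K : ℝ} {D : ℕ → ℝ} {n₀ : ℕ} (hq : 0 ≤ q) (hq1 : q < 1)
    (hD0 : ∀ m, 0 ≤ D m) (hDK : ∀ m, n₀ ≤ m → D m ≤ K) (hD : ∀ m, n₀ ≤ m → D m ≤ q * D (m + 1))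
    {m : ℕ} (hm : n₀ ≤ m) : D m = 0 := by
  have key : ∀ L m, n₀ ≤ m → D m ≤ q ^ L * K := by
    intro L
    induction L with
    | zero => intro m hm; simpa using hDK m hm
    | succ L ih =>
      intro m hm
      refine (hD m hm).trans ?_
      rw [pow_succ', mul_assoc]
      exact mul_le_mul_of_nonneg_left (ih (m + 1) (by omega)) hq
  have hlim : Filter.Tendsto (fun L => q ^ L * K) Filter.atTop (nhds (0 * K)) :=
    (tendsto_pow_atTop_nhds_zero_of_lt_one hq hq1).mul_const K
  rw [zero_mul] at hlim
  exact le_antisymm (ge_of_tendsto' hlim fun L => key L m hm) (hD0 m)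

namespace RootPath

/-- Two solutions of the compatibility equations along a path, which agree at the siblings of the
path vertices, agree on the path. -/
theorem eq_on_path {lam θ : ℝ} (hθ : 1 / 9 < θ) (hθ1 : θ ≤ 1) (hd : k ≤ d) (π : RootPath k d)
    {g g' : Vertex k d → ℝ × ℝ} {n₀ : ℕ}
    (hg : ∀ m, n₀ ≤ m → g (π.vertex m) = update lam θ g (π.vertex m))
    (hg' : ∀ m, n₀ ≤ m → g' (π.vertex m) = update lam θ g' (π.vertex m))
    (hs : ∀ m, n₀ ≤ m → ∀ c, c ≠ π.choice m →
      g ((π.vertex m).child c) = g' ((π.vertex m).child c))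
    {m : ℕ} (hm : n₀ ≤ m) : g (π.vertex m) = g' (π.vertex m) := by
  have hθ0 : 0 < θ := by linarith
  refine dist_eq_zero.1 (eq_zero_of_contraction (D := fun m => dist (g (π.vertex m))
    (g' (π.vertex m))) (n₀ := n₀) (K := Real.log lam - (Real.log lam + d * Real.log θ))
    (contraction_nonneg hθ1) (contraction_lt_one hθ) (fun m => dist_nonneg) (fun m hm => ?_)
    (fun m hm => ?_) hm)
  · rw [hg m hm, hg' m hm]
    exact dist_le_of_mem_Icc (update_mem_Icc hθ0 hθ1 hd _ _) (update_mem_Icc hθ0 hθ1 hd _ _)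
  · nth_rewrite 1 [hg m hm]
    nth_rewrite 1 [hg' m hm]
    refine (dist_update_le hθ0 hθ1 g g' _).trans_eq ?_
    -- Siblings contribute nothing, so a single child remains and the factor per step is the
    -- contraction constant, without a factor k.
    rw [Finset.sum_eq_single (π.choice m) (fun c _ hc => by rw [hs m hm c hc]; simp)
      (fun h => (h (Finset.mem_univ _)).elim)]
    rfl

/-- Value of a path law at the `c`-th child of the `n`-th path vertex, if its value at the next
path vertex is `z`. -/
def sibling (π : RootPath k d) (X X' z : ℝ × ℝ) (n c : ℕ) : ℝ × ℝ :=
  if c < π.step n then X' else if c = π.step n then z else X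

/-- The path values form a fixed point of a contraction of the bounded sequences: coordinate n of
the image depends on the sequence only through coordinate n + 1. -/
theorem exists_path_solution {lam θ : ℝ} (hθ : 1 / 9 < θ) (hθ1 : θ ≤ 1) (hd : k ≤ d)
    (π : RootPath k d) (X X' : ℝ × ℝ) :
    ∃ z : ℕ → ℝ × ℝ, ∀ n, z n = (Real.log lam, Real.log lam) +
      ∑ c : Fin (branching k d (π.vertex n).level), msg θ (π.sibling X X' (z (n + 1)) n c) := by
  have hθ0 : 0 < θ := by linarith
  have hbound : ∀ (z : ℕ → ℝ × ℝ) (n : ℕ), ‖(Real.log lam, Real.log lam) +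
      ∑ c : Fin (branching k d (π.vertex n).level), msg θ (π.sibling X X' (z (n + 1)) n c)‖ ≤
      ‖((Real.log lam, Real.log lam) : ℝ × ℝ)‖ + d * -Real.log θ := by
    intro z n
    refine (norm_add_le _ _).trans (by
      gcongr
      refine (norm_sum_le_of_le (f := fun c : Fin (branching k d (π.vertex n).level) =>
        msg θ (π.sibling X X' (z (n + 1)) n c)) (n := fun _ => -Real.log θ) _ fun c _ => ?_).trans ?_
      · obtain ⟨h1, h2⟩ := msg_mem_Icc hθ0 hθ1 (π.sibling X X' (z (n + 1)) n c)
        rw [Prod.norm_def, max_le_iff, Real.norm_eq_abs, Real.norm_eq_abs, abs_le, abs_le, neg_neg]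
        have hlog : Real.log θ ≤ 0 := Real.log_nonpos hθ0.le hθ1
        have a1 := h1.1
        have a2 := h1.2
        have a3 := h2.1
        have a4 := h2.2
        simp only [Prod.fst_zero, Prod.snd_zero] at a1 a2 a3 a4
        exact ⟨⟨a1, by linarith⟩, ⟨a2, by linarith⟩⟩
      · rw [Finset.sum_const, Finset.card_univ, Fintype.card_fin, nsmul_eq_mul]
        have hlog : 0 ≤ -Real.log θ := by
          have := Real.log_nonpos hθ0.le hθ1
          linarith
        have hb : (branching k d (π.vertex n).level : ℝ) ≤ d := by
          unfold branching; split_ifs <;> simp [hd]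
        gcongr)
  let Φ : (ℕ →ᵇ ℝ × ℝ) → (ℕ →ᵇ ℝ × ℝ) := fun z =>
    BoundedContinuousFunction.ofNormedAddCommGroupDiscrete
      (fun n => (Real.log lam, Real.log lam) +
        ∑ c : Fin (branching k d (π.vertex n).level), msg θ (π.sibling X X' (z (n + 1)) n c)) _ (hbound z)
  have hΦ : ContractingWith (contraction θ).toNNReal Φ := by
    refine ⟨Real.toNNReal_lt_one.2 (contraction_lt_one hθ), LipschitzWith.of_dist_le_mul fun z z' => ?_⟩
    rw [Real.coe_toNNReal _ (contraction_nonneg hθ1),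
      BoundedContinuousFunction.dist_le (mul_nonneg (contraction_nonneg hθ1) dist_nonneg)]
    intro n
    change dist ((Real.log lam, Real.log lam) + _) ((Real.log lam, Real.log lam) + _) ≤ _
    rw [dist_add_left]
    refine (dist_sum_sum_le _ _ _).trans ?_
    rw [Finset.sum_eq_single (π.choice n) (fun c _ hc => by
      have : (c : ℕ) ≠ π.step n := fun h => hc (Fin.ext h)
      simp [sibling, this]) (fun h => (h (Finset.mem_univ _)).elim)]
    refine (dist_msg_le hθ0 hθ1 _ _).trans ?_
    simp only [sibling, choice, lt_irrefl, if_false, if_true]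
    exact mul_le_mul_of_nonneg_left (z.dist_coe_le_dist (n + 1)) (contraction_nonneg hθ1)
  let w : ℕ →ᵇ ℝ × ℝ := ContractingWith.fixedPoint Φ hΦ
  have hw : Φ w = w := hΦ.fixedPoint_isFixedPt
  exact ⟨w, fun n => (congrArg (fun z : ℕ →ᵇ ℝ × ℝ => z n) hw).symm⟩

/-! ### Existence and uniqueness of path laws, and dependence on the number only. -/

variable {lam θ x₁ x₂ : ℝ}

theorem exists_isPathLaw (hθ : 1 / 9 < θ) (hθ1 : θ ≤ 1) (hl : 0 < lam) (hd : k ≤ d)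
    (hs : IsConstantSolution k lam θ x₁ x₂) (π : RootPath k d) :
    ∃ h, IsPathLaw lam θ x₁ x₂ π h := by
  classical
  have hθ0 : 0 < θ := by linarith
  obtain ⟨z, hz⟩ := exists_path_solution (lam := lam) hθ hθ1 hd π
    (Real.log x₁, Real.log x₂) (Real.log x₂, Real.log x₁)
  let h : Vertex k d → ℝ × ℝ := fun x => if π.IsRight x then (Real.log x₁, Real.log x₂) else
    if π.IsLeft x then (Real.log x₂, Real.log x₁) else z x.level
  have hr : ∀ x, π.IsRight x → h x = (Real.log x₁, Real.log x₂) := fun x hx => if_pos hx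
  have hl' : ∀ x, π.IsLeft x → h x = (Real.log x₂, Real.log x₁) := fun x hx => by
    simp only [h]
    rw [if_neg (π.not_isRight_of_isLeft hx), if_pos hx]
  have hp : ∀ n, h (π.vertex n) = z n := fun n => by
    simp only [h]
    rw [if_neg (π.not_isRight_vertex n), if_neg (π.not_isLeft_vertex n), level_vertex]
  refine ⟨h, isBoundaryLaw_iff.2 fun x => ?_, hr, hl'⟩
  rcases π.isRight_or_isLeft_or_eq x with hx | hx | hx
  · rw [hr x hx]
    exact (update_const (isConstantSolution_log hl hθ0 hs) hx.level_pos
      fun c => hr _ (hx.child c)).symm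
  · rw [hl' x hx]
    exact (update_const (isConstantSolution_log hl hθ0 hs.swap) hx.level_pos
      fun c => hl' _ (hx.child c)).symm
  · obtain ⟨n, rfl⟩ : ∃ n, x = π.vertex n := ⟨_, hx⟩
    have hc : ∀ c, h ((π.vertex n).child c) =
        π.sibling (Real.log x₁, Real.log x₂) (Real.log x₂, Real.log x₁) (z (n + 1)) n c := by
      intro c
      unfold sibling
      rcases lt_trichotomy (c : ℕ) (π.step n) with hlt | heq | hgt
      · rw [if_pos hlt, hl' _ (π.isLeft_child_vertex c hlt)]
      · rw [if_neg heq.not_lt, if_pos heq, ← hp]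
        congr 1
        rw [← child_choice]
        congr 1
        exact Fin.ext heq
      · rw [if_neg hgt.not_gt, if_neg hgt.ne', hr _ (π.isRight_child_vertex c hgt)]
    rw [hp, hz, update]
    exact congrArg _ (Finset.sum_congr rfl fun c _ => by rw [hc c])

/-- Path laws agree off the path. -/
theorem eq_child_of_ne_choice {g : Vertex k d → ℝ × ℝ} (π : RootPath k d)
    (hg : IsPathLaw lam θ x₁ x₂ π g) {n : ℕ} (c : Fin (branching k d (π.vertex n).level))
    (hc : c ≠ π.choice n) : g ((π.vertex n).child c) =
      if c < π.choice n then (Real.log x₂, Real.log x₁) else (Real.log x₁, Real.log x₂) := by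
  rcases lt_or_gt_of_ne hc with h | h
  · rw [if_pos h]; exact hg.2.2 _ (π.isLeft_child_vertex c h)
  · rw [if_neg h.not_gt]; exact hg.2.1 _ (π.isRight_child_vertex c h)

theorem isPathLaw_unique (hθ : 1 / 9 < θ) (hθ1 : θ ≤ 1) (hd : k ≤ d) (π : RootPath k d)
    {g g' : Vertex k d → ℝ × ℝ} (hg : IsPathLaw lam θ x₁ x₂ π g)
    (hg' : IsPathLaw lam θ x₁ x₂ π g') : g = g' := by
  funext x
  rcases π.isRight_or_isLeft_or_eq x with hx | hx | hx
  · rw [hg.2.1 x hx, hg'.2.1 x hx]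
  · rw [hg.2.2 x hx, hg'.2.2 x hx]
  · rw [hx]
    refine π.eq_on_path (lam := lam) (n₀ := 0) hθ hθ1 hd (fun m _ => isBoundaryLaw_iff.1 hg.1 _)
      (fun m _ => isBoundaryLaw_iff.1 hg'.1 _) (fun m _ c hc => ?_) (Nat.zero_le _)
    rw [π.eq_child_of_ne_choice hg c hc, π.eq_child_of_ne_choice hg' c hc]

/-- If the siblings of the path vertices from level `n₀ ≥ 1` on all carry the same constant
solution, so do these path vertices. -/
theorem eq_const_on_path (hθ : 1 / 9 < θ) (hθ1 : θ ≤ 1) (hd : k ≤ d) (π : RootPath k d)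
    {g : Vertex k d → ℝ × ℝ} (hg : IsBoundaryLaw lam θ g) {X : ℝ × ℝ}
    (hX : X = (Real.log lam, Real.log lam) + (k : ℝ) • msg θ X) {n₀ : ℕ} (hn₀ : 0 < n₀)
    (hs : ∀ m, n₀ ≤ m → ∀ c, c ≠ π.choice m → g ((π.vertex m).child c) = X)
    {m : ℕ} (hm : n₀ ≤ m) : g (π.vertex m) = X :=
  π.eq_on_path (lam := lam) (g' := fun _ => X) hθ hθ1 hd (fun m _ => isBoundaryLaw_iff.1 hg _)
    (fun m hm => (update_const hX (by rw [level_vertex]; omega) fun _ => rfl).symm) hs hm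

/-- Only the tail of π changes sides. Its siblings are all to the left of π and carry the swapped
constant solution, so the tail carries it as well, as required to the left of π'. -/
theorem Adjacent.isPathLaw (hθ : 1 / 9 < θ) (hθ1 : θ ≤ 1) (hl : 0 < lam) (hd : k ≤ d)
    (hs : IsConstantSolution k lam θ x₁ x₂) {π π' : RootPath k d} {n : ℕ} (h : Adjacent π π' n)
    {g : Vertex k d → ℝ × ℝ} (hg : IsPathLaw lam θ x₁ x₂ π g) : IsPathLaw lam θ x₁ x₂ π' g := by
  have hθ0 : 0 < θ := by linarith
  refine ⟨hg.1, fun x hx => hg.2.1 x (h.isRight hx), fun x hx => ?_⟩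
  rcases h.isLeft hx with hx | ⟨m, hm, rfl⟩
  · exact hg.2.2 x hx
  · refine π.eq_const_on_path hθ hθ1 hd hg.1 (isConstantSolution_log hl hθ0 hs.swap)
      (n₀ := n + 1) (by omega) (fun j hj c hc => ?_) hm
    rw [π.eq_child_of_ne_choice hg c hc, if_pos]
    have h1 : (c : ℕ) < k := c.2.trans_eq (branching_of_pos (by rw [level_vertex]; omega))
    have h2 := h.last j (by omega)
    have h3 : (c : ℕ) ≠ π.step j := fun h => hc (Fin.ext h)
    rw [Fin.lt_def]
    change (c : ℕ) < π.step j
    omega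

theorem isPathLaw_of_number_eq (hk : 2 ≤ k) (hθ : 1 / 9 < θ) (hθ1 : θ ≤ 1) (hl : 0 < lam)
    (hd : k ≤ d) (hs : IsConstantSolution k lam θ x₁ x₂) {π π' : RootPath k d}
    (hn : π.number = π'.number) {g : Vertex k d → ℝ × ℝ} (hg : IsPathLaw lam θ x₁ x₂ π g) :
    IsPathLaw lam θ x₁ x₂ π' g := by
  by_cases hne : π = π'
  · rwa [← hne]
  obtain ⟨n, h1, h2⟩ := exists_first_difference hne
  rcases lt_or_gt_of_ne h2 with h2 | h2
  · exact ((number_eq_iff_adjacent hk hd h1 h2).1 hn).isPathLaw hθ hθ1 hl hd hs hg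
  · have ha := (number_eq_iff_adjacent hk hd (fun j hj => (h1 j hj).symm) h2).1 hn.symm
    -- If π is the right one of the two paths, the law of π' is also a law of π, and uniqueness for
    -- π identifies it with `g`.
    obtain ⟨g', hg'⟩ := exists_isPathLaw hθ hθ1 hl hd hs π'
    rwa [isPathLaw_unique hθ hθ1 hd π hg (ha.isPathLaw hθ hθ1 hl hd hs hg')]

/-- The root is excluded because it has d successors, so for d = k + 1 the equation there differs
from (2). Splitting Gibbs measures do not see the root value. -/
theorem isPathLaw_leftmost (hθ : 1 / 9 < θ) (hθ1 : θ ≤ 1) (hl : 0 < lam) (hd : k ≤ d)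
    (hs : IsConstantSolution k lam θ x₁ x₂) {π : RootPath k d} (hπ : ∀ n, π.step n = 0)
    {g : Vertex k d → ℝ × ℝ} (hg : IsPathLaw lam θ x₁ x₂ π g) {x : Vertex k d} (hx : 0 < x.level) :
    g x = (Real.log x₁, Real.log x₂) := by
  have hθ0 : 0 < θ := by linarith
  rcases π.isRight_or_isLeft_or_eq x with h | h | h
  · exact hg.2.1 x h
  · obtain ⟨n, c, hc, -⟩ := h
    rw [hπ n] at hc; omega
  · rw [h]
    refine π.eq_const_on_path hθ hθ1 hd hg.1 (isConstantSolution_log hl hθ0 hs)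
      (n₀ := 1) (by omega) (fun j hj c hc => ?_) hx
    rw [π.eq_child_of_ne_choice hg c hc, if_neg]
    rw [Fin.lt_def]
    change ¬ (c : ℕ) < π.step j
    rw [hπ]; omega

theorem isPathLaw_rightmost (hθ : 1 / 9 < θ) (hθ1 : θ ≤ 1) (hl : 0 < lam) (hd : k ≤ d)
    (hs : IsConstantSolution k lam θ x₁ x₂) {π : RootPath k d}
    (hπ : ∀ n, π.step n + 1 = branching k d n) {g : Vertex k d → ℝ × ℝ}
    (hg : IsPathLaw lam θ x₁ x₂ π g) {x : Vertex k d} (hx : 0 < x.level) :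
    g x = (Real.log x₂, Real.log x₁) := by
  have hθ0 : 0 < θ := by linarith
  rcases π.isRight_or_isLeft_or_eq x with h | h | h
  · obtain ⟨n, c, hc, h⟩ := h
    have := π.lt_branching_of_suffix h
    rw [← hπ n] at this; omega
  · exact hg.2.2 x h
  · rw [h]
    refine π.eq_const_on_path hθ hθ1 hd hg.1 (isConstantSolution_log hl hθ0 hs.swap)
      (n₀ := 1) (by omega) (fun j hj c hc => ?_) hx
    rw [π.eq_child_of_ne_choice hg c hc, if_pos]
    have h1 : (c : ℕ) < branching k d j := c.2.trans_eq (by rw [level_vertex])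
    have h2 := hπ j
    have h3 : (c : ℕ) ≠ π.step j := fun h => hc (Fin.ext h)
    rw [Fin.lt_def]
    change (c : ℕ) < π.step j
    omega

end RootPath

end

end WidomRowlinson

open MeasureTheory

namespace WidomRowlinson

noncomputable section

variable {k d : ℕ}

/-! ### Cylinder sets -/

instance : DiscreteMeasurableSpace SignType := ⟨fun _ => trivial⟩

/-- The configurations that agree with `σ` on `Λ`. -/
def cylinder (Λ : Finset (Vertex k d)) (σ : Config k d) : Set (Config k d) :=
  {ω | ∀ x ∈ Λ, ω x = σ x}

theorem measurableSet_cylinder (Λ : Finset (Vertex k d)) (σ : Config k d) :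
    MeasurableSet (cylinder Λ σ) := by
  have : cylinder Λ σ = ⋂ x ∈ Λ, (fun ω : Config k d => ω x) ⁻¹' {σ x} := by
    ext ω; simp [cylinder]
  rw [this]
  exact Finset.measurableSet_biInter _ fun x _ => measurable_pi_apply x (measurableSet_singleton _)

theorem glue_of_mem {Λ : Finset (Vertex k d)} (ξ : Λ → SignType) (ω : Config k d) {x : Vertex k d}
    (hx : x ∈ Λ) : glue Λ ξ ω x = ξ ⟨x, hx⟩ := dif_pos hx

theorem glue_of_notMem {Λ : Finset (Vertex k d)} (ξ : Λ → SignType) (ω : Config k d)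
    {x : Vertex k d} (hx : x ∉ Λ) : glue Λ ξ ω x = ω x := dif_neg hx

theorem glue_restrict (Λ : Finset (Vertex k d)) (ω : Config k d) :
    glue Λ (fun x => ω x) ω = ω := by
  funext x
  by_cases hx : x ∈ Λ
  · rw [glue_of_mem _ _ hx]
  · rw [glue_of_notMem _ _ hx]

theorem cylinder_glue_eq_preimage (Λ : Finset (Vertex k d)) (ξ : Λ → SignType) (ω : Config k d) :
    cylinder Λ (glue Λ ξ ω) = (Λ.restrict : Config k d → Λ → SignType) ⁻¹' {ξ} := by
  ext ω'
  simp only [cylinder, Set.mem_ofPred_eq, Set.mem_preimage, Set.mem_singleton_iff, funext_iff,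
    Finset.restrict, Subtype.forall]
  exact forall₂_congr fun x hx => by rw [glue_of_mem _ _ hx]

theorem measurable_finset_restrict (Λ : Finset (Vertex k d)) :
    Measurable (Λ.restrict : Config k d → Λ → SignType) :=
  measurable_pi_lambda _ fun _ => measurable_pi_apply _

/-- Decomposition of a measure according to the configuration in a finite set. -/
theorem sum_measure_inter_cylinder (μ : Measure (Config k d)) (Λ : Finset (Vertex k d))
    (η : Config k d) (A : Set (Config k d)) :
    ∑ ξ : Λ → SignType, μ (A ∩ cylinder Λ (glue Λ ξ η)) = μ A := by
  have h := sum_measure_preimage_singleton (μ := μ.restrict A)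
    (Finset.univ : Finset (Λ → SignType)) (f := Λ.restrict (π := fun _ => SignType))
    fun y _ => measurable_finset_restrict Λ (measurableSet_singleton y)
  rw [Finset.coe_univ, Set.preimage_univ, Measure.restrict_apply_univ] at h
  rw [← h]
  refine Finset.sum_congr rfl fun ξ _ => ?_
  rw [cylinder_glue_eq_preimage, Measure.restrict_apply
    (measurable_finset_restrict Λ (measurableSet_singleton ξ)), Set.inter_comm]

theorem ball_mono {m n : ℕ} (h : m ≤ n) : ball k d m ⊆ ball k d n := fun x hx => by
  rw [mem_ball] at hx ⊢; omega

theorem exists_subset_ball (Λ : Finset (Vertex k d)) (n₀ : ℕ) : ∃ n, n₀ ≤ n ∧ Λ ⊆ ball k d n :=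
  ⟨max n₀ (Λ.sup Vertex.level), le_max_left _ _, fun x hx => by
    rw [mem_ball]
    exact (Finset.le_sup (f := Vertex.level) hx).trans (le_max_right _ _)⟩

/-- A finite measure is determined by its values at cylinders over large balls. -/
theorem ext_of_cylinder {μ ν : Measure (Config k d)} [IsFiniteMeasure ν] (n₀ : ℕ)
    (h : ∀ n, n₀ ≤ n → ∀ σ, μ (cylinder (ball k d n) σ) = ν (cylinder (ball k d n) σ)) :
    μ = ν := by
  refine IsProjectiveLimit.unique (P := fun I : Finset (Vertex k d) => ν.map I.restrict)
    (fun I => ?_) fun I => rfl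
  obtain ⟨n, hn, hI⟩ := exists_subset_ball I n₀
  have hball : μ.map (ball k d n).restrict = ν.map (ball k d n).restrict := by
    refine Measure.ext_of_singleton fun ξ => ?_
    rw [Measure.map_apply (measurable_finset_restrict _) (measurableSet_singleton _),
      Measure.map_apply (measurable_finset_restrict _) (measurableSet_singleton _),
      ← cylinder_glue_eq_preimage _ _ fun _ => 0, h n hn]
  have hcomp : (I.restrict : Config k d → I → SignType) =
      Finset.restrict₂ (π := fun _ => SignType) hI ∘ (ball k d n).restrict := rfl
  have hm : Measurable (Finset.restrict₂ (π := fun _ : Vertex k d => SignType) hI) :=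
    measurable_pi_lambda _ fun _ => measurable_pi_apply _
  rw [hcomp, ← Measure.map_map hm (measurable_finset_restrict _), hball,
    Measure.map_map hm (measurable_finset_restrict _)]
  rfl

/-! ### Markov chains indexed by the tree -/

/-- Spin of the parent of `x`, with the convention that the root has a parent with spin `0`. -/
def parentSpin (σ : Config k d) (x : Vertex k d) : SignType :=
  if x = Vertex.root then 0 else σ x.parent

@[simp] theorem parentSpin_root (σ : Config k d) : parentSpin σ Vertex.root = 0 := if_pos rfl

theorem child_ne_root (x : Vertex k d) (c : Fin (branching k d x.level)) :
    x.child c ≠ Vertex.root := fun h => by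
  have := congrArg Vertex.code h
  simp [Vertex.child, Vertex.root] at this

theorem parent_child (x : Vertex k d) (c : Fin (branching k d x.level)) :
    (x.child c).parent = x := rfl

@[simp] theorem parentSpin_child (σ : Config k d) (x : Vertex k d)
    (c : Fin (branching k d x.level)) : parentSpin σ (x.child c) = σ x :=
  if_neg (child_ne_root x c)

@[simp] theorem level_child (x : Vertex k d) (c : Fin (branching k d x.level)) :
    (x.child c).level = x.level + 1 := rfl

theorem parent_mem_ball {n : ℕ} {x : Vertex k d} (hx : x ∈ ball k d n) :
    x.parent ∈ ball k d n := by
  rw [mem_ball] at hx ⊢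
  refine le_trans ?_ hx
  simp [Vertex.parent, Vertex.level]

theorem parentSpin_congr {σ σ' : Config k d} {n : ℕ} (h : ∀ x ∈ ball k d n, σ x = σ' x)
    {x : Vertex k d} (hx : x ∈ ball k d n) : parentSpin σ x = parentSpin σ' x := by
  unfold parentSpin
  split_ifs
  · rfl
  · exact h _ (parent_mem_ball hx)

/-- Law of the spin at a vertex with weights `law h`, given the spin `s` of its parent. -/
def transMeasure (θ : ℝ) (h : ℝ × ℝ) (s : SignType) : Measure SignType :=
  ∑ s', ENNReal.ofReal (trans θ h s s') • Measure.dirac s'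

theorem transMeasure_singleton (θ : ℝ) (h : ℝ × ℝ) (s s' : SignType) :
    transMeasure θ h s {s'} = ENNReal.ofReal (trans θ h s s') := by
  simp only [transMeasure, Measure.coe_finsetSum, Finset.sum_apply, Measure.smul_apply,
    Measure.dirac_apply, smul_eq_mul]
  rw [Finset.sum_eq_single s' (fun b _ hb => by simp [hb])
    fun h => (h (Finset.mem_univ _)).elim]
  simp

theorem isProbabilityMeasure_transMeasure {θ : ℝ} (hθ : 0 < θ) (h : ℝ × ℝ) (s : SignType) :
    IsProbabilityMeasure (transMeasure θ h s) := by
  constructor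
  simp only [transMeasure, Measure.coe_finsetSum, Finset.sum_apply, Measure.smul_apply,
    measure_univ, smul_eq_mul, mul_one]
  rw [← ENNReal.ofReal_sum_of_nonneg fun i _ => (trans_pos hθ h s i).le, sum_trans hθ,
    ENNReal.ofReal_one]

/-- The spin at the vertex with code `l`, when the spin at each vertex is a function `U` of the
vertex and the spin of its parent. -/
def follow (U : Vertex k d × SignType → SignType) : (l : List ℕ) → IsVertex k d l → SignType
  | [], h => U (⟨[], h⟩, 0)
  | c :: l, h => U (⟨c :: l, h⟩, follow U l h.2)

theorem measurable_follow (l : List ℕ) (hl : IsVertex k d l) :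
    Measurable fun U : Vertex k d × SignType → SignType => follow U l hl := by
  induction l with
  | nil => exact measurable_pi_apply _
  | cons c l ih =>
    refine measurable_to_countable' fun s' => ?_
    have : (fun U : Vertex k d × SignType → SignType => follow U (c :: l) hl) ⁻¹' {s'} =
        ⋃ s : SignType, (fun U => follow U l hl.2) ⁻¹' {s} ∩
          (fun U : Vertex k d × SignType → SignType => U (⟨c :: l, hl⟩, s)) ⁻¹' {s'} := by
      ext U; simp [follow]
    rw [this]
    exact MeasurableSet.iUnion fun s => (ih hl.2 (measurableSet_singleton s)).inter
      (measurable_pi_apply _ (measurableSet_singleton s'))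

/-- The configuration with spins `follow U`. -/
def followConfig (U : Vertex k d × SignType → SignType) : Config k d :=
  fun x => follow U x.code x.isVertex

theorem measurable_followConfig :
    Measurable (followConfig : (Vertex k d × SignType → SignType) → Config k d) :=
  measurable_pi_lambda _ fun x => measurable_follow x.code x.isVertex

theorem followConfig_apply (U : Vertex k d × SignType → SignType) (x : Vertex k d) :
    followConfig U x = U (x, parentSpin (followConfig U) x) := by
  obtain ⟨l, hl⟩ := x
  cases l with
  | nil => rfl
  | cons c l =>
    have : parentSpin (followConfig U) ⟨c :: l, hl⟩ = follow U l hl.2 :=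
      if_neg fun h => by simpa [Vertex.root] using congrArg Vertex.code h
    rw [this]; rfl

/-- On a cylinder all parent spins are known, so the event prescribes exactly one variable `U (x,
s)` per vertex of the ball. -/
theorem followConfig_mem_cylinder_iff (U : Vertex k d × SignType → SignType) (n : ℕ)
    (σ : Config k d) : followConfig U ∈ cylinder (ball k d n) σ ↔
      ∀ x ∈ ball k d n, U (x, parentSpin σ x) = σ x := by
  constructor
  · intro h x hx
    rw [← parentSpin_congr h hx, ← followConfig_apply U]
    exact h x hx
  · intro h x hx
    obtain ⟨l, hl⟩ := x
    induction l with
    | nil => exact h _ hx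
    | cons c l ih =>
      rw [followConfig_apply, ← h _ hx]
      congr 2
      have hne : (⟨c :: l, hl⟩ : Vertex k d) ≠ Vertex.root := fun h => by
        simpa [Vertex.root] using congrArg Vertex.code h
      unfold parentSpin
      rw [if_neg hne, if_neg hne]
      exact ih hl.2 (parent_mem_ball hx)

/-- The law of the tree-indexed Markov chain with transition probabilities `trans θ (h x)`. -/
def chainMeasure (θ : ℝ) (h : Vertex k d → ℝ × ℝ) : Measure (Config k d) :=
  (Measure.infinitePi fun p : Vertex k d × SignType => transMeasure θ (h p.1) p.2).map followConfig

/-- Probability that the tree-indexed Markov chain agrees with `σ` on `V_n`. -/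
def chainProb (θ : ℝ) (h : Vertex k d → ℝ × ℝ) (n : ℕ) (σ : Config k d) : ℝ :=
  ∏ x ∈ ball k d n, trans θ (h x) (parentSpin σ x) (σ x)

theorem isProbabilityMeasure_chainMeasure {θ : ℝ} (hθ : 0 < θ) (h : Vertex k d → ℝ × ℝ) :
    IsProbabilityMeasure (chainMeasure θ h) := by
  have := fun p : Vertex k d × SignType => isProbabilityMeasure_transMeasure hθ (h p.1) p.2
  exact Measure.isProbabilityMeasure_map measurable_followConfig.aemeasurable

theorem chainProb_pos {θ : ℝ} (hθ : 0 < θ) (h : Vertex k d → ℝ × ℝ) (n : ℕ) (σ : Config k d) :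
    0 < chainProb θ h n σ := Finset.prod_pos fun _ _ => trans_pos hθ _ _ _

/-- The prescribed variables belong to different vertices, hence are independent, and their
probabilities multiply. The chain thus exists for every `h`, whether or not it solves (1). -/
theorem chainMeasure_cylinder {θ : ℝ} (hθ : 0 < θ) (h : Vertex k d → ℝ × ℝ) (n : ℕ)
    (σ : Config k d) :
    chainMeasure θ h (cylinder (ball k d n) σ) = ENNReal.ofReal (chainProb θ h n σ) := by
  have := fun p : Vertex k d × SignType => isProbabilityMeasure_transMeasure hθ (h p.1) p.2
  have hinj : Function.Injective fun x : Vertex k d => (x, parentSpin σ x) :=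
    fun x y hxy => (Prod.ext_iff.1 hxy).1
  have hset : followConfig ⁻¹' cylinder (ball k d n) σ =
      (((ball k d n).image fun x => (x, parentSpin σ x) : Finset (Vertex k d × SignType)) :
        Set (Vertex k d × SignType)).pi fun p => {σ p.1} := by
    ext U
    rw [Set.mem_preimage, followConfig_mem_cylinder_iff]
    simp [Set.mem_pi]
  rw [chainMeasure, Measure.map_apply measurable_followConfig (measurableSet_cylinder _ _), hset,
    Measure.infinitePi_pi _ fun _ _ => measurableSet_singleton _,
    Finset.prod_image hinj.injOn, chainProb,
    ENNReal.ofReal_prod_of_nonneg fun _ _ => (trans_pos hθ _ _ _).le]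
  exact Finset.prod_congr rfl fun x _ => transMeasure_singleton _ _ _ _

theorem sum_chainProb {θ : ℝ} (hθ : 0 < θ) (h : Vertex k d → ℝ × ℝ) (n : ℕ) (η : Config k d) :
    ∑ ξ : ball k d n → SignType, chainProb θ h n (glue (ball k d n) ξ η) = 1 := by
  have := isProbabilityMeasure_chainMeasure hθ h
  have h1 := sum_measure_inter_cylinder (chainMeasure θ h) (ball k d n) η Set.univ
  simp only [Set.univ_inter, chainMeasure_cylinder hθ, measure_univ] at h1
  rw [← ENNReal.ofReal_sum_of_nonneg fun _ _ => (chainProb_pos hθ _ _ _).le,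
    ENNReal.ofReal_eq_one] at h1
  exact h1

/-- Cylinder probabilities over a small ball as sums of those over a large ball. -/
theorem sum_chainProb_filter {θ : ℝ} (hθ : 0 < θ) (h : Vertex k d → ℝ × ℝ) {m n : ℕ} (hmn : m ≤ n)
    (σ η : Config k d) :
    ∑ ξ : ball k d n → SignType, (cylinder (ball k d m) σ).indicator (chainProb θ h n)
      (glue (ball k d n) ξ η) = chainProb θ h m σ := by
  have := isProbabilityMeasure_chainMeasure hθ h
  have h1 := sum_measure_inter_cylinder (chainMeasure θ h) (ball k d n) η
    (cylinder (ball k d m) σ)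
  have h2 : ∀ ξ : ball k d n → SignType, chainMeasure θ h (cylinder (ball k d m) σ ∩
      cylinder (ball k d n) (glue (ball k d n) ξ η)) =
      ENNReal.ofReal ((cylinder (ball k d m) σ).indicator (chainProb θ h n)
        (glue (ball k d n) ξ η)) := by
    intro ξ
    by_cases hξ : glue (ball k d n) ξ η ∈ cylinder (ball k d m) σ
    · rw [Set.indicator_of_mem hξ, ← chainMeasure_cylinder hθ, Set.inter_eq_right.2]
      intro ω hω x hx
      rw [hω x (ball_mono hmn hx), hξ x hx]
    · rw [Set.indicator_of_notMem hξ, ENNReal.ofReal_zero, ← measure_empty (μ := chainMeasure θ h)]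
      congr 1
      refine Set.eq_empty_iff_forall_notMem.2 fun ω hω => hξ fun x hx => ?_
      rw [← hω.2 x (ball_mono hmn hx), hω.1 x hx]
  have h3 : ∀ η, 0 ≤ (cylinder (ball k d m) σ).indicator (chainProb θ h n) η := fun η =>
    Set.indicator_nonneg (fun _ _ => (chainProb_pos hθ _ _ _).le) η
  simp only [h2, chainMeasure_cylinder hθ] at h1
  rw [← ENNReal.ofReal_sum_of_nonneg fun _ _ => h3 _] at h1
  exact (ENNReal.ofReal_eq_ofReal_iff (Finset.sum_nonneg fun _ _ => h3 _)
    (chainProb_pos hθ _ _ _).le).1 h1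

/-! ### Boundary laws and finite-volume weights -/

theorem mem_sphere (n : ℕ) (x : Vertex k d) : x ∈ sphere k d n ↔ x.level = n := by
  rw [sphere, Finset.mem_filter, mem_ball]; omega

theorem exists_eq_child {x : Vertex k d} (hx : 0 < x.level) :
    ∃ (y : Vertex k d) (c : Fin (branching k d y.level)), x = y.child c := by
  obtain ⟨l, hl⟩ := x
  cases l with
  | nil => simp [Vertex.level] at hx
  | cons c l => exact ⟨⟨l, hl.2⟩, ⟨c, hl.1⟩, rfl⟩

theorem child_injective (x : Vertex k d) : Function.Injective x.child := fun c c' h => by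
  have := congrArg Vertex.code h
  simp only [Vertex.child, List.cons.injEq, and_true] at this
  exact Fin.ext this

theorem prod_children {M : Type*} [CommMonoid M] (Λ : Finset (Vertex k d)) (f : Vertex k d → M) :
    ∏ y ∈ children Λ, f y = ∏ x ∈ Λ, ∏ c, f (x.child c) := by
  rw [children, Finset.prod_biUnion]
  · exact Finset.prod_congr rfl fun x _ => Finset.prod_image (child_injective x).injOn
  · intro x _ y _ hxy
    refine Finset.disjoint_left.2 fun z hz hz' => hxy ?_
    simp only [Finset.mem_image, Finset.mem_univ, true_and] at hz hz'
    obtain ⟨c, rfl⟩ := hz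
    obtain ⟨c', hc'⟩ := hz'
    simpa [parent_child] using congrArg Vertex.parent hc'.symm

theorem children_sphere (n : ℕ) : children (sphere k d n) = sphere k d (n + 1) := by
  ext y
  simp only [children, Finset.mem_biUnion, Finset.mem_image, Finset.mem_univ, true_and, mem_sphere]
  constructor
  · rintro ⟨x, rfl, c, rfl⟩; rfl
  · intro hy
    obtain ⟨x, c, rfl⟩ := exists_eq_child (x := y) (by omega)
    exact ⟨x, by simpa using hy, c, rfl⟩

theorem ball_succ_eq (n : ℕ) : ball k d (n + 1) = ball k d n ∪ sphere k d (n + 1) := by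
  ext x; simp only [Finset.mem_union, mem_ball, mem_sphere]; omega

theorem disjoint_ball_sphere (n : ℕ) : Disjoint (ball k d n) (sphere k d (n + 1)) :=
  Finset.disjoint_left.2 fun x hx hx' => by
    rw [mem_ball] at hx; rw [mem_sphere] at hx'; omega

theorem prod_ball_succ {M : Type*} [CommMonoid M] (n : ℕ) (f : Vertex k d → M) :
    ∏ x ∈ ball k d (n + 1), f x =
      (∏ x ∈ ball k d n, f x) * ∏ x ∈ sphere k d n, ∏ c, f (x.child c) := by
  rw [ball_succ_eq, Finset.prod_union (disjoint_ball_sphere n), ← children_sphere, prod_children]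

/-- The vertices at distance less than `n` from the root. -/
def openBall (k d n : ℕ) : Finset (Vertex k d) := (ball k d n).filter fun x => x.level < n

theorem openBall_succ (n : ℕ) : openBall k d (n + 1) = ball k d n := by
  ext x; simp only [openBall, Finset.mem_filter, mem_ball]; omega

theorem prod_ball {M : Type*} [CommMonoid M] (n : ℕ) (f : Vertex k d → M) :
    ∏ x ∈ ball k d n, f x = (∏ x ∈ openBall k d n, f x) * ∏ x ∈ sphere k d n, f x := by
  rw [← Finset.prod_union]
  · congr 1
    ext x; simp only [openBall, Finset.mem_union, Finset.mem_filter, mem_ball, mem_sphere]; omega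
  · refine Finset.disjoint_left.2 fun x hx hx' => ?_
    rw [mem_sphere] at hx'
    rw [openBall, Finset.mem_filter] at hx
    omega

/-- The compatibility equation in multiplicative form. It trades the weight at a vertex for its
activity and the normalisations of its children, up to a factor independent of the spin. -/
theorem law_update {lam θ : ℝ} (hθ : 0 < θ) (hl : 0 < lam) (h : Vertex k d → ℝ × ℝ)
    (x : Vertex k d) (s : SignType) :
    law (update lam θ h x) s * ∏ c, partition θ (h (x.child c)) 0 =
      activity lam s * ∏ c, partition θ (h (x.child c)) s := by
  have hp : ∏ c, partition θ (h (x.child c)) 0 ≠ 0 :=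
    Finset.prod_ne_zero_iff.2 fun c _ => (partition_pos hθ _ _).ne'
  have h1 : Real.exp (update lam θ h x).1 =
      lam * ∏ c, partition θ (h (x.child c)) 1 / partition θ (h (x.child c)) 0 := by
    rw [update, Prod.fst_add, Prod.fst_sum, Real.exp_add, Real.exp_log hl, Real.exp_sum]
    simp only [exp_msg_fst hθ]
  have h2 : Real.exp (update lam θ h x).2 =
      lam * ∏ c, partition θ (h (x.child c)) (-1) / partition θ (h (x.child c)) 0 := by
    rw [update, Prod.snd_add, Prod.snd_sum, Real.exp_add, Real.exp_log hl, Real.exp_sum]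
    simp only [exp_msg_snd hθ]
  cases s with
  | zero => simp [law, activity]
  | pos =>
    change Real.exp (update lam θ h x).1 * _ = activity lam 1 * ∏ c, partition θ _ 1
    rw [h1, Finset.prod_div_distrib, activity, if_neg (by decide), mul_assoc, div_mul_cancel₀ _ hp]
  | neg =>
    change Real.exp (update lam θ h x).2 * _ = activity lam (-1) * ∏ c, partition θ _ (-1)
    rw [h2, Finset.prod_div_distrib, activity, if_neg (by decide), mul_assoc, div_mul_cancel₀ _ hp]

/-- For a boundary law, the probabilities of the Markov chain are proportional to the weights of
the model with external fields. -/
theorem exists_chainProb_eq {lam θ : ℝ} (hθ : 0 < θ) (hl : 0 < lam) (h : Vertex k d → ℝ × ℝ)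
    (n : ℕ) (hh : ∀ x : Vertex k d, x.level < n → h x = update lam θ h x) :
    ∃ K : ℝ, 0 < K ∧ ∀ σ : Config k d, chainProb θ h n σ = K *
      ((∏ x ∈ ball k d n, edgeWeight θ (parentSpin σ x) (σ x)) *
        (∏ x ∈ openBall k d n, activity lam (σ x)) * ∏ x ∈ sphere k d n, law (h x) (σ x)) := by
  induction n with
  | zero =>
    have hs : sphere k d 0 = {Vertex.root} := by ext x; simp [sphere, ball]; rintro rfl; rfl
    have ho : openBall k d 0 = ∅ := by ext x; simp [openBall]
    refine ⟨(partition θ (h Vertex.root) 0)⁻¹, inv_pos.2 (partition_pos hθ _ _), fun σ => ?_⟩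
    simp [chainProb, ball, hs, ho, trans, div_eq_inv_mul]
  | succ n ih =>
    obtain ⟨K, hK, ih⟩ := ih fun x hx => hh x (by omega)
    have hZ : 0 < ∏ x ∈ sphere k d n, ∏ c, partition θ (h (x.child c)) 0 :=
      Finset.prod_pos fun _ _ => Finset.prod_pos fun _ _ => partition_pos hθ _ _
    refine ⟨K / ∏ x ∈ sphere k d n, ∏ c, partition θ (h (x.child c)) 0, div_pos hK hZ,
      fun σ => ?_⟩
    have hZσ : 0 < ∏ x ∈ sphere k d n, ∏ c, partition θ (h (x.child c)) (σ x) :=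
      Finset.prod_pos fun _ _ => Finset.prod_pos fun _ _ => partition_pos hθ _ _
    -- The normalisations at generation n + 1 depend on the spins of generation n; they cancel
    -- exactly the spin-dependent part of the weights there, leaving the activities.
    have key : (∏ x ∈ sphere k d n, law (h x) (σ x)) *
        ∏ x ∈ sphere k d n, ∏ c, partition θ (h (x.child c)) 0 =
        (∏ x ∈ sphere k d n, activity lam (σ x)) *
        ∏ x ∈ sphere k d n, ∏ c, partition θ (h (x.child c)) (σ x) := by
      rw [← Finset.prod_mul_distrib, ← Finset.prod_mul_distrib]
      refine Finset.prod_congr rfl fun x hx => ?_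
      rw [mem_sphere] at hx
      rw [hh x (by omega), law_update hθ hl]
    have e1 : chainProb θ h (n + 1) σ = chainProb θ h n σ *
        ((∏ x ∈ sphere k d n, ∏ c, edgeWeight θ (σ x) (σ (x.child c))) *
          (∏ x ∈ sphere k d (n + 1), law (h x) (σ x)) /
          ∏ x ∈ sphere k d n, ∏ c, partition θ (h (x.child c)) (σ x)) := by
      rw [chainProb, prod_ball_succ, ← chainProb, ← children_sphere, prod_children]
      simp only [parentSpin_child, trans, Finset.prod_div_distrib, Finset.prod_mul_distrib]
    have e2 : ∏ x ∈ ball k d (n + 1), edgeWeight θ (parentSpin σ x) (σ x) =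
        (∏ x ∈ ball k d n, edgeWeight θ (parentSpin σ x) (σ x)) *
        ∏ x ∈ sphere k d n, ∏ c, edgeWeight θ (σ x) (σ (x.child c)) := by
      rw [prod_ball_succ]; simp only [parentSpin_child]
    rw [e1, e2, ih, openBall_succ, prod_ball n fun x => activity lam (σ x)]
    have key' : (∏ x ∈ sphere k d n, law (h x) (σ x)) =
        (∏ x ∈ sphere k d n, activity lam (σ x)) *
        (∏ x ∈ sphere k d n, ∏ c, partition θ (h (x.child c)) (σ x)) /
        ∏ x ∈ sphere k d n, ∏ c, partition θ (h (x.child c)) 0 := by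
      rw [eq_div_iff hZ.ne', key]
    rw [key']
    field_simp

theorem edgeWeight_parentSpin (θ : ℝ) (ω : Config k d) (y : Vertex k d) :
    edgeWeight θ (parentSpin ω y) (ω y) = if ω y.parent * ω y = -1 then θ else 1 := by
  by_cases hy : y = Vertex.root
  · subst hy
    have : (Vertex.root : Vertex k d).parent = Vertex.root := rfl
    rw [parentSpin_root, edgeWeight_zero_left, this, if_neg]
    generalize ω Vertex.root = s
    revert s; decide
  · rw [parentSpin, if_neg hy, edgeWeight]

theorem exp_energy {J β lam θ : ℝ} (hβ : 0 < β) (hθ : θ = Real.exp (-J * β)) (hl : 0 < lam)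
    (E Λ : Finset (Vertex k d)) (ω : Config k d) :
    Real.exp (-β * energy J β lam E Λ ω) =
      (∏ y ∈ E, edgeWeight θ (parentSpin ω y) (ω y)) * ∏ x ∈ Λ, activity lam (ω x) := by
  have h1 : ∀ y, edgeWeight θ (parentSpin ω y) (ω y) = Real.exp (-J * β * bond ω y) := by
    intro y
    rw [edgeWeight_parentSpin, bond]
    split_ifs <;> simp [hθ]
  have h2 : ∀ s : SignType, activity lam s = Real.exp (Real.log lam * (s : ℝ) ^ 2) := by
    intro s
    cases s <;> simp [activity, Real.exp_log hl]
  simp only [h1, h2]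
  rw [← Real.exp_sum, ← Real.exp_sum, ← Real.exp_add, energy, ← Finset.mul_sum, ← Finset.mul_sum]
  congr 1
  field_simp
  ring

theorem weight_eq {J β lam θ : ℝ} (hβ : 0 < β) (hθ : θ = Real.exp (-J * β)) (hl : 0 < lam)
    (h : Vertex k d → ℝ × ℝ) (n : ℕ) (σ : Config k d) :
    weight J β lam (fields lam h) n σ =
      (∏ x ∈ ball k d n, edgeWeight θ (parentSpin σ x) (σ x)) *
        (∏ x ∈ openBall k d n, activity lam (σ x)) * ∏ x ∈ sphere k d n, law (h x) (σ x) := by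
  have h1 : ∀ x s, law (h x) s = activity lam s * Real.exp (fields lam h x s) := by
    intro x s
    cases s <;> simp [law, activity, fields, Real.exp_sub, Real.exp_log hl] <;> field_simp
  simp only [h1]
  rw [weight, hamiltonian, Real.exp_add, exp_energy hβ hθ hl, Real.exp_sum, prod_ball n
    fun x => activity lam (σ x), Finset.prod_mul_distrib]
  ring

/-- Weights and chain probabilities are proportional, and the latter sum to 1. Only the equations
strictly inside V_n enter. -/
theorem finiteGibbs_eq {J β lam θ : ℝ} (hβ : 0 < β) (hθ : θ = Real.exp (-J * β)) (hl : 0 < lam)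
    (h : Vertex k d → ℝ × ℝ) (n : ℕ)
    (hh : ∀ x : Vertex k d, x.level < n → h x = update lam θ h x) (σ : Config k d) :
    finiteGibbs J β lam (fields lam h) n σ = chainProb θ h n σ := by
  have hθ0 : 0 < θ := hθ ▸ Real.exp_pos _
  obtain ⟨K, hK, hKσ⟩ := exists_chainProb_eq hθ0 hl h n hh
  have hw : ∀ σ, weight J β lam (fields lam h) n σ = chainProb θ h n σ / K := by
    intro σ
    rw [hKσ, weight_eq hβ hθ hl, mul_div_cancel_left₀ _ hK.ne']
  rw [finiteGibbs]
  simp only [hw]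
  rw [← Finset.sum_div, sum_chainProb hθ0, div_div_div_cancel_right₀ hK.ne', div_one]

/-- The splitting Gibbs measure built from a boundary law exists and is unique. -/
theorem isSplittingGibbs_iff {J β lam θ : ℝ} (hβ : 0 < β) (hθ : θ = Real.exp (-J * β))
    (hl : 0 < lam) {h : Vertex k d → ℝ × ℝ} (hh : IsBoundaryLaw lam θ h)
    (ν : Measure (Config k d)) : IsSplittingGibbs J β lam h ν ↔ ν = chainMeasure θ h := by
  have hθ0 : 0 < θ := hθ ▸ Real.exp_pos _
  have := isProbabilityMeasure_chainMeasure hθ0 h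
  have hf := fun n σ => finiteGibbs_eq hβ hθ hl h n (fun x _ => isBoundaryLaw_iff.1 hh x) σ
  constructor
  · rintro ⟨hν, hc⟩
    refine ext_of_cylinder 1 fun n hn σ => ?_
    rw [chainMeasure_cylinder hθ0, ← hf, ← hc n hn σ, ofReal_measureReal]
    rfl
  · rintro rfl
    refine ⟨this, fun n _ σ => ?_⟩
    rw [hf, measureReal_def]
    change (chainMeasure θ h (cylinder (ball k d n) σ)).toReal = _
    rw [chainMeasure_cylinder hθ0, ENNReal.toReal_ofReal (chainProb_pos hθ0 _ _ _).le]

/-- Splitting Gibbs measures do not depend on the value of `h` at the root. -/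
theorem isSplittingGibbs_congr {J β lam : ℝ} {h h' : Vertex k d → ℝ × ℝ}
    (hh : ∀ x : Vertex k d, 0 < x.level → h x = h' x) (ν : Measure (Config k d)) :
    IsSplittingGibbs J β lam h ν ↔ IsSplittingGibbs J β lam h' ν := by
  refine and_congr_right fun _ => forall₃_congr fun n hn σ => ?_
  have hw : ∀ σ, weight J β lam (fields lam h) n σ = weight J β lam (fields lam h') n σ := by
    intro σ
    unfold weight
    congr 2
    refine Finset.sum_congr rfl fun x hx => ?_
    rw [mem_sphere] at hx
    have := hh x (by omega)
    cases σ x <;> simp [fields, this]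
  unfold finiteGibbs
  simp only [hw]

end

end WidomRowlinson

open MeasureTheory

namespace WidomRowlinson

noncomputable section

variable {k d : ℕ}

/-! ### The Dobrushin-Lanford-Ruelle equations -/

theorem measurable_glue (Λ : Finset (Vertex k d)) (ξ : Λ → SignType) :
    Measurable (glue Λ ξ : Config k d → Config k d) := by
  refine measurable_pi_lambda _ fun x => ?_
  by_cases hx : x ∈ Λ
  · simp only [glue_of_mem _ _ hx]; exact measurable_const
  · simp only [glue_of_notMem _ _ hx]; exact measurable_pi_apply x

theorem measurable_bond (y : Vertex k d) : Measurable fun ω : Config k d => bond ω y := by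
  have h : Measurable fun p : SignType × SignType => if p.1 * p.2 = -1 then (1 : ℝ) else 0 :=
    .of_discrete
  have h' : Measurable fun ω : Config k d => (ω y.parent, ω y) :=
    (measurable_pi_apply y.parent).prodMk (measurable_pi_apply y)
  exact h.comp h'

theorem measurable_boltzmann (J β lam : ℝ) (Λ : Finset (Vertex k d)) :
    Measurable (boltzmann J β lam Λ) := by
  refine Real.measurable_exp.comp (Measurable.const_mul ?_ _)
  refine Measurable.sub (Measurable.const_mul (Finset.measurable_sum _ fun y _ =>
    measurable_bond y) _) (Measurable.const_mul (Finset.measurable_sum _ fun x _ => ?_) _)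
  exact (Measurable.of_discrete (f := fun s : SignType => (s : ℝ) ^ 2)).comp
    (measurable_pi_apply x)

/-- The probability of `ξ` in `Λ` given the configuration off `Λ`. -/
def localProb (J β lam : ℝ) (Λ : Finset (Vertex k d)) (ξ : Λ → SignType) (ω : Config k d) : ℝ :=
  boltzmann J β lam Λ (glue Λ ξ ω) / ∑ ξ' : Λ → SignType, boltzmann J β lam Λ (glue Λ ξ' ω)

theorem measurable_localProb (J β lam : ℝ) (Λ : Finset (Vertex k d)) (ξ : Λ → SignType) :
    Measurable (localProb J β lam Λ ξ) :=
  ((measurable_boltzmann J β lam Λ).comp (measurable_glue Λ ξ)).div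
    (Finset.measurable_sum _ fun ξ' _ =>
      (measurable_boltzmann J β lam Λ).comp (measurable_glue Λ ξ'))

/-- The measure `μ` resampled in `Λ` by the specification. -/
def resample (J β lam : ℝ) (Λ : Finset (Vertex k d)) (μ : Measure (Config k d)) :
    Measure (Config k d) :=
  ∑ ξ : Λ → SignType,
    (μ.withDensity fun ω => ENNReal.ofReal (localProb J β lam Λ ξ ω)).map (glue Λ ξ)

theorem resample_apply (J β lam : ℝ) (Λ : Finset (Vertex k d)) (μ : Measure (Config k d))
    {A : Set (Config k d)} (hA : MeasurableSet A) :
    resample J β lam Λ μ A =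
      ∑ ξ : Λ → SignType, ∫⁻ ω in glue Λ ξ ⁻¹' A, ENNReal.ofReal (localProb J β lam Λ ξ ω) ∂μ := by
  simp only [resample, Measure.coe_finsetSum, Finset.sum_apply]
  refine Finset.sum_congr rfl fun ξ _ => ?_
  rw [Measure.map_apply (measurable_glue Λ ξ) hA, withDensity_apply _ (measurable_glue Λ ξ hA)]

theorem lintegral_gibbsKernel (J β lam : ℝ) (Λ : Finset (Vertex k d)) (μ : Measure (Config k d))
    {A : Set (Config k d)} (hA : MeasurableSet A) :
    ∫⁻ ω, gibbsKernel J β lam Λ ω A ∂μ = resample J β lam Λ μ A := by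
  have h : ∀ ξ : Λ → SignType, (fun ω => ENNReal.ofReal (localProb J β lam Λ ξ ω) *
      A.indicator 1 (glue Λ ξ ω)) = (glue Λ ξ ⁻¹' A).indicator
        fun ω => ENNReal.ofReal (localProb J β lam Λ ξ ω) := by
    intro ξ
    funext ω
    by_cases hω : glue Λ ξ ω ∈ A
    · rw [Set.indicator_of_mem hω, Set.indicator_of_mem (s := glue Λ ξ ⁻¹' A) hω, Pi.one_apply,
        mul_one]
    · rw [Set.indicator_of_notMem hω, Set.indicator_of_notMem (s := glue Λ ξ ⁻¹' A) hω, mul_zero]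
  change ∫⁻ ω, ∑ ξ : Λ → SignType, ENNReal.ofReal (localProb J β lam Λ ξ ω) *
      A.indicator 1 (glue Λ ξ ω) ∂μ = _
  rw [resample_apply J β lam Λ μ hA, lintegral_finsetSum]
  · refine Finset.sum_congr rfl fun ξ _ => ?_
    rw [h ξ, lintegral_indicator (measurable_glue Λ ξ hA)]
  · intro ξ _
    rw [h ξ]
    exact (measurable_localProb J β lam Λ ξ).ennreal_ofReal.indicator (measurable_glue Λ ξ hA)

theorem boltzmann_pos (J β lam : ℝ) (Λ : Finset (Vertex k d)) (ω : Config k d) :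
    0 < boltzmann J β lam Λ ω := Real.exp_pos _

theorem boltzmann_congr (J β lam : ℝ) {Λ : Finset (Vertex k d)} {n : ℕ}
    (hΛ : Λ ∪ children Λ ⊆ ball k d n) {ω ω' : Config k d} (h : ∀ x ∈ ball k d n, ω x = ω' x) :
    boltzmann J β lam Λ ω = boltzmann J β lam Λ ω' := by
  unfold boltzmann energy
  congr 3
  · congr 1
    refine Finset.sum_congr rfl fun y hy => ?_
    rw [bond, bond, h _ (hΛ hy), h _ (parent_mem_ball (hΛ hy))]
  · congr 1
    refine Finset.sum_congr rfl fun x hx => ?_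
    rw [h _ (hΛ (Finset.mem_union_left _ hx))]

theorem localProb_nonneg (J β lam : ℝ) (Λ : Finset (Vertex k d)) (ξ : Λ → SignType)
    (ω : Config k d) : 0 ≤ localProb J β lam Λ ξ ω :=
  div_nonneg (boltzmann_pos _ _ _ _ _).le (Finset.sum_nonneg fun _ _ => (boltzmann_pos _ _ _ _ _).le)

variable {J β lam θ : ℝ} {h : Vertex k d → ℝ × ℝ}

/-- The cylinder probabilities of the Markov chain of a boundary law are proportional, as functions
of the configuration in `Λ`, to the Boltzmann weights in `Λ`. -/
theorem exists_chainProb_glue (hβ : 0 < β) (hθ : θ = Real.exp (-J * β)) (hl : 0 < lam)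
    (hh : IsBoundaryLaw lam θ h) {Λ : Finset (Vertex k d)} {n : ℕ}
    (hΛ : Λ ∪ children Λ ⊆ ball k d n) (hΛn : Λ ⊆ openBall k d n) (σ : Config k d) :
    ∃ C : ℝ, 0 < C ∧ ∀ ξ : Λ → SignType,
      chainProb θ h n (glue Λ ξ σ) = C * boltzmann J β lam Λ (glue Λ ξ σ) := by
  have hθ0 : 0 < θ := hθ ▸ Real.exp_pos _
  obtain ⟨K, hK, hKσ⟩ := exists_chainProb_eq hθ0 hl h n fun x _ => isBoundaryLaw_iff.1 hh x
  refine ⟨K * ((∏ y ∈ ball k d n \ (Λ ∪ children Λ), edgeWeight θ (parentSpin σ y) (σ y)) *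
    (∏ x ∈ openBall k d n \ Λ, activity lam (σ x)) * ∏ x ∈ sphere k d n, law (h x) (σ x)),
    mul_pos hK (mul_pos (mul_pos (Finset.prod_pos fun _ _ => edgeWeight_pos hθ0 _ _)
      (Finset.prod_pos fun _ _ => activity_pos hl _)) (Finset.prod_pos fun _ _ => law_pos _ _)),
    fun ξ => ?_⟩
  rw [hKσ, boltzmann, exp_energy hβ hθ hl, ← Finset.prod_sdiff hΛ, ← Finset.prod_sdiff hΛn]
  have e1 : ∏ y ∈ ball k d n \ (Λ ∪ children Λ),
      edgeWeight θ (parentSpin (glue Λ ξ σ) y) (glue Λ ξ σ y) =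
      ∏ y ∈ ball k d n \ (Λ ∪ children Λ), edgeWeight θ (parentSpin σ y) (σ y) := by
    refine Finset.prod_congr rfl fun y hy => ?_
    simp only [Finset.mem_sdiff, Finset.mem_union, not_or] at hy
    rw [glue_of_notMem _ _ hy.2.1]
    congr 1
    unfold parentSpin
    split_ifs with hr
    · rfl
    · refine glue_of_notMem _ _ fun hp => hy.2.2 ?_
      have hpos : 0 < y.level := by
        by_contra h0
        exact hr (Vertex.ext (List.length_eq_zero_iff.1 (by simpa [Vertex.level] using h0)))
      obtain ⟨x, c, rfl⟩ := exists_eq_child hpos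
      exact Finset.mem_biUnion.2 ⟨x, hp, Finset.mem_image_of_mem _ (Finset.mem_univ c)⟩
  have e2 : ∏ x ∈ openBall k d n \ Λ, activity lam (glue Λ ξ σ x) =
      ∏ x ∈ openBall k d n \ Λ, activity lam (σ x) :=
    Finset.prod_congr rfl fun x hx => by rw [glue_of_notMem _ _ (Finset.mem_sdiff.1 hx).2]
  have e3 : ∏ x ∈ sphere k d n, law (h x) (glue Λ ξ σ x) =
      ∏ x ∈ sphere k d n, law (h x) (σ x) := by
    refine Finset.prod_congr rfl fun x hx => ?_
    rw [glue_of_notMem]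
    intro hxΛ
    have h1 := hΛn hxΛ
    rw [openBall, Finset.mem_filter] at h1
    rw [mem_sphere] at hx
    omega
  rw [e1, e2, e3]
  ring

/-- Cylinders over balls large enough to contain Λ and its children in their interior suffice. There
the chain probabilities are a constant times the Boltzmann weight in Λ, so their conditional
distribution in Λ is that of the specification. -/
theorem resample_chainMeasure (hβ : 0 < β) (hθ : θ = Real.exp (-J * β)) (hl : 0 < lam)
    (hh : IsBoundaryLaw lam θ h) (Λ : Finset (Vertex k d)) :
    resample J β lam Λ (chainMeasure θ h) = chainMeasure θ h := by
  have hθ0 : 0 < θ := hθ ▸ Real.exp_pos _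
  have := isProbabilityMeasure_chainMeasure hθ0 h
  obtain ⟨n₀, -, hn₀⟩ := exists_subset_ball (Λ ∪ children Λ) 0
  refine ext_of_cylinder (n₀ + 1) fun n hn σ => ?_
  have hΛ : Λ ∪ children Λ ⊆ ball k d n := hn₀.trans (ball_mono (by omega))
  have hΛn : Λ ⊆ openBall k d n := by
    intro x hx
    have h1 := hn₀ (Finset.mem_union_left _ hx)
    rw [mem_ball] at h1
    rw [openBall, Finset.mem_filter, mem_ball]
    omega
  have hΛb : Λ ⊆ ball k d n := Finset.union_subset_left hΛ
  obtain ⟨C, hC, hCξ⟩ := exists_chainProb_glue hβ hθ hl hh hΛ hΛn σ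
  -- Only the resampled configuration equal to `σ` on Λ can end in the cylinder.
  rw [resample_apply _ _ _ _ _ (measurableSet_cylinder _ _),
    Finset.sum_eq_single (fun x : Λ => σ x) _ fun h => (h (Finset.mem_univ _)).elim]
  · have hset : glue Λ (fun x : Λ => σ x) ⁻¹' cylinder (ball k d n) σ =
        cylinder (ball k d n \ Λ) σ := by
      ext ω
      constructor
      · intro hω x hx
        rw [Finset.mem_sdiff] at hx
        rw [← hω x hx.1, glue_of_notMem _ _ hx.2]
      · intro hω x hx
        by_cases hxΛ : x ∈ Λ
        · rw [glue_of_mem _ _ hxΛ]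
        · rw [glue_of_notMem _ _ hxΛ, hω x (Finset.mem_sdiff.2 ⟨hx, hxΛ⟩)]
    -- The local probability sees only the spins in the ball, which are fixed off Λ by the cylinder
    -- and replaced in Λ.
    have hconst : ∀ ω ∈ cylinder (ball k d n \ Λ) σ, localProb J β lam Λ (fun x : Λ => σ x) ω =
        localProb J β lam Λ (fun x : Λ => σ x) σ := by
      intro ω hω
      have hg : ∀ ξ : Λ → SignType, boltzmann J β lam Λ (glue Λ ξ ω) =
          boltzmann J β lam Λ (glue Λ ξ σ) := by
        refine fun ξ => boltzmann_congr J β lam hΛ fun x hx => ?_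
        by_cases hxΛ : x ∈ Λ
        · rw [glue_of_mem _ _ hxΛ, glue_of_mem _ _ hxΛ]
        · rw [glue_of_notMem _ _ hxΛ, glue_of_notMem _ _ hxΛ, hω x (Finset.mem_sdiff.2 ⟨hx, hxΛ⟩)]
      simp only [localProb, hg]
    have hmeas : chainMeasure θ h (cylinder (ball k d n \ Λ) σ) =
        ENNReal.ofReal (∑ ξ : Λ → SignType, C * boltzmann J β lam Λ (glue Λ ξ σ)) := by
      rw [← sum_measure_inter_cylinder _ Λ σ,
        ENNReal.ofReal_sum_of_nonneg fun ξ _ => (mul_pos hC (boltzmann_pos _ _ _ _ _)).le]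
      refine Finset.sum_congr rfl fun ξ _ => ?_
      rw [← hCξ, ← chainMeasure_cylinder hθ0]
      congr 1
      ext ω
      constructor
      · intro hω x hx
        by_cases hxΛ : x ∈ Λ
        · exact hω.2 x hxΛ
        · rw [glue_of_notMem _ _ hxΛ, hω.1 x (Finset.mem_sdiff.2 ⟨hx, hxΛ⟩)]
      · intro hω
        refine ⟨fun x hx => ?_, fun x hx => hω x (hΛb hx)⟩
        rw [Finset.mem_sdiff] at hx
        rw [hω x hx.1, glue_of_notMem _ _ hx.2]
    rw [hset, setLIntegral_congr_fun (measurableSet_cylinder _ _) (g := fun _ =>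
      ENNReal.ofReal (localProb J β lam Λ (fun x : Λ => σ x) σ)) fun ω hω => by
        simp only [hconst ω hω], setLIntegral_const, hmeas, chainMeasure_cylinder hθ0,
      ← ENNReal.ofReal_mul (localProb_nonneg _ _ _ _ _ _)]
    congr 1
    have hpos : 0 < ∑ ξ : Λ → SignType, boltzmann J β lam Λ (glue Λ ξ σ) :=
      Finset.sum_pos (fun _ _ => boltzmann_pos _ _ _ _ _) ⟨fun _ => 0, Finset.mem_univ _⟩
    have := hCξ fun x : Λ => σ x
    rw [glue_restrict] at this
    rw [this, localProb, glue_restrict, ← Finset.mul_sum]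
    field_simp
  · intro ξ _ hξ
    have : glue Λ ξ ⁻¹' cylinder (ball k d n) σ = ∅ := by
      refine Set.eq_empty_iff_forall_notMem.2 fun ω hω => hξ ?_
      funext x
      rw [← hω x (hΛb x.2), glue_of_mem _ _ x.2]
    rw [this, Measure.restrict_empty, lintegral_zero_measure]

/-- The Markov chain of a boundary law is a Gibbs measure. -/
theorem chainMeasure_mem_gibbsMeasures (hβ : 0 < β) (hθ : θ = Real.exp (-J * β)) (hl : 0 < lam)
    (hh : IsBoundaryLaw lam θ h) : chainMeasure θ h ∈ gibbsMeasures k d J β lam := by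
  refine ⟨isProbabilityMeasure_chainMeasure (hθ ▸ Real.exp_pos _) h, fun Λ A hA => ?_⟩
  rw [lintegral_gibbsKernel J β lam Λ _ hA, resample_chainMeasure hβ hθ hl hh]

/-! ### Conditional probabilities in a ball -/

/-- The weights at `x`, given the configuration `ω` in the generation `j + 1` after `x`. -/
def innerField (lam θ : ℝ) (ω : Config k d) : ℕ → Vertex k d → ℝ × ℝ
  | 0, x => (Real.log lam + ∑ c, Real.log (edgeWeight θ 1 (ω (x.child c))),
      Real.log lam + ∑ c, Real.log (edgeWeight θ (-1) (ω (x.child c))))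
  | j + 1, x => update lam θ (innerField lam θ ω j) x

/-- The weights at the vertices of `V_n`, given the configuration `ω` in `W_{n + 1}`. -/
def ballField (lam θ : ℝ) (ω : Config k d) (n : ℕ) (x : Vertex k d) : ℝ × ℝ :=
  innerField lam θ ω (n - x.level) x

theorem ballField_eq_update (ω : Config k d) {n : ℕ} {x : Vertex k d} (hx : x.level < n) :
    ballField lam θ ω n x = update lam θ (ballField lam θ ω n) x := by
  obtain ⟨j, hj⟩ := Nat.exists_eq_add_of_lt hx
  have h1 : n - x.level = j + 1 := by omega
  have h2 : ∀ c, n - (x.child c).level = j := fun c => by rw [level_child]; omega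
  rw [ballField, h1, innerField, update, update]
  simp only [ballField, h2]

/-- At the last generation before the boundary the children have fixed spins, so the weight is the
activity times the boundary edge weights. -/
theorem law_innerField_zero (hθ : 0 < θ) (hl : 0 < lam) (ω : Config k d) (x : Vertex k d)
    (s : SignType) : law (innerField lam θ ω 0 x) s =
      activity lam s * ∏ c, edgeWeight θ s (ω (x.child c)) := by
  have he : ∀ s, Real.exp (Real.log lam + ∑ c, Real.log (edgeWeight θ s (ω (x.child c)))) =
      lam * ∏ c, edgeWeight θ s (ω (x.child c)) := by
    intro s
    rw [Real.exp_add, Real.exp_log hl, Real.exp_sum]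
    simp only [Real.exp_log (edgeWeight_pos hθ _ _)]
  cases s with
  | zero => simp [law, activity]
  | pos =>
    change Real.exp (innerField lam θ ω 0 x).1 = activity lam 1 * ∏ c, edgeWeight θ 1 _
    rw [activity, if_neg (by decide), ← he]; rfl
  | neg =>
    change Real.exp (innerField lam θ ω 0 x).2 = activity lam (-1) * ∏ c, edgeWeight θ (-1) _
    rw [activity, if_neg (by decide), ← he]; rfl

/-- Given the configuration off `V_n`, the configuration in `V_n` is a Markov chain. -/
theorem gibbsKernel_ball (hβ : 0 < β) (hθ : θ = Real.exp (-J * β)) (hl : 0 < lam) {m n : ℕ}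
    (hmn : m ≤ n) (ω σ : Config k d) :
    gibbsKernel J β lam (ball k d n) ω (cylinder (ball k d m) σ) =
      ENNReal.ofReal (chainProb θ (ballField lam θ ω n) m σ) := by
  have hθ0 : 0 < θ := hθ ▸ Real.exp_pos _
  -- The random weights solve the compatibility equations strictly inside V_n by construction, which
  -- is all that this proportionality requires.
  obtain ⟨K, hK, hKσ⟩ := exists_chainProb_eq hθ0 hl (ballField lam θ ω n) n
    fun x hx => ballField_eq_update ω hx
  have hb : ∀ ξ : ball k d n → SignType, boltzmann J β lam (ball k d n) (glue (ball k d n) ξ ω) =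
      chainProb θ (ballField lam θ ω n) n (glue (ball k d n) ξ ω) / K := by
    intro ξ
    have hE : ball k d n ∪ children (ball k d n) = ball k d (n + 1) := rfl
    rw [hKσ, mul_div_cancel_left₀ _ hK.ne', boltzmann, exp_energy hβ hθ hl, hE, prod_ball_succ,
      prod_ball n fun x => activity lam _]
    simp only [parentSpin_child]
    have e : ∏ x ∈ sphere k d n, law (ballField lam θ ω n x) (glue (ball k d n) ξ ω x) =
        (∏ x ∈ sphere k d n, activity lam (glue (ball k d n) ξ ω x)) *
        ∏ x ∈ sphere k d n, ∏ c, edgeWeight θ (glue (ball k d n) ξ ω x)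
          (glue (ball k d n) ξ ω (x.child c)) := by
      rw [← Finset.prod_mul_distrib]
      refine Finset.prod_congr rfl fun x hx => ?_
      rw [mem_sphere] at hx
      have h0 : n - x.level = 0 := by omega
      rw [ballField, h0, law_innerField_zero hθ0 hl]
      congr 1
      refine Finset.prod_congr rfl fun c _ => ?_
      rw [glue_of_notMem ξ ω (x := x.child c)]
      rw [mem_ball, level_child]; omega
    rw [e]
    ring
  rw [← sum_chainProb_filter hθ0 _ hmn σ ω, gibbsKernel,
    ENNReal.ofReal_sum_of_nonneg fun ξ _ =>
      Set.indicator_nonneg (fun _ _ => (chainProb_pos hθ0 _ _ _).le) _]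
  refine Finset.sum_congr rfl fun ξ _ => ?_
  simp only [hb]
  rw [← Finset.sum_div, sum_chainProb hθ0, div_div_div_cancel_right₀ hK.ne', div_one]
  by_cases hξ : glue (ball k d n) ξ ω ∈ cylinder (ball k d m) σ
  · rw [Set.indicator_of_mem hξ, Set.indicator_of_mem hξ, Pi.one_apply, mul_one]
  · rw [Set.indicator_of_notMem hξ, Set.indicator_of_notMem hξ, mul_zero, ENNReal.ofReal_zero]

theorem measurable_innerField (hθ : 0 < θ) (hθ1 : θ ≤ 1) (j : ℕ) (x : Vertex k d) :
    Measurable fun ω : Config k d => innerField lam θ ω j x := by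
  induction j generalizing x with
  | zero =>
    have h : ∀ s (y : Vertex k d),
        Measurable fun ω : Config k d => Real.log (edgeWeight θ s (ω y)) := fun s y =>
      (Measurable.of_discrete (f := fun s' : SignType => Real.log (edgeWeight θ s s'))).comp
        (measurable_pi_apply y)
    exact (measurable_const.add (Finset.measurable_sum _ fun c _ => h 1 _)).prodMk
      (measurable_const.add (Finset.measurable_sum _ fun c _ => h (-1) _))
  | succ j ih =>
    exact measurable_const.add (Finset.measurable_sum _ fun c _ =>
      (continuous_msg hθ hθ1).measurable.comp (ih _))

theorem measurable_ballField (hθ : 0 < θ) (hθ1 : θ ≤ 1) (n : ℕ) (x : Vertex k d) :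
    Measurable fun ω : Config k d => ballField lam θ ω n x := measurable_innerField hθ hθ1 _ _

end

end WidomRowlinson

open MeasureTheory Filter Topology

namespace WidomRowlinson

noncomputable section

variable {k d : ℕ} {J β lam θ : ℝ} {h : Vertex k d → ℝ × ℝ}

/-! ### The extremal boundary field -/

/-- The weights at a vertex when all spins in the generation `j + 1` after it are `1`. -/
def extremeField (k : ℕ) (lam θ : ℝ) : ℕ → ℝ × ℝ
  | 0 => (Real.log lam, Real.log lam + k * Real.log θ)
  | j + 1 => (Real.log lam, Real.log lam) + (k : ℝ) • msg θ (extremeField k lam θ j)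

theorem isConstantSolution_exp {a b : ℝ} (hl : 0 < lam) (hθ : 0 < θ)
    (h : (a, b) = (Real.log lam, Real.log lam) + (k : ℝ) • msg θ (a, b)) :
    IsConstantSolution k lam θ (Real.exp a) (Real.exp b) := by
  have h1 : a = Real.log lam + k * lawMap a b θ := congrArg Prod.fst h
  have h2 : b = Real.log lam + k * lawMap b a θ := congrArg Prod.snd h
  refine ⟨Real.exp_pos a, Real.exp_pos b, ?_, ?_⟩
  · nth_rewrite 1 [h1]
    rw [Real.exp_add, Real.exp_log hl, Real.exp_nat_mul, lawMap, Real.exp_log (by positivity)]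
  · nth_rewrite 1 [h2]
    rw [Real.exp_add, Real.exp_log hl, Real.exp_nat_mul, lawMap, Real.exp_log (by positivity)]
    ring_nf

theorem add_smul_msg_mono (hθ : 0 < θ) (hθ1 : θ ≤ 1) {z z' : ℝ × ℝ} (h1 : z.1 ≤ z'.1)
    (h2 : z'.2 ≤ z.2) :
    ((Real.log lam, Real.log lam) + (k : ℝ) • msg θ z).1 ≤
        ((Real.log lam, Real.log lam) + (k : ℝ) • msg θ z').1 ∧
      ((Real.log lam, Real.log lam) + (k : ℝ) • msg θ z').2 ≤
        ((Real.log lam, Real.log lam) + (k : ℝ) • msg θ z).2 := by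
  have a := lawMap_mono hθ hθ1 h1 h2
  have b := lawMap_mono hθ hθ1 h2 h1
  simp only [msg, Prod.fst_add, Prod.snd_add, Prod.smul_fst, Prod.smul_snd, smul_eq_mul]
  exact ⟨by gcongr, by gcongr⟩

theorem extremeField_zero_bound (hθ : 0 < θ) (hθ1 : θ ≤ 1) (z : ℝ × ℝ) :
    ((Real.log lam, Real.log lam) + (k : ℝ) • msg θ z).1 ≤ (extremeField k lam θ 0).1 ∧
      (extremeField k lam θ 0).2 ≤ ((Real.log lam, Real.log lam) + (k : ℝ) • msg θ z).2 := by
  have h1 := lawMap_nonpos hθ hθ1 z.1 z.2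
  have h2 := log_le_lawMap hθ hθ1 z.2 z.1
  have hk : (0 : ℝ) ≤ k := by positivity
  simp only [msg, extremeField, Prod.fst_add, Prod.snd_add, Prod.smul_fst, Prod.smul_snd,
    smul_eq_mul]
  exact ⟨by nlinarith, by gcongr⟩

theorem extremeField_succ_le (hθ : 0 < θ) (hθ1 : θ ≤ 1) (j : ℕ) :
    (extremeField k lam θ (j + 1)).1 ≤ (extremeField k lam θ j).1 ∧
      (extremeField k lam θ j).2 ≤ (extremeField k lam θ (j + 1)).2 := by
  induction j with
  | zero => exact extremeField_zero_bound hθ hθ1 _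
  | succ j ih => exact add_smul_msg_mono hθ hθ1 ih.1 ih.2

theorem le_extremeField (hθ : 0 < θ) (hθ1 : θ ≤ 1) {z : ℝ × ℝ}
    (hz : z = (Real.log lam, Real.log lam) + (k : ℝ) • msg θ z) (j : ℕ) :
    z.1 ≤ (extremeField k lam θ j).1 ∧ (extremeField k lam θ j).2 ≤ z.2 := by
  induction j with
  | zero => rw [hz]; exact extremeField_zero_bound hθ hθ1 _
  | succ j ih => rw [hz]; exact add_smul_msg_mono hθ hθ1 ih.1 ih.2

/-- The sequence decreases in the order and stays above the given solution, so it converges, by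
continuity to a fixed point. A limit above the given solution is asymmetric in the same sense, and
uniqueness identifies the two. -/
theorem tendsto_extremeField (hk : 2 ≤ k) (hθ : 0 < θ) (hθ1 : θ < 1) (hl : 0 < lam) {x₁ x₂ : ℝ}
    (hx : x₂ < x₁) (hs : IsConstantSolution k lam θ x₁ x₂) :
    Tendsto (extremeField k lam θ) atTop (𝓝 (Real.log x₁, Real.log x₂)) := by
  have hz := isConstantSolution_log hl hθ hs
  have h1 : Antitone fun j => (extremeField k lam θ j).1 :=
    antitone_nat_of_succ_le fun j => (extremeField_succ_le hθ hθ1.le j).1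
  have h2 : Monotone fun j => (extremeField k lam θ j).2 :=
    monotone_nat_of_le_succ fun j => (extremeField_succ_le hθ hθ1.le j).2
  have ha := tendsto_atTop_ciInf h1 ⟨_, by
    rintro _ ⟨j, rfl⟩; exact (le_extremeField hθ hθ1.le hz j).1⟩
  have hb := tendsto_atTop_ciSup h2 ⟨_, by
    rintro _ ⟨j, rfl⟩; exact (le_extremeField hθ hθ1.le hz j).2⟩
  set a := ⨅ j, (extremeField k lam θ j).1
  set b := ⨆ j, (extremeField k lam θ j).2
  have hab : Tendsto (extremeField k lam θ) atTop (𝓝 (a, b)) := ha.prodMk_nhds hb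
  have hfix : (a, b) = (Real.log lam, Real.log lam) + (k : ℝ) • msg θ (a, b) := by
    have hc : Continuous fun z => (Real.log lam, Real.log lam) + (k : ℝ) • msg θ z := by
      have := continuous_msg hθ hθ1.le
      fun_prop
    exact tendsto_nhds_unique ((tendsto_add_atTop_iff_nat 1).2 hab) ((hc.tendsto (a, b)).comp hab)
  have ha1 : Real.log x₁ ≤ a := ge_of_tendsto' ha fun j => (le_extremeField hθ hθ1.le hz j).1
  have hb1 : b ≤ Real.log x₂ := le_of_tendsto' hb fun j => (le_extremeField hθ hθ1.le hz j).2
  have hlt : Real.exp b < Real.exp a :=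
    Real.exp_lt_exp.2 ((hb1.trans_lt (Real.log_lt_log hs.2.1 hx)).trans_le ha1)
  -- Uniqueness is stated for x < y, hence the swaps.
  obtain ⟨e1, e2⟩ := hs.swap.unique hk hθ hθ1 hl hx hlt
    (isConstantSolution_exp hl hθ hfix).swap
  rw [e1, e2, Real.log_exp, Real.log_exp]
  exact hab

/-! ### Bounds for the conditional fields. -/

theorem log_edgeWeight_mem (hθ : 0 < θ) (hθ1 : θ ≤ 1) (s s' : SignType) :
    Real.log θ ≤ Real.log (edgeWeight θ s s') ∧ Real.log (edgeWeight θ s s') ≤ 0 := by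
  have := Real.log_nonpos hθ.le hθ1
  unfold edgeWeight
  split_ifs <;> simp [this]

/-- No boundary condition favours spin 1 more than the one with all spins 1, and monotonicity
preserves this towards the root. The root is excluded because its number of successors may be k + 1.
-/
theorem innerField_le_extremeField (hθ : 0 < θ) (hθ1 : θ ≤ 1) (ω : Config k d) (j : ℕ)
    {x : Vertex k d} (hx : 0 < x.level) :
    (innerField lam θ ω j x).1 ≤ (extremeField k lam θ j).1 ∧
      (extremeField k lam θ j).2 ≤ (innerField lam θ ω j x).2 := by
  have hcard : (Finset.univ : Finset (Fin (branching k d x.level))).card = k := by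
    rw [Finset.card_univ, Fintype.card_fin, branching_of_pos hx]
  induction j generalizing x with
  | zero =>
    constructor
    · have := Finset.sum_nonpos fun c (_ : c ∈ Finset.univ) =>
        (log_edgeWeight_mem hθ hθ1 1 (ω (x.child c))).2
      simp only [innerField, extremeField]
      linarith
    · have := Finset.card_nsmul_le_sum Finset.univ _ _ fun c _ =>
        (log_edgeWeight_mem hθ hθ1 (-1) (ω (x.child c))).1
      rw [hcard, nsmul_eq_mul] at this
      simp only [innerField, extremeField]
      linarith
  | succ j ih =>
    have hc := fun c => ih (x := x.child c) (by simp) (by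
      rw [Finset.card_univ, Fintype.card_fin, branching_of_pos (by simp)])
    constructor
    · have := Finset.sum_le_card_nsmul Finset.univ _ _ fun c _ =>
        lawMap_mono hθ hθ1 (hc c).1 (hc c).2
      rw [hcard, nsmul_eq_mul] at this
      simp only [innerField, update, extremeField, Prod.fst_add, Prod.fst_sum, msg, Prod.smul_fst,
        smul_eq_mul]
      linarith
    · have := Finset.card_nsmul_le_sum Finset.univ _ _ fun c _ =>
        lawMap_mono hθ hθ1 (hc c).2 (hc c).1
      rw [hcard, nsmul_eq_mul] at this
      simp only [innerField, update, extremeField, Prod.snd_add, Prod.snd_sum, msg, Prod.smul_snd,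
        smul_eq_mul]
      linarith

theorem edgeWeight_neg_neg (θ : ℝ) (s s' : SignType) :
    edgeWeight θ (-s) (-s') = edgeWeight θ s s' := by
  unfold edgeWeight; rw [neg_mul_neg]

/-- The spin-flip symmetry; it turns the bound for spin 1 into the bound for spin -1. -/
theorem innerField_neg (ω : Config k d) (j : ℕ) (x : Vertex k d) :
    innerField lam θ (-ω) j x = (innerField lam θ ω j x).swap := by
  induction j generalizing x with
  | zero =>
    have h := fun s s' => edgeWeight_neg_neg θ (-s) s'
    simp only [neg_neg] at h
    simp [innerField, h]
  | succ j ih =>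
    simp only [innerField, update, ih, msg_swap, Prod.ext_iff, Prod.fst_add, Prod.snd_add,
      Prod.fst_sum, Prod.snd_sum, Prod.fst_swap, Prod.snd_swap, and_self]

/-- All fields lie in the same box. -/
def box (d : ℕ) (lam θ : ℝ) : Set (ℝ × ℝ) :=
  Set.Icc (Real.log lam + d * Real.log θ, Real.log lam + d * Real.log θ)
    (Real.log lam, Real.log lam)

theorem innerField_mem_box (hθ : 0 < θ) (hθ1 : θ ≤ 1) (hd : k ≤ d) (ω : Config k d) (j : ℕ)
    (x : Vertex k d) : innerField lam θ ω j x ∈ box d lam θ := by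
  cases j with
  | zero =>
    have hb : (branching k d x.level : ℝ) ≤ d := by
      unfold branching; split_ifs <;> simp [hd]
    have hlog : Real.log θ ≤ 0 := Real.log_nonpos hθ.le hθ1
    have h1 : ∀ s, ∑ c, Real.log (edgeWeight θ s (ω (x.child c))) ≤ 0 := fun s =>
      Finset.sum_nonpos fun c _ => (log_edgeWeight_mem hθ hθ1 s _).2
    have h2 : ∀ s, d * Real.log θ ≤ ∑ c, Real.log (edgeWeight θ s (ω (x.child c))) := fun s => by
      have := Finset.card_nsmul_le_sum Finset.univ _ _ fun c _ =>
        (log_edgeWeight_mem hθ hθ1 s (ω (x.child c))).1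
      rw [Finset.card_univ, Fintype.card_fin, nsmul_eq_mul] at this
      exact (mul_le_mul_of_nonpos_right hb hlog).trans this
    exact ⟨⟨add_le_add_right (h2 1) _, add_le_add_right (h2 (-1)) _⟩,
      ⟨by simpa [innerField] using h1 1, by simpa [innerField] using h1 (-1)⟩⟩
  | succ j => exact update_mem_Icc hθ hθ1 hd _ _

/-- Lower bound for the transition probabilities from the spin `0`. -/
def transBound (d : ℕ) (lam θ : ℝ) : ℝ :=
  min 1 (Real.exp (Real.log lam + d * Real.log θ)) / (1 + lam + lam)

theorem transBound_pos (hl : 0 < lam) : 0 < transBound d lam θ :=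
  div_pos (lt_min one_pos (Real.exp_pos _)) (by positivity)

theorem transBound_le (hl : 0 < lam) {z : ℝ × ℝ} (hz : z ∈ box d lam θ)
    (s : SignType) : transBound d lam θ ≤ trans θ z 0 s := by
  rw [trans, edgeWeight_zero_left, one_mul, partition_zero, transBound]
  obtain ⟨⟨h1, h2⟩, ⟨h3, h4⟩⟩ := hz
  have e3 : Real.exp z.1 ≤ lam := by rw [← Real.exp_log hl]; exact Real.exp_le_exp.2 h3
  have e4 : Real.exp z.2 ≤ lam := by rw [← Real.exp_log hl]; exact Real.exp_le_exp.2 h4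
  have h5 : min 1 (Real.exp (Real.log lam + d * Real.log θ)) ≤ law z s := by
    cases s with
    | zero => exact min_le_left _ _
    | pos => exact (min_le_right _ _).trans (Real.exp_le_exp.2 h1)
    | neg => exact (min_le_right _ _).trans (Real.exp_le_exp.2 h2)
  exact div_le_div₀ (law_pos z s).le h5 (by positivity) (by linarith)

theorem abs_log_sub_log_le {c u v : ℝ} (hc : 0 < c) (hu : c ≤ u) (hv : c ≤ v) :
    |Real.log u - Real.log v| ≤ |u - v| / c := by
  have key : ∀ u v : ℝ, c ≤ u → c ≤ v → Real.log u - Real.log v ≤ |u - v| / c := by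
    intro u v hu hv
    have hu0 : 0 < u := hc.trans_le hu
    have hv0 : 0 < v := hc.trans_le hv
    rw [← Real.log_div hu0.ne' hv0.ne']
    calc Real.log (u / v) ≤ u / v - 1 := Real.log_le_sub_one_of_pos (by positivity)
      _ = (u - v) / v := by field_simp
      _ ≤ |u - v| / v := by gcongr; exact le_abs_self _
      _ ≤ |u - v| / c := by gcongr
  rw [abs_sub_le_iff]
  exact ⟨key u v hu hv, by rw [abs_sub_comm]; exact key v u hv hu⟩

/-- Fields are controlled by the transition probabilities from the spin `0`. -/
theorem dist_le_abs_trans_sub (hl : 0 < lam) (hθ : 0 < θ) {z z' : ℝ × ℝ} (hz : z ∈ box d lam θ)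
    (hz' : z' ∈ box d lam θ) :
    dist z z' ≤ 2 / transBound d lam θ *
      (|trans θ z 0 1 - trans θ z' 0 1| + |trans θ z 0 (-1) - trans θ z' 0 (-1)|) := by
  have hc : 0 < transBound d lam θ := transBound_pos hl
  have hlog : ∀ s, |Real.log (trans θ z 0 s) - Real.log (trans θ z' 0 s)| ≤
      |trans θ z 0 s - trans θ z' 0 s| / transBound d lam θ := fun s =>
    abs_log_sub_log_le hc (transBound_le hl hz s) (transBound_le hl hz' s)
  -- From a parent with spin 0 all edge weights are 1, so a field is the logarithm of a ratio of
  -- transition probabilities; these are bounded below on the box, where the logarithm is Lipschitz.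
  have e1 : ∀ z : ℝ × ℝ, z.1 = Real.log (trans θ z 0 1) - Real.log (trans θ z 0 0) := by
    intro z
    rw [← Real.log_div (trans_pos hθ z 0 1).ne' (trans_pos hθ z 0 0).ne', trans, trans,
      div_div_div_cancel_right₀ (partition_pos hθ z 0).ne']
    simp
  have e2 : ∀ z : ℝ × ℝ, z.2 = Real.log (trans θ z 0 (-1)) - Real.log (trans θ z 0 0) := by
    intro z
    rw [← Real.log_div (trans_pos hθ z 0 (-1)).ne' (trans_pos hθ z 0 0).ne', trans, trans,
      div_div_div_cancel_right₀ (partition_pos hθ z 0).ne']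
    simp
  have h0 : |trans θ z 0 0 - trans θ z' 0 0| ≤
      |trans θ z 0 1 - trans θ z' 0 1| + |trans θ z 0 (-1) - trans θ z' 0 (-1)| := by
    have s1 := sum_trans hθ z 0
    have s2 := sum_trans hθ z' 0
    rw [sum_signType] at s1 s2
    have : trans θ z 0 0 - trans θ z' 0 0 =
        -((trans θ z 0 1 - trans θ z' 0 1) + (trans θ z 0 (-1) - trans θ z' 0 (-1))) := by
      linarith
    rw [this, abs_neg]
    exact abs_add_le _ _
  set A := |trans θ z 0 1 - trans θ z' 0 1|
  set B := |trans θ z 0 (-1) - trans θ z' 0 (-1)|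
  set C := |trans θ z 0 0 - trans θ z' 0 0|
  set c := transBound d lam θ
  have hA : 0 ≤ A := abs_nonneg _
  have hB : 0 ≤ B := abs_nonneg _
  have fin : ∀ D ≤ A + B, D / c + C / c ≤ 2 / c * (A + B) := by
    intro D hD
    rw [← add_div, div_mul_eq_mul_div]
    gcongr
    linarith
  rw [Prod.dist_eq, max_le_iff, Real.dist_eq, Real.dist_eq]
  constructor
  · refine le_trans ?_ (fin A (by linarith))
    rw [e1 z, e1 z', sub_sub_sub_comm]
    exact (abs_sub _ _).trans (add_le_add (hlog 1) (hlog 0))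
  · refine le_trans ?_ (fin B (by linarith))
    rw [e2 z, e2 z', sub_sub_sub_comm]
    exact (abs_sub _ _).trans (add_le_add (hlog (-1)) (hlog 0))

theorem trans_zero_one_mono (θ : ℝ) {z z' : ℝ × ℝ} (h1 : z.1 ≤ z'.1) (h2 : z'.2 ≤ z.2) :
    trans θ z 0 1 ≤ trans θ z' 0 1 := by
  rw [trans, trans, partition_zero, partition_zero, edgeWeight_zero_left,
    one_mul, one_mul, law_one, law_one, div_le_div_iff₀ (by positivity) (by positivity)]
  have e1 := Real.exp_le_exp.2 h1
  have e2 := Real.exp_le_exp.2 h2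
  have : Real.exp z.1 * Real.exp z'.2 ≤ Real.exp z'.1 * Real.exp z.2 := by gcongr
  linarith

theorem trans_zero_neg_one (θ : ℝ) (z : ℝ × ℝ) : trans θ z 0 (-1) = trans θ z.swap 0 1 := by
  simp only [trans, partition_zero, edgeWeight_zero_left, law_one, law_neg_one, Prod.fst_swap,
    Prod.snd_swap]
  ring_nf

end

end WidomRowlinson

open MeasureTheory Filter Topology

namespace WidomRowlinson

noncomputable section

variable {k d : ℕ} {J β lam θ : ℝ} {h : Vertex k d → ℝ × ℝ}

/-! ### Convergence of the conditional fields -/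

theorem measurable_trans_comp {Ω : Type*} [MeasurableSpace Ω] {f : Ω → ℝ × ℝ} (hf : Measurable f)
    (θ : ℝ) (s s' : SignType) : Measurable fun ω => trans θ (f ω) s s' := by
  have hlaw : ∀ i, Measurable fun ω => law (f ω) i := fun i => by
    cases i with
    | zero => exact measurable_const
    | pos => exact Real.measurable_exp.comp hf.fst
    | neg => exact Real.measurable_exp.comp hf.snd
  exact ((hlaw s').const_mul _).div (Finset.measurable_sum _ fun i _ => (hlaw i).const_mul _)

theorem measurable_chainProb_ballField (hθ : 0 < θ) (hθ1 : θ ≤ 1) (n m : ℕ) (σ : Config k d) :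
    Measurable fun ω : Config k d => chainProb θ (ballField lam θ ω n) m σ :=
  Finset.measurable_prod _ fun x _ =>
    measurable_trans_comp (measurable_ballField hθ hθ1 n x) θ _ _

theorem integrable_of_abs_le {Ω : Type*} [MeasurableSpace Ω] {μ : Measure Ω} [IsFiniteMeasure μ]
    {f : Ω → ℝ} (hf : Measurable f) {C : ℝ} (hC : ∀ ω, |f ω| ≤ C) : Integrable f μ :=
  (memLp_top_of_bound hf.aestronglyMeasurable C (ae_of_all _ hC)).integrable le_top

theorem chainProb_le_one (hθ : 0 < θ) (h : Vertex k d → ℝ × ℝ) (n : ℕ) (σ : Config k d) :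
    chainProb θ h n σ ≤ 1 :=
  Finset.prod_le_one (fun _ _ => (trans_pos hθ _ _ _).le) fun _ _ => trans_le_one hθ _ _ _

theorem integrable_chainProb_ballField (hθ : 0 < θ) (hθ1 : θ ≤ 1) (n m : ℕ) (σ : Config k d)
    (μ : Measure (Config k d)) [IsFiniteMeasure μ] :
    Integrable (fun ω => chainProb θ (ballField lam θ ω n) m σ) μ :=
  integrable_of_abs_le (measurable_chainProb_ballField hθ hθ1 n m σ) (C := 1) fun ω => by
    rw [abs_of_pos (chainProb_pos hθ _ _ _)]
    exact chainProb_le_one hθ _ _ _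

/-- Cylinder probabilities of a Gibbs measure as means of conditional probabilities. -/
theorem integral_chainProb_ballField (hβ : 0 < β) (hθ : θ = Real.exp (-J * β)) (hθ1 : θ ≤ 1)
    (hl : 0 < lam) {ν : Measure (Config k d)} (hν : ν ∈ gibbsMeasures k d J β lam) {m n : ℕ}
    (hmn : m ≤ n) (σ : Config k d) :
    ∫ ω, chainProb θ (ballField lam θ ω n) m σ ∂ν = ν.real (cylinder (ball k d m) σ) := by
  have hθ0 : 0 < θ := hθ ▸ Real.exp_pos _
  rw [integral_eq_lintegral_of_nonneg_ae (ae_of_all _ fun ω => (chainProb_pos hθ0 _ _ _).le)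
    (measurable_chainProb_ballField hθ0 hθ1 n m σ).aestronglyMeasurable, measureReal_def,
    hν.2 (ball k d n) _ (measurableSet_cylinder _ _)]
  simp only [gibbsKernel_ball hβ hθ hl hmn]

theorem chainMeasure_real_cylinder (hθ : 0 < θ) (h : Vertex k d → ℝ × ℝ) (m : ℕ)
    (σ : Config k d) : (chainMeasure θ h).real (cylinder (ball k d m) σ) = chainProb θ h m σ := by
  rw [measureReal_def, chainMeasure_cylinder hθ, ENNReal.toReal_ofReal (chainProb_pos hθ _ _ _).le]

/-- The probability that all spins in `V_m` are `0`, except possibly for the spin at `y`. -/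
def zeroProb (θ : ℝ) (h : Vertex k d → ℝ × ℝ) (m : ℕ) (y : Vertex k d) : ℝ :=
  ∏ x ∈ (ball k d m).erase y, trans θ (h x) 0 0

theorem level_parent (x : Vertex k d) : x.parent.level = x.level - 1 := by
  simp [Vertex.parent, Vertex.level]

/-- This test configuration isolates one transition probability: the ball ends at the level of `y`,
so `y` has no children in it, and every parent spin is 0. -/
theorem chainProb_single {y : Vertex k d} (hy : 0 < y.level) (g : Vertex k d → ℝ × ℝ)
    (s : SignType) : chainProb θ g y.level (fun x => if x = y then s else 0) =
      zeroProb θ g y.level y * trans θ (g y) 0 s := by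
  have hyb : y ∈ ball k d y.level := (mem_ball _ _).2 le_rfl
  have hp : ∀ x ∈ ball k d y.level,
      parentSpin (fun x : Vertex k d => if x = y then s else 0) x = 0 := by
    intro x hx
    unfold parentSpin
    split_ifs with hr
    · rfl
    · refine if_neg fun hxy => ?_
      have h1 := level_parent x
      rw [hxy] at h1
      rw [mem_ball] at hx
      omega
  rw [chainProb, ← Finset.prod_erase_mul _ _ hyb, zeroProb, hp y hyb, if_pos rfl]
  congr 1
  refine Finset.prod_congr rfl fun x hx => ?_
  rw [Finset.mem_erase] at hx
  rw [hp x hx.2, if_neg hx.1]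

/-- Summing out the spin at `y` writes the remaining product as a sum of cylinder probabilities, so
the DLR equations give its mean. -/
theorem zeroProb_eq_sum (hθ : 0 < θ) {y : Vertex k d} (hy : 0 < y.level)
    (g : Vertex k d → ℝ × ℝ) : zeroProb θ g y.level y =
      ∑ s, chainProb θ g y.level fun x => if x = y then s else 0 := by
  simp only [chainProb_single hy]
  rw [← Finset.mul_sum, sum_trans hθ, mul_one]

theorem abs_prod_sub_prod_le {ι : Type*} (s : Finset ι) {f g : ι → ℝ}
    (hf : ∀ i, 0 ≤ f i ∧ f i ≤ 1) (hg : ∀ i, 0 ≤ g i ∧ g i ≤ 1) :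
    |∏ i ∈ s, f i - ∏ i ∈ s, g i| ≤ ∑ i ∈ s, |f i - g i| := by
  classical
  induction s using Finset.induction_on with
  | empty => simp
  | insert a s ha ih =>
    rw [Finset.prod_insert ha, Finset.prod_insert ha, Finset.sum_insert ha]
    have hp0 : 0 ≤ ∏ i ∈ s, f i := Finset.prod_nonneg fun i _ => (hf i).1
    have hp1 : ∏ i ∈ s, f i ≤ 1 := Finset.prod_le_one (fun i _ => (hf i).1) fun i _ => (hf i).2
    have e : f a * ∏ i ∈ s, f i - g a * ∏ i ∈ s, g i =
        (f a - g a) * ∏ i ∈ s, f i + g a * (∏ i ∈ s, f i - ∏ i ∈ s, g i) := by ring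
    rw [e]
    refine (abs_add_le _ _).trans (add_le_add ?_ ?_)
    · rw [abs_mul, abs_of_nonneg hp0]
      exact mul_le_of_le_one_right (abs_nonneg _) hp1
    · rw [abs_mul, abs_of_nonneg (hg a).1]
      exact (mul_le_of_le_one_left (abs_nonneg _) (hg a).2).trans ih

section Fixed

variable (hβ : 0 < β) (hθ : θ = Real.exp (-J * β)) (hθ1 : θ ≤ 1) (hl : 0 < lam) (hd : k ≤ d)
  (hh : IsBoundaryLaw lam θ h)
include hβ hθ hθ1 hl hd hh

/-- A one-sided deterministic bound that is asymptotically attained forces convergence in mean of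
the conditional transition probabilities. -/
theorem tendsto_integral_abs_trans_sub {y : Vertex k d} (hy : 0 < y.level) (s : SignType)
    {ε : ℝ} (hε : |ε| = 1) {c : ℕ → ℝ} (hc : Tendsto c atTop (𝓝 (trans θ (h y) 0 s)))
    (hle : ∀ n ω, ε * trans θ (ballField lam θ ω n y) 0 s ≤ ε * c n) :
    Tendsto (fun n => ∫ ω, |trans θ (ballField lam θ ω n y) 0 s - trans θ (h y) 0 s|
      ∂(chainMeasure θ h)) atTop (𝓝 0) := by
  have hθ0 : 0 < θ := hθ ▸ Real.exp_pos _
  have := isProbabilityMeasure_chainMeasure hθ0 h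
  have hG := chainMeasure_mem_gibbsMeasures hβ hθ hl hh
  set μ := chainMeasure θ h
  set p := trans θ (h y) 0 s
  -- A lower bound for the zero probability, uniform in n and in the boundary condition.
  set r := transBound d lam θ ^ ((ball k d y.level).erase y).card
  have hr : 0 < r := pow_pos (transBound_pos hl) _
  have hmean : ∀ n, y.level ≤ n → ∀ s,
      ∫ ω, chainProb θ (ballField lam θ ω n) y.level (fun x => if x = y then s else 0) ∂μ =
      chainProb θ h y.level fun x => if x = y then s else 0 := fun n hn s => by
    rw [integral_chainProb_ballField hβ hθ hθ1 hl hG hn, chainMeasure_real_cylinder hθ0]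
  have hint := fun n s => integrable_chainProb_ballField (lam := lam) hθ0 hθ1 n y.level
    (fun x : Vertex k d => if x = y then s else 0) μ
  have hzint : ∀ n, Integrable (fun ω => zeroProb θ (ballField lam θ ω n) y.level y) μ := by
    intro n
    simp only [zeroProb_eq_sum hθ0 hy]
    exact integrable_finsetSum _ fun s _ => hint n s
  have hzmean : ∀ n, y.level ≤ n → ∫ ω, zeroProb θ (ballField lam θ ω n) y.level y ∂μ =
      zeroProb θ h y.level y := by
    intro n hn
    simp only [zeroProb_eq_sum hθ0 hy]
    rw [integral_finsetSum _ fun s _ => hint n s]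
    exact Finset.sum_congr rfl fun s _ => hmean n hn s
  have hzr : ∀ n ω, r ≤ zeroProb θ (ballField lam θ ω n) y.level y := by
    intro n ω
    change transBound d lam θ ^ _ ≤ _
    rw [← Finset.prod_const]
    exact Finset.prod_le_prod (fun _ _ => (transBound_pos hl).le) fun x _ =>
      transBound_le hl (innerField_mem_box hθ0 hθ1 hd _ _ _) 0
  have hz1 : zeroProb θ h y.level y ≤ 1 :=
    Finset.prod_le_one (fun _ _ => (trans_pos hθ0 _ _ _).le) fun _ _ => trans_le_one hθ0 _ _ _
  have hz0 : 0 ≤ zeroProb θ h y.level y :=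
    Finset.prod_nonneg fun _ _ => (trans_pos hθ0 _ _ _).le
  have hftint : ∀ n, Integrable (fun ω => trans θ (ballField lam θ ω n y) 0 s) μ := fun n =>
    integrable_of_abs_le (measurable_trans_comp (measurable_ballField hθ0 hθ1 n y) θ 0 s) (C := 1)
      fun ω => by
        rw [abs_of_pos (trans_pos hθ0 _ _ _)]
        exact trans_le_one hθ0 _ _ _
  have bound : ∀ n, y.level ≤ n →
      ∫ ω, |trans θ (ballField lam θ ω n y) 0 s - p| ∂μ ≤ |c n - p| * (1 / r + 1) := by
    intro n hn
    -- The integrand is nonnegative, so r may be replaced by the random zero probability, which is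
    -- larger. The product with the transition probability is then a cylinder probability, both
    -- means are known, and what remains is the deterministic gap between c_n and p.
    have h1 : ∫ ω, ε * (c n - trans θ (ballField lam θ ω n y) 0 s) ∂μ ≤ |c n - p| / r := by
      rw [le_div_iff₀ hr, ← integral_mul_const]
      calc ∫ ω, ε * (c n - trans θ (ballField lam θ ω n y) 0 s) * r ∂μ
          ≤ ∫ ω, ε * (c n * zeroProb θ (ballField lam θ ω n) y.level y -
              chainProb θ (ballField lam θ ω n) y.level fun x => if x = y then s else 0) ∂μ := by
            refine integral_mono ((((integrable_const _).sub (hftint n)).const_mul _).mul_const _)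
              ((((hzint n).const_mul _).sub (hint n s)).const_mul _) fun ω => ?_
            simp only [chainProb_single hy]
            have a := hzr n ω
            have b : 0 ≤ ε * (c n - trans θ (ballField lam θ ω n y) 0 s) := by
              linarith [hle n ω]
            have := mul_le_mul_of_nonneg_left a b
            linarith
        _ = ε * (c n * zeroProb θ h y.level y - zeroProb θ h y.level y * p) := by
            rw [integral_const_mul, integral_sub ((hzint n).const_mul _) (hint n s),
              integral_const_mul, hzmean n hn, hmean n hn, chainProb_single hy]
        _ = ε * (c n - p) * zeroProb θ h y.level y := by ring
        _ ≤ |ε * (c n - p)| * zeroProb θ h y.level y := by gcongr; exact le_abs_self _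
        _ ≤ |ε * (c n - p)| * 1 := by gcongr
        _ = |c n - p| := by rw [abs_mul, hε, one_mul, mul_one]
    calc ∫ ω, |trans θ (ballField lam θ ω n y) 0 s - p| ∂μ
        ≤ ∫ ω, (ε * (c n - trans θ (ballField lam θ ω n y) 0 s) + |c n - p|) ∂μ := by
          refine integral_mono ((hftint n).sub (integrable_const _)).abs
            ((((integrable_const _).sub (hftint n)).const_mul _).add (integrable_const _))
            fun ω => ?_
          have b : 0 ≤ ε * (c n - trans θ (ballField lam θ ω n y) 0 s) := by linarith [hle n ω]
          have e : |c n - trans θ (ballField lam θ ω n y) 0 s| =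
              ε * (c n - trans θ (ballField lam θ ω n y) 0 s) := by
            rw [← abs_of_nonneg b, abs_mul, hε, one_mul]
          simp only
          rw [← e, abs_sub_comm (c n)]
          exact abs_sub_le _ _ _
      _ = ∫ ω, ε * (c n - trans θ (ballField lam θ ω n y) 0 s) ∂μ + |c n - p| := by
          have hi : Integrable (fun ω => ε * (c n - trans θ (ballField lam θ ω n y) 0 s)) μ :=
            ((integrable_const _).sub (hftint n)).const_mul _
          rw [integral_add hi (integrable_const _)]
          simp
      _ ≤ |c n - p| / r + |c n - p| := by gcongr
      _ = _ := by ring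
  have hlim : Tendsto (fun n => |c n - p| * (1 / r + 1)) atTop (𝓝 (|p - p| * (1 / r + 1))) :=
    ((hc.sub_const p).abs).mul_const _
  rw [sub_self, abs_zero, zero_mul] at hlim
  refine tendsto_of_tendsto_of_tendsto_of_le_of_le' tendsto_const_nhds hlim
    (Eventually.of_forall fun n => integral_nonneg fun ω => abs_nonneg _)
    ((eventually_ge_atTop y.level).mono bound)

omit hβ hθ hl in
theorem integrable_dist_ballField (hθ0 : 0 < θ) (n : ℕ) (x : Vertex k d) (μ : Measure (Config k d))
    [IsFiniteMeasure μ] : Integrable (fun ω => dist (ballField lam θ ω n x) (h x)) μ :=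
  integrable_of_abs_le ((measurable_ballField hθ0 hθ1 n x).dist measurable_const)
    (C := Real.log lam - (Real.log lam + d * Real.log θ)) fun ω => by
      rw [abs_of_nonneg dist_nonneg, isBoundaryLaw_iff.1 hh x]
      exact dist_le_of_mem_Icc (innerField_mem_box hθ0 hθ1 hd _ _ _)
        (update_mem_Icc hθ0 hθ1 hd _ _)

/-- Convergence in mean of the conditional fields at a vertex with weights `z`, if `z` is the limit
of the extremal fields. -/
theorem tendsto_integral_dist_of_bounds {y : Vertex k d} (hy : 0 < y.level)
    {ε : ℝ} (hε : |ε| = 1) {c : ℕ → ℝ × ℝ} (hc : Tendsto c atTop (𝓝 (h y)))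
    (hle : ∀ n ω, ε * trans θ (ballField lam θ ω n y) 0 1 ≤ ε * trans θ (c n) 0 1)
    (hge : ∀ n ω, -ε * trans θ (ballField lam θ ω n y) 0 (-1) ≤ -ε * trans θ (c n) 0 (-1)) :
    Tendsto (fun n => ∫ ω, dist (ballField lam θ ω n y) (h y) ∂(chainMeasure θ h))
      atTop (𝓝 0) := by
  have hθ0 : 0 < θ := hθ ▸ Real.exp_pos _
  have := isProbabilityMeasure_chainMeasure hθ0 h
  have hct : ∀ s, Tendsto (fun n => trans θ (c n) 0 s) atTop (𝓝 (trans θ (h y) 0 s)) := by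
    intro s
    rw [tendsto_iff_dist_tendsto_zero]
    refine squeeze_zero (fun _ => dist_nonneg) (fun n => abs_trans_sub_le hθ0 (c n) (h y) 0 s) ?_
    simpa using (tendsto_iff_dist_tendsto_zero.1 hc).const_mul 2
  have h1 := tendsto_integral_abs_trans_sub hβ hθ hθ1 hl hd hh hy 1 hε (hct 1) hle
  have h2 := tendsto_integral_abs_trans_sub hβ hθ hθ1 hl hd hh hy (-1) (by rwa [abs_neg])
    (hct (-1)) hge
  have hsum := (h1.add h2).const_mul (2 / transBound d lam θ)
  rw [add_zero, mul_zero] at hsum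
  have hint : ∀ n s, Integrable (fun ω : Config k d =>
      |trans θ (ballField lam θ ω n y) 0 s - trans θ (h y) 0 s|) (chainMeasure θ h) := fun n s =>
    integrable_of_abs_le ((measurable_trans_comp (measurable_ballField hθ0 hθ1 n y) θ 0 s).sub
      measurable_const).abs (C := 1) fun ω => by
        rw [abs_abs, abs_sub_le_iff]
        have a := trans_le_one hθ0 (ballField lam θ ω n y) 0 s
        have b := trans_le_one hθ0 (h y) 0 s
        have a' := trans_pos hθ0 (ballField lam θ ω n y) 0 s
        have b' := trans_pos hθ0 (h y) 0 s
        exact ⟨by linarith, by linarith⟩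
  refine squeeze_zero (fun n => integral_nonneg fun ω => dist_nonneg) (fun n => ?_) hsum
  rw [← integral_add (hint n 1) (hint n (-1)), ← integral_const_mul]
  refine integral_mono (integrable_dist_ballField hθ1 hd hh hθ0 n y _)
    (((hint n 1).add (hint n (-1))).const_mul _) fun ω => ?_
  refine dist_le_abs_trans_sub hl hθ0 (innerField_mem_box hθ0 hθ1 hd _ _ _) ?_
  rw [isBoundaryLaw_iff.1 hh y]
  exact update_mem_Icc hθ0 hθ1 hd _ _

/-- Convergence in mean of the conditional fields at the vertices off the path. -/
theorem tendsto_integral_dist_of_constant (hk : 2 ≤ k) (hθ1' : θ < 1) {x₁ x₂ : ℝ} (hx : x₂ < x₁)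
    (hs : IsConstantSolution k lam θ x₁ x₂) {y : Vertex k d} (hy : 0 < y.level)
    (hhy : h y = (Real.log x₁, Real.log x₂) ∨ h y = (Real.log x₂, Real.log x₁)) :
    Tendsto (fun n => ∫ ω, dist (ballField lam θ ω n y) (h y) ∂(chainMeasure θ h))
      atTop (𝓝 0) := by
  have hθ0 : 0 < θ := hθ ▸ Real.exp_pos _
  have hM := (tendsto_extremeField hk hθ0 hθ1' hl hx hs).comp (tendsto_sub_atTop_nat y.level)
  -- The bound by the all-1 boundary condition serves the larger-first solution; its flipped form,
  -- obtained at -ω, serves the swapped one.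
  have hle : ∀ n (ω : Config k d), _ := fun n ω =>
    innerField_le_extremeField (lam := lam) hθ0 hθ1 ω (n - y.level) hy
  have hle' : ∀ n (ω : Config k d), _ := fun n ω =>
    innerField_le_extremeField (lam := lam) hθ0 hθ1 (-ω) (n - y.level) hy
  simp only [innerField_neg, Prod.fst_swap, Prod.snd_swap] at hle'
  rcases hhy with hhy | hhy
  · refine tendsto_integral_dist_of_bounds hβ hθ hθ1 hl hd hh hy (ε := 1) (by simp)
      (c := fun n => extremeField k lam θ (n - y.level)) (by rw [hhy]; exact hM)
      (fun n ω => ?_) fun n ω => ?_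
    · rw [one_mul, one_mul]
      exact trans_zero_one_mono θ (hle n ω).1 (hle n ω).2
    · rw [trans_zero_neg_one, trans_zero_neg_one, neg_one_mul, neg_one_mul, neg_le_neg_iff]
      exact trans_zero_one_mono θ (hle n ω).2 (hle n ω).1
  · refine tendsto_integral_dist_of_bounds hβ hθ hθ1 hl hd hh hy (ε := -1) (by simp)
      (c := fun n => (extremeField k lam θ (n - y.level)).swap)
      (by rw [hhy]; exact (continuous_swap.tendsto _).comp hM)
      (fun n ω => ?_) fun n ω => ?_
    · rw [neg_one_mul, neg_one_mul, neg_le_neg_iff]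
      exact trans_zero_one_mono θ (hle' n ω).2 (hle' n ω).1
    · rw [trans_zero_neg_one, trans_zero_neg_one, neg_neg, one_mul, one_mul]
      exact trans_zero_one_mono θ (hle' n ω).1 (hle' n ω).2

omit hβ hl in
/-- Convergence in mean of the conditional fields on a path, if they converge off the path. -/
theorem tendsto_integral_dist_on_path (hθ9 : 1 / 9 < θ) (π : RootPath k d)
    (hoff : ∀ m c, c ≠ π.choice m → Tendsto (fun n => ∫ ω, dist
      (ballField lam θ ω n ((π.vertex m).child c)) (h ((π.vertex m).child c)) ∂(chainMeasure θ h))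
      atTop (𝓝 0)) (m : ℕ) :
    Tendsto (fun n => ∫ ω, dist (ballField lam θ ω n (π.vertex m)) (h (π.vertex m))
      ∂(chainMeasure θ h)) atTop (𝓝 0) := by
  have hθ0 : 0 < θ := hθ ▸ Real.exp_pos _
  have := isProbabilityMeasure_chainMeasure hθ0 h
  have hq0 := contraction_nonneg hθ1
  have hq1 := contraction_lt_one hθ9
  set q := contraction θ
  set D : ℕ → Vertex k d → ℝ := fun n x =>
    ∫ ω, dist (ballField lam θ ω n x) (h x) ∂(chainMeasure θ h) with hD
  have hint : ∀ n x, Integrable (fun ω => dist (ballField lam θ ω n x) (h x))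
      (chainMeasure θ h) := fun n x => integrable_dist_ballField hθ1 hd hh hθ0 n x _
  have hD0 : ∀ n x, 0 ≤ D n x := fun n x => integral_nonneg fun ω => dist_nonneg
  obtain ⟨K, hK⟩ : ∃ K, K = Real.log lam - (Real.log lam + d * Real.log θ) := ⟨_, rfl⟩
  have hDK : ∀ n x, D n x ≤ K := by
    intro n x
    have : D n x ≤ ∫ _, K ∂(chainMeasure θ h) := by
      refine integral_mono (hint n x) (integrable_const _) fun ω => ?_
      simp only
      rw [isBoundaryLaw_iff.1 hh x, hK]
      exact dist_le_of_mem_Icc (innerField_mem_box hθ0 hθ1 hd _ _ _)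
        (update_mem_Icc hθ0 hθ1 hd _ _)
    simpa using this
  -- Both `ballField` and `h` satisfy the compatibility equation at a path vertex inside the ball,
  -- so the mean distance contracts up to errors from the siblings.
  have hrec : ∀ m n, m < n → D n (π.vertex m) ≤ q * D n (π.vertex (m + 1)) +
      ∑ c ∈ Finset.univ.erase (π.choice m), q * D n ((π.vertex m).child c) := by
    intro m n hmn
    have h1 : D n (π.vertex m) ≤ ∑ c, q * D n ((π.vertex m).child c) := by
      simp only [hD, ← integral_const_mul]
      rw [← integral_finsetSum _ fun c _ => (hint n _).const_mul q]
      refine integral_mono (hint n _) (integrable_finsetSum _ fun c _ => (hint n _).const_mul q)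
        fun ω => ?_
      simp only
      rw [ballField_eq_update ω (by rwa [RootPath.level_vertex]), isBoundaryLaw_iff.1 hh]
      exact dist_update_le hθ0 hθ1 _ _ _
    rw [← Finset.add_sum_erase _ _ (Finset.mem_univ (π.choice m)), RootPath.child_choice] at h1
    exact h1
  have hSlim : ∀ m, Tendsto (fun n => ∑ c ∈ Finset.univ.erase (π.choice m),
      q * D n ((π.vertex m).child c)) atTop (𝓝 0) := by
    intro m
    simpa using tendsto_finsetSum (Finset.univ.erase (π.choice m)) fun c hc =>
      (hoff m c (Finset.ne_of_mem_erase hc)).const_mul q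
  -- Iterating L times leaves q^L times the a priori bound K, plus sibling errors that vanish as n
  -- grows with L fixed.
  have key : ∀ L m, ∀ δ > 0, ∀ᶠ n in atTop, D n (π.vertex m) ≤ q ^ L * K + δ := by
    intro L
    induction L with
    | zero =>
      intro m δ hδ
      exact Eventually.of_forall fun n => by linarith [hDK n (π.vertex m)]
    | succ L ih =>
      intro m δ hδ
      filter_upwards [ih (m + 1) (δ / 2) (by linarith), eventually_gt_atTop m,
        (hSlim m).eventually (eventually_lt_nhds (by linarith : (0 : ℝ) < δ / 2))] with n h1 h2 h3
      have h4 := hrec m n h2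
      have h5 := mul_le_mul_of_nonneg_left h1 hq0
      rw [pow_succ']
      nlinarith
  have hpow : Tendsto (fun L => q ^ L * K) atTop (𝓝 (0 * K)) :=
    (tendsto_pow_atTop_nhds_zero_of_lt_one hq0 hq1).mul_const K
  rw [zero_mul] at hpow
  rw [Metric.tendsto_atTop']
  intro ε hε
  obtain ⟨L, hL⟩ := (hpow.eventually (eventually_lt_nhds (half_pos hε))).exists
  obtain ⟨N, hN⟩ := eventually_atTop.1 (key L m (ε / 2) (half_pos hε))
  refine ⟨N, fun n hn => ?_⟩
  have := hN n hn.le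
  rw [Real.dist_0_eq_abs, abs_of_nonneg (hD0 n _)]
  linarith

/-- If the conditional fields converge in mean, the Gibbs measure is extreme. -/
theorem isExtremeGibbs_of_tendsto
    (hlim : ∀ x, Tendsto (fun n => ∫ ω, dist (ballField lam θ ω n x) (h x) ∂(chainMeasure θ h))
      atTop (𝓝 0)) : IsExtremeGibbs J β lam (chainMeasure θ h) := by
  have hθ0 : 0 < θ := hθ ▸ Real.exp_pos _
  have hprob := isProbabilityMeasure_chainMeasure hθ0 h
  refine ⟨chainMeasure_mem_gibbsMeasures hβ hθ hl hh, fun ν hν ν' _ hseg => ?_⟩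
  obtain ⟨a, b, ha, -, -, hab⟩ := hseg
  have hνp : IsProbabilityMeasure ν := hν.1
  -- Domination lets the L¹ convergence under the chain measure be used under the component ν.
  have hle : a • ν ≤ chainMeasure θ h := by
    rw [← hab]; exact Measure.le_add_right le_rfl
  refine ext_of_cylinder 0 fun m _ σ => ?_
  have hdiff : ν.real (cylinder (ball k d m) σ) - chainProb θ h m σ = 0 := by
    have hint : ∀ (μ : Measure (Config k d)) [IsProbabilityMeasure μ] n, Integrable (fun ω =>
        |chainProb θ (ballField lam θ ω n) m σ - chainProb θ h m σ|) μ := fun μ _ n =>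
      ((integrable_chainProb_ballField hθ0 hθ1 n m σ μ).sub (integrable_const _)).abs
    -- By DLR the cylinder probability under ν is the ν-mean of the conditional one, and the latter
    -- is close to `chainProb θ h m σ` in L¹ of the dominating measure.
    have h1 : ∀ n, m ≤ n → (a : ℝ) * |ν.real (cylinder (ball k d m) σ) - chainProb θ h m σ| ≤
        ∑ x ∈ ball k d m, 2 * ∫ ω, dist (ballField lam θ ω n x) (h x) ∂(chainMeasure θ h) := by
      intro n hn
      have e1 : ν.real (cylinder (ball k d m) σ) - chainProb θ h m σ =
          ∫ ω, (chainProb θ (ballField lam θ ω n) m σ - chainProb θ h m σ) ∂ν := by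
        rw [integral_sub (integrable_chainProb_ballField hθ0 hθ1 n m σ ν) (integrable_const _),
          integral_chainProb_ballField hβ hθ hθ1 hl hν hn]
        simp
      calc (a : ℝ) * |ν.real (cylinder (ball k d m) σ) - chainProb θ h m σ|
          ≤ a * ∫ ω, |chainProb θ (ballField lam θ ω n) m σ - chainProb θ h m σ| ∂ν := by
            rw [e1]; gcongr; exact abs_integral_le_integral_abs
        _ = ∫ ω, |chainProb θ (ballField lam θ ω n) m σ - chainProb θ h m σ| ∂(a • ν) := by
            rw [integral_smul_nnreal_measure]; rfl
        _ ≤ ∫ ω, |chainProb θ (ballField lam θ ω n) m σ - chainProb θ h m σ|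
              ∂(chainMeasure θ h) :=
            integral_mono_measure hle (ae_of_all _ fun ω => abs_nonneg _) (hint _ n)
        _ ≤ ∫ ω, ∑ x ∈ ball k d m, 2 * dist (ballField lam θ ω n x) (h x)
              ∂(chainMeasure θ h) := by
            refine integral_mono (hint _ n) (integrable_finsetSum _ fun x _ =>
              (integrable_dist_ballField hθ1 hd hh hθ0 n x _).const_mul 2) fun ω => ?_
            refine (abs_prod_sub_prod_le _ (fun x => ⟨(trans_pos hθ0 _ _ _).le,
              trans_le_one hθ0 _ _ _⟩) fun x => ⟨(trans_pos hθ0 _ _ _).le,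
              trans_le_one hθ0 _ _ _⟩).trans ?_
            exact Finset.sum_le_sum fun x _ => abs_trans_sub_le hθ0 _ _ _ _
        _ = _ := by
            rw [integral_finsetSum _ fun x _ =>
              (integrable_dist_ballField hθ1 hd hh hθ0 n x _).const_mul 2]
            simp only [integral_const_mul]
    have h2 : Tendsto (fun n => ∑ x ∈ ball k d m,
        2 * ∫ ω, dist (ballField lam θ ω n x) (h x) ∂(chainMeasure θ h)) atTop (𝓝 0) := by
      simpa using tendsto_finsetSum (ball k d m) fun x _ => (hlim x).const_mul 2
    have h3 := ge_of_tendsto h2 ((eventually_ge_atTop m).mono h1)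
    have ha' : (0 : ℝ) < a := ha
    have h4 : |ν.real (cylinder (ball k d m) σ) - chainProb θ h m σ| ≤ 0 := by
      by_contra hpos
      nlinarith
    exact abs_nonpos_iff.1 h4
  rw [chainMeasure_cylinder hθ0, ← sub_eq_zero.1 hdiff, ofReal_measureReal]

/-- The splitting Gibbs measure of a path is extreme. -/
theorem isExtremeGibbs_chainMeasure (hk : 2 ≤ k) (hθ9 : 1 / 9 < θ) (hθ1' : θ < 1) {x₁ x₂ : ℝ}
    (hx : x₁ ≠ x₂) (hs : IsConstantSolution k lam θ x₁ x₂) {π : RootPath k d}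
    (hπ : IsPathLaw lam θ x₁ x₂ π h) : IsExtremeGibbs J β lam (chainMeasure θ h) := by
  have hoff : ∀ y : Vertex k d, π.IsRight y ∨ π.IsLeft y →
      Tendsto (fun n => ∫ ω, dist (ballField lam θ ω n y) (h y) ∂(chainMeasure θ h))
        atTop (𝓝 0) := by
    intro y hy
    have hy0 : 0 < y.level := hy.elim (fun h => h.level_pos) fun h => h.level_pos
    have hval : h y = (Real.log x₁, Real.log x₂) ∨ h y = (Real.log x₂, Real.log x₁) :=
      hy.imp (hπ.2.1 y) (hπ.2.2 y)
    rcases lt_or_gt_of_ne hx with hlt | hlt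
    · exact tendsto_integral_dist_of_constant hβ hθ hθ1 hl hd hh hk hθ1' hlt hs.swap hy0 hval.symm
    · exact tendsto_integral_dist_of_constant hβ hθ hθ1 hl hd hh hk hθ1' hlt hs hy0 hval
  refine isExtremeGibbs_of_tendsto hβ hθ hθ1 hl hd hh fun x => ?_
  rcases π.isRight_or_isLeft_or_eq x with hx | hx | hx
  · exact hoff x (Or.inl hx)
  · exact hoff x (Or.inr hx)
  · rw [hx]
    refine tendsto_integral_dist_on_path hθ hθ1 hd hh hθ9 π (fun m c hc => ?_) _
    rcases lt_or_gt_of_ne hc with hlt | hlt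
    · exact hoff _ (Or.inr (π.isLeft_child_vertex c hlt))
    · exact hoff _ (Or.inl (π.isRight_child_vertex c hlt))

end Fixed

end

end WidomRowlinson

open MeasureTheory

namespace WidomRowlinson

noncomputable section

variable {k d : ℕ} {J β lam θ : ℝ} {h : Vertex k d → ℝ × ℝ}

/-! ### Spins at the ends of an edge -/

/-- The configurations with spin `0` at `x` and spin `s` at `z`. -/
def zeroAnd (x z : Vertex k d) (s : SignType) : Set (Config k d) := {ω | ω x = 0 ∧ ω z = s}

theorem measurableSet_zeroAnd (x z : Vertex k d) (s : SignType) : MeasurableSet (zeroAnd x z s) := by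
  have hm : ∀ (v : Vertex k d) (s : SignType), MeasurableSet {ω : Config k d | ω v = s} :=
    fun v s => measurableSet_eq_fun (measurable_pi_apply v) measurable_const
  exact (hm x 0).inter (hm z s)

theorem chainProb_child (x : Vertex k d) (c : Fin (branching k d x.level)) (σ : Config k d) :
    chainProb θ h (x.child c).level σ =
      (∏ v ∈ (ball k d (x.child c).level).erase (x.child c), trans θ (h v) (parentSpin σ v) (σ v)) *
        trans θ (h (x.child c)) (σ x) (σ (x.child c)) := by
  rw [chainProb, ← Finset.prod_erase_mul _ _ ((mem_ball _ _).2 le_rfl), parentSpin_child]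

theorem trans_zero_one_eq (X : ℝ × ℝ) : trans θ X 0 1 = Real.exp X.1 * trans θ X 0 0 := by
  simp [trans, edgeWeight, law, div_eq_mul_inv]

/-- In the ball ending at the level of the child its spin enters one factor only, and from a parent
with spin 0 the probabilities of 1 and 0 have ratio exp of the first component. -/
theorem chainProb_update_child (x : Vertex k d) (c : Fin (branching k d x.level)) {σ : Config k d}
    (hx : σ x = 0) :
    chainProb θ h (x.child c).level (Function.update σ (x.child c) 1) =
      Real.exp (h (x.child c)).1 *
        chainProb θ h (x.child c).level (Function.update σ (x.child c) 0) := by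
  set z := x.child c with hz
  have hxz : x ≠ z := fun e => by
    have := congrArg Vertex.level e
    rw [hz, level_child] at this
    omega
  have hp : ∀ s, ∏ v ∈ (ball k d z.level).erase z,
      trans θ (h v) (parentSpin (Function.update σ z s) v) (Function.update σ z s v) =
      ∏ v ∈ (ball k d z.level).erase z, trans θ (h v) (parentSpin σ v) (σ v) := by
    intro s
    refine Finset.prod_congr rfl fun v hv => ?_
    rw [Finset.mem_erase, mem_ball] at hv
    rw [Function.update_of_ne hv.1]
    congr 1
    unfold parentSpin
    split_ifs with hr
    · rfl
    · refine Function.update_of_ne (fun e => ?_) _ _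
      have h1 := level_parent v
      rw [e] at h1
      have : z.level = x.level + 1 := level_child x c
      omega
  rw [hz, chainProb_child, chainProb_child, ← hz, hp, hp, Function.update_of_ne hxz,
    Function.update_of_ne hxz, Function.update_self, Function.update_self, hx, trans_zero_one_eq]
  ring

theorem chainMeasure_real_eq_sum (hθ : 0 < θ) (n : ℕ) {A : Set (Config k d)}
    (hA : ∀ ω ω' : Config k d, (∀ x ∈ ball k d n, ω x = ω' x) → ω ∈ A → ω' ∈ A) :
    (chainMeasure θ h).real A = ∑ ξ : ball k d n → SignType,
      A.indicator (chainProb θ h n) (glue (ball k d n) ξ 0) := by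
  have := isProbabilityMeasure_chainMeasure hθ h
  rw [measureReal_def, ← sum_measure_inter_cylinder _ (ball k d n) 0,
    ENNReal.toReal_sum fun _ _ => measure_ne_top _ _]
  refine Finset.sum_congr rfl fun ξ _ => ?_
  by_cases hξ : glue (ball k d n) ξ 0 ∈ A
  · rw [Set.indicator_of_mem hξ, ← chainMeasure_real_cylinder hθ, measureReal_def,
      Set.inter_eq_right.2]
    exact fun ω hω => hA _ _ (fun x hx => (hω x hx).symm) hξ
  · have hempty : A ∩ cylinder (ball k d n) (glue (ball k d n) ξ 0) = ∅ :=
      Set.eq_empty_iff_forall_notMem.2 fun ω hω => hξ (hA _ _ hω.2 hω.1)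
    rw [Set.indicator_of_notMem hξ, hempty, measure_empty, ENNReal.toReal_zero]

theorem glue_update {Λ : Finset (Vertex k d)} (ξ : Λ → SignType) (ω : Config k d) (z : Λ)
    (s : SignType) : glue Λ (Function.update ξ z s) ω = Function.update (glue Λ ξ ω) z s := by
  funext x
  by_cases hx : x ∈ Λ
  · rw [glue_of_mem _ _ hx]
    by_cases hxz : x = z
    · subst hxz
      simp
    · rw [Function.update_of_ne hxz, Function.update_of_ne (fun e => hxz (congrArg Subtype.val e)),
        glue_of_mem _ _ hx]
  · rw [glue_of_notMem _ _ hx, Function.update_of_ne (by rintro rfl; exact hx z.2),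
      glue_of_notMem _ _ hx]

/-- The weights at a vertex are ratios of probabilities. -/
theorem chainMeasure_zeroAnd_one (hθ : 0 < θ) (x : Vertex k d)
    (c : Fin (branching k d x.level)) :
    (chainMeasure θ h).real (zeroAnd x (x.child c) 1) =
      Real.exp (h (x.child c)).1 * (chainMeasure θ h).real (zeroAnd x (x.child c) 0) := by
  have hu := fun σ hx => chainProb_update_child (θ := θ) (h := h) x c (σ := σ) hx
  set z := x.child c with hz
  set n := z.level with hn
  have hlev : z.level = x.level + 1 := level_child x c
  have hzb : z ∈ ball k d n := (mem_ball _ _).2 le_rfl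
  have hxb : x ∈ ball k d n := (mem_ball _ _).2 (by omega)
  have hxz : x ≠ z := fun e => by have := congrArg Vertex.level e; omega
  have hA : ∀ s (ω ω' : Config k d), (∀ x ∈ ball k d n, ω x = ω' x) → ω ∈ zeroAnd x z s →
      ω' ∈ zeroAnd x z s := fun s ω ω' he hω => ⟨he x hxb ▸ hω.1, he z hzb ▸ hω.2⟩
  let z' : ball k d n := ⟨z, hzb⟩
  -- Exchanging the spins 0 and 1 at the child is an involution that matches the configurations of
  -- the two events.
  let e : Equiv.Perm (ball k d n → SignType) :=
    { toFun := fun ξ => Function.update ξ z' (Equiv.swap 0 1 (ξ z'))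
      invFun := fun ξ => Function.update ξ z' (Equiv.swap 0 1 (ξ z'))
      left_inv := fun ξ => by simp
      right_inv := fun ξ => by simp }
  rw [chainMeasure_real_eq_sum hθ n (hA 1), chainMeasure_real_eq_sum hθ n (hA 0), Finset.mul_sum]
  refine Finset.sum_equiv e (by simp) fun ξ _ => ?_
  have he : glue (ball k d n) (e ξ) 0 =
      Function.update (glue (ball k d n) ξ 0) z (Equiv.swap 0 1 (ξ z')) := glue_update ξ 0 z' _
  have hξz : glue (ball k d n) ξ 0 z = ξ z' := glue_of_mem _ _ hzb
  rw [he]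
  by_cases hmem : glue (ball k d n) ξ 0 ∈ zeroAnd x z 1
  · have h1 : ξ z' = 1 := hξz ▸ hmem.2
    rw [h1, Equiv.swap_apply_right, Set.indicator_of_mem hmem, Set.indicator_of_mem,
      ← hu _ hmem.1, ← hmem.2, Function.update_eq_self]
    exact ⟨by rw [Function.update_of_ne hxz]; exact hmem.1, Function.update_self ..⟩
  · rw [Set.indicator_of_notMem hmem, Set.indicator_of_notMem, mul_zero]
    rintro ⟨h0, h1⟩
    rw [Function.update_of_ne hxz] at h0
    rw [Function.update_self, Equiv.swap_apply_eq_iff, Equiv.swap_apply_left] at h1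
    exact hmem ⟨h0, hξz.trans h1⟩

theorem chainMeasure_zeroAnd_zero_pos (hθ : 0 < θ) (x z : Vertex k d) :
    0 < (chainMeasure θ h).real (zeroAnd x z 0) := by
  have := isProbabilityMeasure_chainMeasure hθ h
  refine (chainMeasure_real_cylinder hθ h (max x.level z.level) 0 ▸ chainProb_pos hθ _ _ _).trans_le
    (measureReal_mono (s₁ := cylinder (ball k d (max x.level z.level)) 0) fun ω hω => ?_)
  exact ⟨hω x ((mem_ball _ _).2 (le_max_left _ _)), hω z ((mem_ball _ _).2 (le_max_right _ _))⟩

/-- The measure determines the first component of the weights off the root. -/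
theorem fst_eq_of_chainMeasure_eq (hθ : 0 < θ) {g g' : Vertex k d → ℝ × ℝ}
    (hm : chainMeasure θ g = chainMeasure θ g') {y : Vertex k d} (hy : 0 < y.level) :
    (g y).1 = (g' y).1 := by
  obtain ⟨x, c, rfl⟩ := exists_eq_child hy
  have h1 := chainMeasure_zeroAnd_one (h := g) hθ x c
  rw [hm, chainMeasure_zeroAnd_one hθ] at h1
  exact (Real.exp_injective
    (mul_right_cancel₀ (chainMeasure_zeroAnd_zero_pos hθ x (x.child c)).ne' h1)).symm

/-- Paths with different numbers are separated by a vertex, to the right of one and to the left of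
the other. The first components there are log x₁ and log x₂, and the measure can tell them apart. -/
theorem number_eq_of_chainMeasure_eq (hk : 2 ≤ k) (hd : k ≤ d) (hθ : 0 < θ) {x₁ x₂ : ℝ}
    (hx : x₁ ≠ x₂) (hs : IsConstantSolution k lam θ x₁ x₂) {π π' : RootPath k d}
    {g g' : Vertex k d → ℝ × ℝ} (hg : IsPathLaw lam θ x₁ x₂ π g)
    (hg' : IsPathLaw lam θ x₁ x₂ π' g') (hm : chainMeasure θ g = chainMeasure θ g') :
    π.number = π'.number := by
  by_contra hne
  have hlog : Real.log x₁ ≠ Real.log x₂ := fun e => hx (Real.log_injOn_pos hs.1 hs.2.1 e)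
  obtain ⟨n, h1, h2⟩ := RootPath.exists_first_difference fun e => hne (congrArg RootPath.number e)
  rcases lt_or_gt_of_ne h2 with h2 | h2
  · obtain ⟨x, hr, hl⟩ := RootPath.exists_isRight_isLeft hk hd h1 h2 hne
    have := fst_eq_of_chainMeasure_eq hθ hm hr.level_pos
    rw [hg.2.1 x hr, hg'.2.2 x hl] at this
    exact hlog this
  · obtain ⟨x, hr, hl⟩ := RootPath.exists_isRight_isLeft hk hd (fun j hj => (h1 j hj).symm) h2
      (Ne.symm hne)
    have := fst_eq_of_chainMeasure_eq hθ hm hr.level_pos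
    rw [hg'.2.1 x hr, hg.2.2 x hl] at this
    exact hlog this.symm

/-! ### The tree and its automorphisms -/

theorem tree_adj_iff {x y : Vertex k d} :
    (tree k d).Adj x y ↔ x ≠ y ∧ (y.parent = x ∨ x.parent = y) := by
  simp [tree, SimpleGraph.fromRel_adj]

theorem adj_child (x : Vertex k d) (c : Fin (branching k d x.level)) :
    (tree k d).Adj x (x.child c) :=
  tree_adj_iff.2 ⟨fun e => by have := congrArg Vertex.level e; simp at this, Or.inl rfl⟩

theorem reachable_root (x : Vertex k d) : (tree k d).Reachable x Vertex.root := by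
  obtain ⟨l, hl⟩ := x
  induction l with
  | nil => exact SimpleGraph.Reachable.refl _
  | cons c l ih =>
    exact (adj_child ⟨l, hl.2⟩ ⟨c, hl.1⟩).symm.reachable.trans (ih hl.2)

/-- `x` is at least `N` levels below `v`. -/
def DeepBelow (v : Vertex k d) (N : ℕ) (x : Vertex k d) : Prop :=
  ∃ e : List ℕ, N ≤ e.length ∧ x.code = e ++ v.code

theorem exists_deepBelow (hk : 2 ≤ k) (hd : k ≤ d) (v : Vertex k d) (N : ℕ) :
    ∃ x, DeepBelow v N x := by
  induction N with
  | zero => exact ⟨v, [], le_rfl, rfl⟩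
  | succ N ih =>
    obtain ⟨x, e, he, hx⟩ := ih
    have := branching_pos hk hd x.level
    exact ⟨x.child ⟨0, by omega⟩, 0 :: e, by simpa using he, by simp [Vertex.child, hx]⟩

theorem DeepBelow.of_adj {v : Vertex k d} {N : ℕ} {x x' : Vertex k d} (hx : DeepBelow v (N + 1) x)
    (ha : (tree k d).Adj x x') : DeepBelow v N x' := by
  obtain ⟨e, he, hx⟩ := hx
  obtain ⟨hne, ha | ha⟩ := tree_adj_iff.1 ha
  · obtain ⟨l, hl⟩ := x'
    cases l with
    | nil => exact absurd ha.symm hne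
    | cons c l =>
      refine ⟨c :: e, ?_, ?_⟩
      · rw [List.length_cons]; omega
      · rw [← ha] at hx
        simpa [Vertex.parent] using hx
  · cases e with
    | nil => simp at he
    | cons c e =>
      exact ⟨e, by simpa using he, by rw [← ha]; simp [Vertex.parent, hx]⟩

theorem DeepBelow.of_walk {v : Vertex k d} (g : tree k d ≃g tree k d) {x y : Vertex k d}
    (w : (tree k d).Walk x y) : ∀ {N : ℕ}, DeepBelow v (N + w.length) (g x) →
      DeepBelow v N (g y) := by
  induction w with
  | nil => exact fun h => h
  | cons ha w ih => exact fun h => ih (h.of_adj (g.map_adj_iff.2 ha))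

/-- A group of automorphisms with finitely many orbits moves every vertex below any vertex. -/
theorem exists_deepBelow_orbit (hk : 2 ≤ k) (hd : k ≤ d) {H : Subgroup (tree k d ≃g tree k d)}
    {F : Finset (Vertex k d)} (hF : ∀ x, ∃ y ∈ F, ∃ g ∈ H, g y = x) (v y : Vertex k d) :
    ∃ g ∈ H, DeepBelow v 0 (g y) := by
  have hw : ∀ x : Vertex k d, Nonempty ((tree k d).Walk x y) := fun x =>
    (reachable_root x).trans (reachable_root y).symm
  -- The vertex is taken deeper below `v` than the lengths of chosen walks from orbit
  -- representatives to `y`. It is the image of a representative, and the image of the walk to `y`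
  -- cannot climb above `v`.
  obtain ⟨x, hx⟩ := exists_deepBelow hk hd v (F.sup fun u => (hw u).some.length)
  obtain ⟨u, hu, g, hg, rfl⟩ := hF x
  refine ⟨g, hg, DeepBelow.of_walk g (hw u).some ?_⟩
  obtain ⟨e, he, hc⟩ := hx
  exact ⟨e, by
    have := Finset.le_sup (f := fun u => (hw u).some.length) hu
    omega, hc⟩

theorem exists_eq_child_of_adj {x z : Vertex k d} (ha : (tree k d).Adj x z) (hz : z ≠ x.parent) :
    ∃ c, z = x.child c := by
  obtain ⟨hne, ha | ha⟩ := tree_adj_iff.1 ha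
  · obtain ⟨l, hl⟩ := z
    cases l with
    | nil => exact absurd ha.symm hne
    | cons c l =>
      subst ha
      exact ⟨⟨c, hl.1⟩, rfl⟩
  · exact absurd ha.symm hz

/-- A vertex with three neighbours has a neighbour which two given automorphisms map to a
successor. -/
theorem exists_adj_map_child (hk : 2 ≤ k) (hd : k ≤ d) : ∃ y : Vertex k d,
    ∀ g g' : tree k d ≃g tree k d, ∃ z, (∃ c, g z = (g y).child c) ∧ ∃ c, g' z = (g' y).child c := by
  have hb := branching_pos hk hd
  -- A vertex at level 1 has a parent and at least two successors, while the root of the half tree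
  -- with k = 2 has only two neighbours.
  let y : Vertex k d := Vertex.root.child ⟨0, (hb _).trans' one_pos⟩
  let z₀ : Vertex k d := y.child ⟨0, (hb _).trans' one_pos⟩
  let z₁ : Vertex k d := y.child ⟨1, hb y.level⟩
  have h0 : (tree k d).Adj y z₀ := adj_child _ _
  have h1 : (tree k d).Adj y z₁ := adj_child _ _
  have hr : (tree k d).Adj y Vertex.root := (adj_child _ _).symm
  have h01 : z₀ ≠ z₁ := fun e => by simpa using child_injective y e
  have hr0 : Vertex.root ≠ z₀ := (child_ne_root y _).symm
  have hr1 : Vertex.root ≠ z₁ := (child_ne_root y _).symm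
  refine ⟨y, fun g g' => ?_⟩
  -- Each automorphism sends at most one neighbour of `y` to the parent of the image, so one of
  -- three neighbours is left.
  obtain ⟨z, hz, hg, hg'⟩ : ∃ z, (tree k d).Adj y z ∧ g z ≠ (g y).parent ∧
      g' z ≠ (g' y).parent := by
    by_contra! hcon
    have inj : ∀ (f : tree k d ≃g tree k d) u v, u ≠ v → f u = (f y).parent →
        f v ≠ (f y).parent := fun f u v huv hu hv => huv (f.injective (hu.trans hv.symm))
    by_cases a : g Vertex.root = (g y).parent
    · exact inj g' _ _ h01 (hcon _ h0 (inj g _ _ hr0 a)) (hcon _ h1 (inj g _ _ hr1 a))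
    · by_cases b : g z₀ = (g y).parent
      · exact inj g' _ _ hr1 (hcon _ hr a) (hcon _ h1 (inj g _ _ h01 b))
      · exact inj g' _ _ hr0 (hcon _ hr a) (hcon _ h0 b)
  exact ⟨z, exists_eq_child_of_adj (g.map_adj_iff.2 hz) hg,
    exists_eq_child_of_adj (g'.map_adj_iff.2 hz) hg'⟩

/-! ### Paths with numbers strictly between `0` and `1` -/

theorem DeepBelow.suffix {v x : Vertex k d} (h : DeepBelow v 0 x) : v.code <:+ x.code :=
  let ⟨e, _, hx⟩ := h
  ⟨e, hx.symm⟩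

theorem measureReal_zeroAnd_map {μ : Measure (Config k d)} {g : tree k d ≃g tree k d}
    (hg : μ.map (fun (ω : Config k d) (x : Vertex k d) => ω (g x)) = μ) (y z : Vertex k d)
    (s : SignType) : μ.real (zeroAnd (g y) (g z) s) = μ.real (zeroAnd y z s) := by
  have hm : Measurable fun (ω : Config k d) (x : Vertex k d) => ω (g x) :=
    measurable_pi_lambda _ fun _ => measurable_pi_apply _
  nth_rw 2 [← hg]
  rw [map_measureReal_apply hm (measurableSet_zeroAnd _ _ _)]
  rfl

/-- As the number is neither 0 nor 1, both sides of the path are nonempty. Group elements carry one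
oriented edge (y, z) to parent-child edges on either side; invariance equates the ratios read off
there, which are x₁ and x₂. -/
theorem not_isPeriodic_chainMeasure (hk : 2 ≤ k) (hd : k ≤ d) (hθ : 0 < θ) {x₁ x₂ : ℝ}
    (hx : x₁ ≠ x₂) (hs : IsConstantSolution k lam θ x₁ x₂) {π : RootPath k d}
    (hπ : IsPathLaw lam θ x₁ x₂ π h) (h0 : π.number ≠ 0) (h1 : π.number ≠ 1) :
    ¬ IsPeriodic (chainMeasure θ h) := by
  rintro ⟨H, ⟨F, hF⟩, hinv⟩
  have hb := branching_pos hk hd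
  obtain ⟨v, hv⟩ : ∃ v, π.IsRight v := by
    obtain ⟨n, hn⟩ : ∃ n, π.step n + 1 ≠ branching k d n := by
      by_contra! hcon
      exact h1 (π.number_eq_one hk hd hcon)
    have hlt := π.step_lt n
    exact ⟨_, π.isRight_child_vertex (n := n) ⟨π.step n + 1, by rw [π.level_vertex]; omega⟩
      (Nat.lt_succ_self _)⟩
  obtain ⟨v', hv'⟩ : ∃ v, π.IsLeft v := by
    obtain ⟨n, hn⟩ : ∃ n, π.step n ≠ 0 := by
      by_contra! hcon
      exact h0 (π.number_eq_zero hk hd hcon)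
    exact ⟨_, π.isLeft_child_vertex (n := n) ⟨0, by rw [π.level_vertex]; have := hb n; omega⟩
      (Nat.pos_of_ne_zero hn)⟩
  obtain ⟨y, hy⟩ := exists_adj_map_child hk hd
  obtain ⟨g, hg, hgy⟩ := exists_deepBelow_orbit hk hd hF v y
  obtain ⟨g', hg', hgy'⟩ := exists_deepBelow_orbit hk hd hF v' y
  obtain ⟨z, ⟨c, hc⟩, ⟨c', hc'⟩⟩ := hy g g'
  have hR : π.IsRight (g y) := by
    obtain ⟨n, a, ha, hsuf⟩ := hv
    exact ⟨n, a, ha, hsuf.trans hgy.suffix⟩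
  have hL : π.IsLeft (g' y) := by
    obtain ⟨n, a, ha, hsuf⟩ := hv'
    exact ⟨n, a, ha, hsuf.trans hgy'.suffix⟩
  have e1 := chainMeasure_zeroAnd_one (h := h) hθ (g y) c
  have e2 := chainMeasure_zeroAnd_one (h := h) hθ (g' y) c'
  rw [hπ.2.1 _ (hR.child c), Real.exp_log hs.1, ← hc, measureReal_zeroAnd_map (hinv g hg),
    measureReal_zeroAnd_map (hinv g hg)] at e1
  rw [hπ.2.2 _ (hL.child c'), Real.exp_log hs.2.1, ← hc', measureReal_zeroAnd_map (hinv g' hg'),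
    measureReal_zeroAnd_map (hinv g' hg')] at e2
  exact hx (mul_right_cancel₀ (chainMeasure_zeroAnd_zero_pos hθ y z).ne' (e1.symm.trans e2))

end

end WidomRowlinson

theorem mainTheorem9 (k d : ℕ) (hk : 2 ≤ k) (hd : d = k ∨ d = k + 1)
    (J β lam θ : ℝ) (hβ : 0 < β) (hθ : θ = Real.exp (-J * β))
    (hθ_low : 1 / 9 < θ) (hθ_high : θ < ((k : ℝ) - 1) / ((k : ℝ) + 1))
    (hlam : lamCr k θ < lam) :
    (∃ x₁ x₂ : ℝ, x₁ < x₂ ∧ IsConstantSolution k lam θ x₁ x₂) ∧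
    (∀ π : RootPath k d, π.number ∈ Set.Icc (0 : ℝ) 1) ∧
    (∀ t ∈ Set.Icc (0 : ℝ) 1, ∃ π : RootPath k d, π.number = t) ∧
    ∀ x₁ x₂ : ℝ, x₁ ≠ x₂ → IsConstantSolution k lam θ x₁ x₂ →
      ∃ (μ₁ μ₂ : MeasureTheory.Measure (Config k d))
        (h : ℝ → Vertex k d → ℝ × ℝ)
        (μ : ℝ → MeasureTheory.Measure (Config k d)),
        (∀ ν, IsSplittingGibbs J β lam (fun _ => (Real.log x₁, Real.log x₂)) ν ↔ ν = μ₁) ∧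
        (∀ ν, IsSplittingGibbs J β lam (fun _ => (Real.log x₂, Real.log x₁)) ν ↔ ν = μ₂) ∧
        (∀ (π : RootPath k d) (g : Vertex k d → ℝ × ℝ),
          IsPathLaw lam θ x₁ x₂ π g ↔ g = h π.number) ∧
        (∀ t ∈ Set.Icc (0 : ℝ) 1,
          (∀ ν, IsSplittingGibbs J β lam (h t) ν ↔ ν = μ t) ∧ IsExtremeGibbs J β lam (μ t)) ∧
        μ 0 = μ₁ ∧ μ 1 = μ₂ ∧
        Set.InjOn μ (Set.Icc (0 : ℝ) 1) ∧
        ∀ t ∈ Set.Ioo (0 : ℝ) 1, ¬ IsPeriodic (μ t) := by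
  have hkd : k ≤ d := by omega
  have hθ0 : 0 < θ := by linarith
  have hθ1 : θ < 1 := hθ_high.trans_le (div_le_one_of_le₀ (by linarith) (by positivity))
  have hl : 0 < lam := (lamCr_pos hk hθ_high).trans hlam
  refine ⟨exists_isConstantSolution hk hθ0 hθ_high hlam, RootPath.number_mem_Icc hk hkd,
    fun t ht => RootPath.exists_number_eq hk hkd ht, fun x₁ x₂ hx hs => ?_⟩
  choose p hp using fun t (ht : t ∈ Set.Icc (0 : ℝ) 1) =>
    RootPath.exists_number_eq (k := k) (d := d) hk hkd ht
  choose G hG using fun π : RootPath k d => RootPath.exists_isPathLaw hθ_low hθ1.le hl hkd hs π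
  classical
  -- The value 0 outside [0, 1] is irrelevant. Inside, the law of one chosen path with number t
  -- serves all paths with that number.
  let h : ℝ → Vertex k d → ℝ × ℝ := fun t => if ht : t ∈ Set.Icc (0 : ℝ) 1 then G (p t ht) else 0
  have hh : ∀ π : RootPath k d, IsPathLaw lam θ x₁ x₂ π (h π.number) := by
    intro π
    have ht := RootPath.number_mem_Icc hk hkd π
    simp only [h, dif_pos ht]
    exact RootPath.isPathLaw_of_number_eq hk hθ_low hθ1.le hl hkd hs (hp _ ht) (hG _)
  have hh' : ∀ t ∈ Set.Icc (0 : ℝ) 1, ∃ π : RootPath k d, π.number = t ∧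
      IsPathLaw lam θ x₁ x₂ π (h t) := fun t ht => ⟨p t ht, hp t ht, by
    simpa only [hp t ht] using hh (p t ht)⟩
  have hsplit : ∀ t ∈ Set.Icc (0 : ℝ) 1, ∀ ν, IsSplittingGibbs J β lam (h t) ν ↔
      ν = chainMeasure θ (h t) := fun t ht ν => by
    obtain ⟨π, -, hπ⟩ := hh' t ht
    exact isSplittingGibbs_iff hβ hθ hl hπ.1 ν
  refine ⟨chainMeasure θ (h 0), chainMeasure θ (h 1), h, fun t => chainMeasure θ (h t),
    fun ν => ?_, fun ν => ?_, fun π g => ⟨fun hg => ?_, fun hg => hg ▸ hh π⟩,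
    fun t ht => ⟨hsplit t ht, ?_⟩, rfl, rfl, fun t ht t' ht' hm => ?_, fun t ht => ?_⟩
  · let π : RootPath k d := ⟨fun _ => 0, fun n => (branching_pos hk hkd n).trans' one_pos⟩
    have h0 : π.number = 0 := RootPath.number_eq_zero hk hkd π fun _ => rfl
    rw [← hsplit 0 (by simp) ν]
    -- The law of the leftmost path is the constant function except possibly at the root, and the
    -- root value does not matter.
    refine isSplittingGibbs_congr (fun x hx' => ?_) ν
    exact (RootPath.isPathLaw_leftmost hθ_low hθ1.le hl hkd hs (fun _ => rfl) (h0 ▸ hh π) hx').symm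
  · have hb := branching_pos (k := k) hk hkd
    let π : RootPath k d := ⟨fun n => branching k d n - 1, fun n => by have := hb n; omega⟩
    have hlast : ∀ n, π.step n + 1 = branching k d n := fun n => by
      have := hb n
      change branching k d n - 1 + 1 = _
      omega
    have h1 : π.number = 1 := RootPath.number_eq_one hk hkd π hlast
    rw [← hsplit 1 (by simp) ν]
    refine isSplittingGibbs_congr (fun x hx' => ?_) ν
    exact (RootPath.isPathLaw_rightmost hθ_low hθ1.le hl hkd hs hlast (h1 ▸ hh π) hx').symm
  · exact RootPath.isPathLaw_unique hθ_low hθ1.le hkd π hg (hh π)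
  · obtain ⟨π, -, hπ⟩ := hh' t ht
    exact isExtremeGibbs_chainMeasure hβ hθ hθ1.le hl hkd hπ.1 hk hθ_low hθ1 hx hs hπ
  · obtain ⟨π, rfl, hπ⟩ := hh' t ht
    obtain ⟨π', rfl, hπ'⟩ := hh' t' ht'
    exact number_eq_of_chainMeasure_eq hk hkd hθ0 hx hs hπ hπ' hm
  · obtain ⟨π, rfl, hπ⟩ := hh' t (Set.Ioo_subset_Icc_self ht)
    exact not_isPeriodic_chainMeasure hk hkd hθ0 hx hs hπ ht.1.ne' ht.2.ne
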